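/- Let $\mathbb A=\mathbb A_{\mathbb Q}$ and let $G=\mathbb G_a\rtimes\mathbb G_m$ with $(x,a)(y,b)=(x+ay,ab)$. Let $dx=\prod_v dx_v$ and $da^\times=\prod_v da_v^\times$ be the standard Haar measures on $\mathbb A$ and $\mathbb A^\times$ (Lebesgue measure on $\mathbb R$, $dr/|r|$ on $\mathbb R^\times$, $\mathrm{vol}(\mathbb Z_p)=\mathrm{vol}(\mathbb Z_p^\times)=1$), and let $dg=dx\,da^\times$ be the right Haar measure on $G(\mathbb A)$. Let $\psi=\prod_v\psi_v$ be the standard additive character of $\mathbb Q\backslash\mathbb A$, $\psi_\infty(x)=e^{-2\pi i x}$, $\psi_p(x)=e^{2\pi i\{x\}_p}$. Let $\mathcal H=\mathsf L^2(G(\mathbb Q)\backslash G(\mathbb A),dg)$, let $\mathcal H_0$ be the subspace of all $\phi\in\mathcal H$ with $\phi((x,1)g)=\phi(g)$ for all $x\in\mathbb A$, and let $\mathcal H_1=\mathcal H_0^{\perp}$. Let $n_p\ge 0$ be integers, zero for almost all primes $p$; put $S=\{p: n_p\ne 0\}$ and $N=\prod_p p^{n_p}$. Let $\mathbf K=\prod_p\mathbf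 K_p\cdot\mathbf K_\infty\subset G(\mathbb A)$, where $\mathbf K_\infty=\{(0,\pm1)\}$, $\mathbf K_p=\mathbb Z_p\rtimes\mathbb Z_p^\times$ if $n_p=0$, and $\mathbf K_p=\{(x,a): x\in p^{n_p}\mathbb Z_p,\ a\in 1+p^{n_p}\mathbb Z_p\}$ if $n_p\ge1$. Let $\mathcal H_1^{\mathbf K}$ be the space of vectors of $\mathcal H_1$ fixed under right translation by $\mathbf K$. Let $\mathsf M=\prod_{p\in S}\mathsf M_p$, where $\mathsf M_p$ is the (finite) set of characters of $\mathbb Z_p^\times/(1+p^{n_p}\mathbb Z_p)$. For $m\ge1$ and $\lambda=(\lambda_p)\in\mathsf M$ define on the finite ideles $$\mathbf v_{m,\lambda}(a)=\prod_{p\in S}\lambda_p\bigl(a_p p^{-v_p(a_p)}\bigr)\mathbf 1_{\frac mN\mathbb Z_p^\times}(a_p)\prod_{p\notin S}\mathbf 1_{m\mathbb Z_p^\times}(a_p),$$ and for $t\in\mathbb R$ and $g=(x,a)\in G(\mathbb A)$ define $$\theta_{m,\lambda,t}(g)=\sum_{\alpha\in\mathbb Q^\times}\psi(\alpha x)\,\mathbf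 v_{m,\lambda}(\alpha a_{\mathrm{fin}})\,|\alpha a_\infty|_\infty^{it},$$ which is left $G(\mathbb Q)$-invariant. For $f\in\mathcal H_1$ let $I(f)(a)=\int_{\mathbb Q\backslash\mathbb A}f(x,a)\overline{\psi(x)}\,dx$ for almost every $a\in\mathbb A^\times$. **Proposition.** Let $f\in\mathcal H_1^{\mathbf K}$. Suppose that 1. $I(f)$ is integrable on $\mathbb A^\times$ with respect to $da^\times$; 2. for all $m\ge1$ and $\lambda\in\mathsf M$, the function $t\mapsto(f,\theta_{m,\lambda,t})$ is integrable on $\mathbb R$, where $(f,\theta_{m,\lambda,t})=\int_{G(\mathbb Q)\backslash G(\mathbb A)}f(g)\overline{\theta_{m,\lambda,t}(g)}\,dg$. Then for almost every $g$ $$f(g)=\sum_{\lambda\in\mathsf M}\sum_{m=1}^{\infty}\frac1{4\pi}\int_{-\infty}^{+\infty}(f,\theta_{m,\lambda,t})\,\theta_{m,\lambda,t}(g)\,dt.$$ Here the integrals defining $(f,\theta_{m,\lambda,t})$ and the integrals over $t$ converge absolutely, and for almost every $g$ the series over $m$ converges absolutely for each $\lambda$. -/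

import Mathlib

open MeasureTheory Filter Topology
open scoped RestrictedProduct ENNReal ComplexConjugate

noncomputable section

namespace AxPlusB

instance primeFact (p : Nat.Primes) : Fact (p : ℕ).Prime := ⟨p.2⟩

/-! ### Adeles and ideles of `ℚ` -/

/-- The ring of finite adeles of `ℚ`: the restricted product of the `ℚ_p` with respect to the
`ℤ_p`, with the restricted product topology. -/
abbrev FinAdele : Type :=
  Πʳ p : Nat.Primes, [ℚ_[(p : ℕ)], PadicInt.subring (p : ℕ)]

/-- The group of finite ideles of `ℚ`: the restricted product of the `ℚ_pˣ` with respect to the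
`ℤ_pˣ`, with the restricted product topology. -/
abbrev FinIdele : Type :=
  Πʳ p : Nat.Primes, [ℚ_[(p : ℕ)]ˣ, (Submonoid.ofClass (PadicInt.subring (p : ℕ))).units]

/-- The adele ring of `ℚ`; the first component is the real one. -/
abbrev Adele : Type := ℝ × FinAdele

/-- The idele group of `ℚ`; the first component is the real one. -/
abbrev Idele : Type := ℝˣ × FinIdele

theorem isOpen_subring (p : Nat.Primes) :
    IsOpen ((PadicInt.subring (p : ℕ) : Set ℚ_[(p : ℕ)])) := by
  have : (PadicInt.subring (p : ℕ) : Set ℚ_[(p : ℕ)]) = Metric.closedBall 0 1 := by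
    ext x
    simp [PadicInt.mem_subring_iff]
  rw [this]
  exact IsUltrametricDist.isOpen_closedBall _ one_ne_zero

theorem isCompact_subring (p : Nat.Primes) :
    IsCompact ((PadicInt.subring (p : ℕ) : Set ℚ_[(p : ℕ)])) := by
  have : (PadicInt.subring (p : ℕ) : Set ℚ_[(p : ℕ)]) = Metric.closedBall 0 1 := by
    ext x
    simp [PadicInt.mem_subring_iff]
  rw [this]
  exact isCompact_closedBall _ _

instance factOpenSubring :
    Fact (∀ p : Nat.Primes, IsOpen ((PadicInt.subring (p : ℕ) : Set ℚ_[(p : ℕ)]))) :=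
  ⟨isOpen_subring⟩

instance factOpenUnits :
    Fact (∀ p : Nat.Primes, IsOpen
      (((Submonoid.ofClass (PadicInt.subring (p : ℕ))).units : Subgroup ℚ_[(p : ℕ)]ˣ) :
        Set ℚ_[(p : ℕ)]ˣ)) :=
  ⟨fun p => Submonoid.isOpen_units (isOpen_subring p)⟩

/-- The inclusion of the ideles into the adeles. -/
def Idele.toAdele : Idele →* Adele :=
  (Units.coeHom ℝ).prodMap ((Units.coeHom FinAdele).comp
    (RestrictedProduct.unitsEquiv (fun p : Nat.Primes => ℚ_[(p : ℕ)])).symm.toMonoidHom)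

theorem mem_units_iff (p : Nat.Primes) (u : ℚ_[(p : ℕ)]ˣ) :
    u ∈ (Submonoid.ofClass (PadicInt.subring (p : ℕ))).units ↔ ‖(u : ℚ_[(p : ℕ)])‖ = 1 := by
  have hu : 0 < ‖(u : ℚ_[(p : ℕ)])‖ := norm_pos_iff.2 u.ne_zero
  rw [Submonoid.mem_units_iff]
  change ‖(u : ℚ_[(p : ℕ)])‖ ≤ 1 ∧ ‖((u⁻¹ : ℚ_[(p : ℕ)]ˣ) : ℚ_[(p : ℕ)])‖ ≤ 1 ↔ _
  rw [Units.val_inv_eq_inv_val, norm_inv, inv_le_one₀ hu]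
  exact ⟨fun h => le_antisymm h.1 h.2, fun h => ⟨h.le, h.ge⟩⟩

theorem finite_dvd (d : ℕ) (hd : d ≠ 0) : {p : Nat.Primes | (p : ℕ) ∣ d}.Finite := by
  refine Set.Finite.of_finite_image (f := fun p : Nat.Primes => (p : ℕ)) ?_
    (fun a _ b _ h => Subtype.ext h)
  refine (d.divisors.finite_toSet).subset ?_
  rintro _ ⟨p, hp, rfl⟩
  simpa using ⟨hp, hd⟩

theorem eventually_norm_rat_le (q : ℚ) :
    ∀ᶠ p : Nat.Primes in cofinite, ‖(q : ℚ_[(p : ℕ)])‖ ≤ 1 := by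
  refine ((finite_dvd q.den q.den_ne_zero).subset ?_)
  intro p hp
  by_contra h
  exact hp (Padic.norm_rat_le_one h)

/-- The diagonal embedding `ℚ → 𝔸`. -/
def ratAdele : ℚ →+* Adele :=
  (Rat.castHom ℝ).prod
    { toFun := fun q => RestrictedProduct.mk (fun p : Nat.Primes => (q : ℚ_[(p : ℕ)]))
        (eventually_norm_rat_le q)
      map_one' := by ext p; simp
      map_mul' := by intro a b; ext p; exact Rat.cast_mul a b
      map_zero' := by ext p; simp
      map_add' := by intro a b; ext p; exact Rat.cast_add a b }

theorem eventually_units_rat (q : ℚˣ) : ∀ᶠ p : Nat.Primes in cofinite,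
    Units.map ((Rat.castHom ℚ_[(p : ℕ)] : ℚ →+* ℚ_[(p : ℕ)]) : ℚ →* ℚ_[(p : ℕ)]) q ∈
      (Submonoid.ofClass (PadicInt.subring (p : ℕ))).units := by
  filter_upwards [eventually_norm_rat_le (q : ℚ), eventually_norm_rat_le ((q⁻¹ : ℚˣ) : ℚ)]
    with p h1 h2
  rw [Submonoid.mem_units_iff]
  refine ⟨h1, ?_⟩
  have : ((q⁻¹ : ℚˣ) : ℚ) = (q : ℚ)⁻¹ := by simp
  rw [this] at h2
  change ‖_‖ ≤ (1 : ℝ)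
  simpa using h2

/-- The diagonal embedding `ℚˣ → 𝔸ˣ`. -/
def ratIdele : ℚˣ →* Idele :=
  (Units.map ((Rat.castHom ℝ : ℚ →+* ℝ) : ℚ →* ℝ)).prod
    { toFun := fun q => RestrictedProduct.mk (fun p : Nat.Primes =>
          Units.map ((Rat.castHom ℚ_[(p : ℕ)] : ℚ →+* ℚ_[(p : ℕ)]) : ℚ →* ℚ_[(p : ℕ)]) q)
        (eventually_units_rat q)
      map_one' := by ext p; simp
      map_mul' := by intro a b; ext p; simp }

theorem toAdele_ratIdele (q : ℚˣ) : (ratIdele q).toAdele = ratAdele (q : ℚ) := rfl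

/-! ### Haar measures -/

instance : MeasurableSpace FinAdele := borel _
instance : BorelSpace FinAdele := ⟨rfl⟩
instance : MeasurableSpace FinIdele := borel _
instance : BorelSpace FinIdele := ⟨rfl⟩

/-- `∏_p ℤ_p`, as a compact subset of the finite adeles with non-empty interior. -/
def zHat : TopologicalSpace.PositiveCompacts FinAdele where
  carrier := {x | ∀ p : Nat.Primes, x p ∈ PadicInt.subring (p : ℕ)}
  isCompact' := by
    have : ∀ p : Nat.Primes, CompactSpace (PadicInt.subring (p : ℕ) : Set ℚ_[(p : ℕ)]) :=
      fun p => isCompact_iff_compactSpace.1 (isCompact_subring p)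
    have h := isCompact_range (RestrictedProduct.isEmbedding_structureMap
      (R := fun p : Nat.Primes => ℚ_[(p : ℕ)])
      (A := fun p : Nat.Primes => (PadicInt.subring (p : ℕ) : Set ℚ_[(p : ℕ)]))
      (𝓕 := cofinite)).continuous
    rw [RestrictedProduct.range_structureMap] at h
    exact h
  interior_nonempty' := by
    have h := RestrictedProduct.isOpen_forall_mem
      (R := fun p : Nat.Primes => ℚ_[(p : ℕ)])
      (A := fun p : Nat.Primes => (PadicInt.subring (p : ℕ) : Set ℚ_[(p : ℕ)])) isOpen_subring
    exact ⟨0, (interior_maximal subset_rfl h) fun p => (PadicInt.subring (p : ℕ)).zero_mem⟩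

/-- `∏_p ℤ_pˣ`, as a compact subset of the finite ideles with non-empty interior. -/
def zHatUnits : TopologicalSpace.PositiveCompacts FinIdele where
  carrier := {a | ∀ p : Nat.Primes, a p ∈ (Submonoid.ofClass (PadicInt.subring (p : ℕ))).units}
  isCompact' := by
    have : ∀ p : Nat.Primes, CompactSpace
        ((Submonoid.ofClass (PadicInt.subring (p : ℕ))).units : Set ℚ_[(p : ℕ)]ˣ) :=
      fun p => isCompact_iff_compactSpace.1 (Submonoid.units_isCompact (isCompact_subring p))
    have h := isCompact_range (RestrictedProduct.isEmbedding_structureMap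
      (R := fun p : Nat.Primes => ℚ_[(p : ℕ)]ˣ)
      (A := fun p : Nat.Primes =>
        ((Submonoid.ofClass (PadicInt.subring (p : ℕ))).units : Set ℚ_[(p : ℕ)]ˣ))
      (𝓕 := cofinite)).continuous
    rw [RestrictedProduct.range_structureMap] at h
    exact h
  interior_nonempty' := by
    have h := RestrictedProduct.isOpen_forall_mem
      (R := fun p : Nat.Primes => ℚ_[(p : ℕ)]ˣ)
      (A := fun p : Nat.Primes =>
        ((Submonoid.ofClass (PadicInt.subring (p : ℕ))).units : Set ℚ_[(p : ℕ)]ˣ))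
      (fun p => Submonoid.isOpen_units (isOpen_subring p))
    exact ⟨1, (interior_maximal subset_rfl h) fun p => one_mem _⟩

/-- The Haar measure `dx` on `𝔸`: Lebesgue measure on `ℝ` times the Haar measure on the finite
adeles for which `∏_p ℤ_p` has volume one. -/
def adeleMeasure : Measure Adele :=
  (volume : Measure ℝ).prod (Measure.addHaarMeasure zHat)

/-- The Haar measure `dr/|r|` on `ℝˣ`. -/
def realUnitsMeasure : Measure ℝˣ :=
  ((volume : Measure ℝ).withDensity fun r => ENNReal.ofReal |r|⁻¹).comap Units.val

/-- The Haar measure `da^×` on `𝔸ˣ`: `dr/|r|` on `ℝˣ` times the Haar measure on the finite ideles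
for which `∏_p ℤ_pˣ` has volume one. -/
def ideleMeasure : Measure Idele :=
  realUnitsMeasure.prod (Measure.haarMeasure zHatUnits)

/-! ### The group `G(𝔸) = 𝔸 ⋊ 𝔸ˣ`, its rational points and the automorphic quotient -/

/-- The adelic points of `G = 𝔾_a ⋊ 𝔾_m`: pairs `(x, a)` with
`(x, a) (y, b) = (x + a y, a b)`. -/
def GA : Type := Adele × Idele

namespace GA

instance : MeasurableSpace GA := inferInstanceAs (MeasurableSpace (Adele × Idele))

/-- The element `(x, a)` of `G(𝔸)`. -/
def mk (x : Adele) (a : Idele) : GA := (x, a)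

/-- The additive coordinate. -/
def x (g : GA) : Adele := Prod.fst g

/-- The multiplicative coordinate. -/
def a (g : GA) : Idele := Prod.snd g

@[ext] theorem ext {g h : GA} (hx : g.x = h.x) (ha : g.a = h.a) : g = h := Prod.ext hx ha

instance : Mul GA := ⟨fun g h => mk (g.x + g.a.toAdele * h.x) (g.a * h.a)⟩
instance : One GA := ⟨mk 0 1⟩
instance : Inv GA := ⟨fun g => mk (-(g.a⁻¹.toAdele * g.x)) g.a⁻¹⟩

@[simp] theorem mk_x (x : Adele) (a : Idele) : (mk x a).x = x := rfl
@[simp] theorem mk_a (x : Adele) (a : Idele) : (mk x a).a = a := rfl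
@[simp] theorem mul_x (g h : GA) : (g * h).x = g.x + g.a.toAdele * h.x := rfl
@[simp] theorem mul_a (g h : GA) : (g * h).a = g.a * h.a := rfl
@[simp] theorem one_x : (1 : GA).x = 0 := rfl
@[simp] theorem one_a : (1 : GA).a = 1 := rfl
@[simp] theorem inv_x (g : GA) : (g⁻¹).x = -(g.a⁻¹.toAdele * g.x) := rfl
@[simp] theorem inv_a (g : GA) : (g⁻¹).a = g.a⁻¹ := rfl

instance : Group GA :=
  Group.ofLeftAxioms
    (by
      intro g h k
      apply GA.ext
      · rw [mul_x, mul_x, mul_x, mul_x, mul_a, map_mul]; ring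
      · rw [mul_a, mul_a, mul_a, mul_a, mul_assoc])
    (by
      intro g
      apply GA.ext
      · rw [mul_x, one_x, one_a, map_one, one_mul, zero_add]
      · rw [mul_a, one_a, one_mul])
    (by
      intro g
      apply GA.ext
      · rw [mul_x, inv_x, inv_a, one_x, neg_add_cancel]
      · rw [mul_a, inv_a, one_a, inv_mul_cancel])

/-- The right Haar measure `dg = dx da^×` on `G(𝔸)`. -/
def haar : Measure GA := adeleMeasure.prod ideleMeasure

/-- The subgroup `G(ℚ)` of `G(𝔸)`, embedded diagonally. -/
def rational : Subgroup GA where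
  carrier := {g | ∃ (β : ℚ) (α : ℚˣ), g = mk (ratAdele β) (ratIdele α)}
  one_mem' := ⟨0, 1, GA.ext (by rw [mk_x, map_zero, one_x]) (by rw [mk_a, map_one, one_a])⟩
  mul_mem' := by
    rintro _ _ ⟨β, α, rfl⟩ ⟨β', α', rfl⟩
    refine ⟨β + α * β', α * α', GA.ext ?_ ?_⟩
    · rw [mul_x, mk_x, mk_x, mk_x, mk_a, toAdele_ratIdele, map_add, map_mul]
    · rw [mul_a, mk_a, mk_a, mk_a, map_mul]
  inv_mem' := by
    rintro _ ⟨β, α, rfl⟩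
    refine ⟨-((α⁻¹ : ℚˣ) * β), α⁻¹, GA.ext ?_ ?_⟩
    · rw [inv_x, mk_x, mk_x, mk_a, ← map_inv, toAdele_ratIdele, map_neg, map_mul]
    · rw [inv_a, mk_a, mk_a, map_inv]

end GA

/-! ### The standard additive character of `𝔸/ℚ` -/

section Frac

variable (p : ℕ) [Fact p.Prime]

theorem exists_fracPart (x : ℚ_[p]) : ∃ r : ℚ, (0 ≤ r ∧ r < 1) ∧
    (∃ (k : ℕ) (j : ℤ), r * (p : ℚ) ^ k = j) ∧ ‖x - (r : ℚ_[p])‖ ≤ 1 := by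
  have hp0 : (p : ℚ_[p]) ≠ 0 := by exact_mod_cast (Fact.out : p.Prime).ne_zero
  have hpq : (0 : ℚ) < p := by exact_mod_cast (Fact.out : p.Prime).pos
  have hpr : (0 : ℝ) < p := by exact_mod_cast (Fact.out : p.Prime).pos
  obtain ⟨k, hk⟩ : ∃ k : ℕ, ‖x‖ ≤ (p : ℝ) ^ k :=
    pow_unbounded_of_one_lt ‖x‖ (by exact_mod_cast (Fact.out : p.Prime).one_lt) |>.imp
      fun _ h => h.le
  have hy : ‖x * (p : ℚ_[p]) ^ k‖ ≤ 1 := by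
    rw [norm_mul, norm_pow, Padic.norm_p, inv_pow, ← div_eq_mul_inv]
    exact div_le_one_of_le₀ hk (by positivity)
  set y : ℤ_[p] := ⟨x * (p : ℚ_[p]) ^ k, hy⟩ with hydef
  refine ⟨(y.appr k : ℚ) / (p : ℚ) ^ k, ⟨by positivity, ?_⟩, ⟨k, (y.appr k : ℤ), ?_⟩, ?_⟩
  · rw [div_lt_one (by positivity)]
    exact_mod_cast y.appr_lt k
  · push_cast
    field_simp
  · have h := (PadicInt.norm_le_pow_iff_mem_span_pow _ k).2 (y.appr_spec k)
    have hxy : x - (((y.appr k : ℚ) / (p : ℚ) ^ k : ℚ) : ℚ_[p]) =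
        ((y - (y.appr k : ℤ_[p]) : ℤ_[p]) : ℚ_[p]) * ((p : ℚ_[p]) ^ k)⁻¹ := by
      push_cast
      rw [hydef]
      field_simp
    rw [hxy, norm_mul, norm_inv, norm_pow, Padic.norm_p, inv_pow, inv_inv]
    calc _ ≤ (p : ℝ) ^ (-(k : ℤ)) * (p : ℝ) ^ k := by gcongr; exact h
      _ = 1 := by rw [zpow_neg, zpow_natCast]; field_simp

/-- The `p`-adic fractional part `{x}_p`: the element of `ℤ[1/p] ∩ [0, 1)` with
`x - {x}_p ∈ ℤ_p`. -/
def fracPart (x : ℚ_[p]) : ℚ := (exists_fracPart p x).choose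

theorem fracPart_nonneg (x : ℚ_[p]) : 0 ≤ fracPart p x := (exists_fracPart p x).choose_spec.1.1
theorem fracPart_lt_one (x : ℚ_[p]) : fracPart p x < 1 := (exists_fracPart p x).choose_spec.1.2
theorem fracPart_den (x : ℚ_[p]) : ∃ (k : ℕ) (j : ℤ), fracPart p x * (p : ℚ) ^ k = j :=
  (exists_fracPart p x).choose_spec.2.1
theorem norm_sub_fracPart (x : ℚ_[p]) : ‖x - (fracPart p x : ℚ_[p])‖ ≤ 1 :=
  (exists_fracPart p x).choose_spec.2.2

variable {p}

theorem norm_add_le_one {x y : ℚ_[p]} (hx : ‖x‖ ≤ 1) (hy : ‖y‖ ≤ 1) : ‖x + y‖ ≤ 1 :=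
  (Padic.nonarchimedean x y).trans (max_le hx hy)

theorem norm_sub_le_one {x y : ℚ_[p]} (hx : ‖x‖ ≤ 1) (hy : ‖y‖ ≤ 1) : ‖x - y‖ ≤ 1 := by
  rw [sub_eq_add_neg]
  exact norm_add_le_one hx (by rwa [norm_neg])

theorem not_dvd_den {r : ℚ} (h : ‖(r : ℚ_[p])‖ ≤ 1) : ¬ p ∣ r.den := by
  have h1 := PadicInt.isUnit_iff.1 (PadicInt.isUnit_den r h)
  intro hd
  have h2 : ‖((r.den : ℕ) : ℚ_[p])‖ < 1 := Padic.norm_natCast_lt_one_iff.2 hd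
  have h3 : ‖((r.den : ℕ) : ℚ_[p])‖ = 1 := by exact_mod_cast h1
  linarith

theorem den_dvd {r : ℚ} (h : ∃ (k : ℕ) (j : ℤ), r * (p : ℚ) ^ k = j) :
    ∃ k : ℕ, r.den ∣ p ^ k := by
  obtain ⟨k, j, hj⟩ := h
  have hpq : (p : ℚ) ≠ 0 := by exact_mod_cast (Fact.out : p.Prime).ne_zero
  refine ⟨k, ?_⟩
  have hr : r = (j : ℚ) / ((p ^ k : ℕ) : ℤ) := by
    push_cast
    rw [← hj]
    field_simp
  have := Rat.den_dvd j ((p ^ k : ℕ) : ℤ)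
  rw [← Rat.divInt_eq_div, ] at hr
  rw [hr]
  exact_mod_cast this

theorem isInt_of_local {r : ℚ} (h : ∃ (k : ℕ) (j : ℤ), r * (p : ℚ) ^ k = j)
    (h1 : ‖(r : ℚ_[p])‖ ≤ 1) : ∃ j : ℤ, r = j := by
  obtain ⟨k, hk⟩ := den_dvd h
  have hc : Nat.Coprime r.den (p ^ k) :=
    (((Fact.out : p.Prime).coprime_iff_not_dvd.2 (not_dvd_den h1)).symm).pow_right k
  have : r.den = 1 := Nat.Coprime.eq_one_of_dvd hc hk
  exact ⟨r.num, (Rat.den_eq_one_iff r).1 this |>.symm⟩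

theorem norm_le_one_of_ne {ℓ : ℕ} [Fact ℓ.Prime] (hne : ℓ ≠ p) {r : ℚ}
    (h : ∃ (k : ℕ) (j : ℤ), r * (p : ℚ) ^ k = j) : ‖(r : ℚ_[ℓ])‖ ≤ 1 := by
  obtain ⟨k, hk⟩ := den_dvd h
  refine Padic.norm_rat_le_one fun hd => hne ?_
  exact (Nat.prime_dvd_prime_iff_eq Fact.out Fact.out).1
    ((Fact.out : ℓ.Prime).dvd_of_dvd_pow (hd.trans hk))

theorem fracPart_add (x y : ℚ_[p]) :
    ∃ j : ℤ, fracPart p (x + y) = fracPart p x + fracPart p y + j := by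
  obtain ⟨k1, j1, h1⟩ := fracPart_den p (x + y)
  obtain ⟨k2, j2, h2⟩ := fracPart_den p x
  obtain ⟨k3, j3, h3⟩ := fracPart_den p y
  obtain ⟨j, hj⟩ := isInt_of_local (p := p)
    (r := fracPart p (x + y) - fracPart p x - fracPart p y)
    ⟨k1 + k2 + k3, j1 * p ^ (k2 + k3) - j2 * p ^ (k1 + k3) - j3 * p ^ (k1 + k2), by
      push_cast
      rw [← h1, ← h2, ← h3]
      ring⟩ (by
      have h := norm_sub_le_one (norm_add_le_one (norm_sub_fracPart p x) (norm_sub_fracPart p y))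
        (norm_sub_fracPart p (x + y))
      convert! h using 2
      push_cast
      ring)
  exact ⟨j, by rw [← hj]; ring⟩

theorem fracPart_of_norm_le {x : ℚ_[p]} (hx : ‖x‖ ≤ 1) : fracPart p x = 0 := by
  obtain ⟨j, hj⟩ := isInt_of_local (fracPart_den p x) (by
    have h := norm_sub_le_one hx (norm_sub_fracPart p x)
    simpa using h)
  have h0 := fracPart_nonneg p x
  have h1 := fracPart_lt_one p x
  rw [hj] at h0 h1 ⊢
  have a : 0 ≤ j := by exact_mod_cast h0
  have b : j < 1 := by exact_mod_cast h1
  have : j = 0 := by omega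
  simp [this]

theorem circle_exp_add_int (x : ℝ) (j : ℤ) :
    Circle.exp (2 * Real.pi * (x + j)) = Circle.exp (2 * Real.pi * x) :=
  Circle.exp_eq_exp.2 ⟨j, by ring⟩

variable (p)

/-- The local character `ψ_p(x) = exp(2πi {x}_p)` of `ℚ_p`. -/
def psiLocal : AddChar ℚ_[p] Circle where
  toFun x := Circle.exp (2 * Real.pi * (fracPart p x : ℝ))
  map_zero_eq_one' := by rw [fracPart_of_norm_le (by simp)]; simp
  map_add_eq_mul' x y := by
    obtain ⟨j, hj⟩ := fracPart_add x y
    rw [hj]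
    push_cast
    rw [circle_exp_add_int, mul_add, Circle.exp_add]

theorem psiLocal_of_norm_le {x : ℚ_[p]} (hx : ‖x‖ ≤ 1) : psiLocal p x = 1 := by
  change Circle.exp (2 * Real.pi * (fracPart p x : ℝ)) = 1
  rw [fracPart_of_norm_le hx]
  simp

end Frac

theorem finite_psiLocal (x : FinAdele) :
    (Function.mulSupport fun p : Nat.Primes => psiLocal (p : ℕ) (x p)).Finite := by
  refine Set.Finite.subset (x.2 : ∀ᶠ p in cofinite, _) ?_
  intro p hp h
  exact hp (psiLocal_of_norm_le (p : ℕ) h)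

/-- The standard character `ψ = ∏_v ψ_v` of `𝔸`, with `ψ_∞(x) = exp(-2πi x)` and
`ψ_p(x) = exp(2πi {x}_p)`. It is trivial on `ℚ`, see `psi_ratAdele`. -/
def psi : AddChar Adele Circle where
  toFun x := Circle.exp (-(2 * Real.pi * x.1)) * ∏ᶠ p : Nat.Primes, psiLocal (p : ℕ) (x.2 p)
  map_zero_eq_one' := by
    have : ∀ p : Nat.Primes, psiLocal (p : ℕ) ((0 : Adele).2 p) = 1 :=
      fun p => AddChar.map_zero_eq_one _
    rw [finprod_congr this]
    simp
  map_add_eq_mul' x y := by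
    have h : ∀ p : Nat.Primes, psiLocal (p : ℕ) ((x + y).2 p) =
        psiLocal (p : ℕ) (x.2 p) * psiLocal (p : ℕ) (y.2 p) :=
      fun p => AddChar.map_add_eq_mul _ _ _
    simp_rw [h]
    rw [finprod_mul_distrib (finite_psiLocal x.2) (finite_psiLocal y.2), Prod.fst_add, mul_add,
      neg_add, Circle.exp_add]
    exact mul_mul_mul_comm _ _ _ _

theorem isInt_of_norm_le {r : ℚ} (h : ∀ p : Nat.Primes, ‖(r : ℚ_[(p : ℕ)])‖ ≤ 1) :
    ∃ j : ℤ, r = j := by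
  have : r.den = 1 := by
    by_contra hd
    obtain ⟨p, hp, hpd⟩ := Nat.exists_prime_and_dvd hd
    have : Fact p.Prime := ⟨hp⟩
    exact not_dvd_den (p := p) (h ⟨p, hp⟩) hpd
  exact ⟨r.num, (Rat.den_eq_one_iff r).1 this |>.symm⟩

/-- Every finite adele is the sum of a rational number and an element of `∏_p ℤ_p`. -/
theorem exists_rat_sub_mem (x : FinAdele) : ∃ s : Finset Nat.Primes,
    (∀ p ∉ s, ‖x p‖ ≤ 1) ∧
    ∀ p : Nat.Primes, ‖x p - ((∑ q ∈ s, fracPart (q : ℕ) (x q) : ℚ) : ℚ_[(p : ℕ)])‖ ≤ 1 := by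
  classical
  have hfin : {p : Nat.Primes | ¬ ‖x p‖ ≤ 1}.Finite := (x.2 : ∀ᶠ p in cofinite, _)
  refine ⟨hfin.toFinset, fun p hp => by simpa using hp, fun p => ?_⟩
  have hsum : ∀ s : Finset Nat.Primes, p ∉ s →
      ‖((∑ q ∈ s, fracPart (q : ℕ) (x q) : ℚ) : ℚ_[(p : ℕ)])‖ ≤ 1 := by
    intro s
    induction s using Finset.induction_on with
    | empty => simp
    | insert q s hq ih =>
      intro hp
      rw [Finset.sum_insert hq]
      push_cast
      rw [← Rat.cast_sum]
      refine norm_add_le_one (norm_le_one_of_ne (p := (q : ℕ)) ?_ (fracPart_den _ _))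
        (ih fun h => hp (Finset.mem_insert_of_mem h))
      intro h
      exact hp (by rw [Subtype.ext h]; exact Finset.mem_insert_self _ _)
  by_cases hp : p ∈ hfin.toFinset
  · rw [← Finset.add_sum_erase _ _ hp]
    push_cast
    rw [← Rat.cast_sum, ← sub_sub]
    exact norm_sub_le_one (norm_sub_fracPart _ _) (hsum _ (Finset.notMem_erase _ _))
  · exact norm_sub_le_one (by simpa using hp) (hsum _ hp)

theorem psi_ratAdele (q : ℚ) : psi (ratAdele q) = 1 := by
  obtain ⟨s, hs, h⟩ := exists_rat_sub_mem (ratAdele q).2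
  obtain ⟨j, hj⟩ := isInt_of_norm_le (r := q - ∑ p ∈ s, fracPart (p : ℕ) ((ratAdele q).2 p))
    (fun p => by rw [Rat.cast_sub]; exact h p)
  change Circle.exp (-(2 * Real.pi * (q : ℝ))) *
    ∏ᶠ p : Nat.Primes, psiLocal (p : ℕ) ((ratAdele q).2 p) = 1
  rw [finprod_eq_prod_of_mulSupport_subset (s := s)]
  · have hprod : ∀ s : Finset Nat.Primes,
        ∏ p ∈ s, psiLocal (p : ℕ) ((ratAdele q).2 p) =
          Circle.exp (2 * Real.pi *
            ((∑ p ∈ s, fracPart (p : ℕ) ((ratAdele q).2 p) : ℚ) : ℝ)) := by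
      classical
      intro s
      induction s using Finset.induction_on with
      | empty => simp
      | insert a s ha ih =>
        rw [Finset.prod_insert ha, ih, Finset.sum_insert ha, Rat.cast_add, mul_add,
          Circle.exp_add]
        rfl
    rw [hprod, ← Circle.exp_add]
    have : -(2 * Real.pi * (q : ℝ)) + 2 * Real.pi *
        ((∑ p ∈ s, fracPart (p : ℕ) ((ratAdele q).2 p) : ℚ) : ℝ) =
        2 * Real.pi * (0 + ((-j : ℤ) : ℝ)) := by
      have hj' : (q : ℝ) = ((∑ p ∈ s, fracPart (p : ℕ) ((ratAdele q).2 p) : ℚ) : ℝ) + j := by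
        have : q = (∑ p ∈ s, fracPart (p : ℕ) ((ratAdele q).2 p)) + j := by rw [← hj]; ring
        exact_mod_cast this
      rw [hj']
      push_cast
      ring
    rw [this, circle_exp_add_int]
    simp
  · intro p hp
    by_contra hps
    exact hp (psiLocal_of_norm_le (p : ℕ) (hs p hps))

namespace GA

/-- The set `[0, 1) × ∏_p ℤ_p`, a fundamental domain for `N(ℚ)\N(𝔸) = ℚ\𝔸`. -/
def adeleDomain : Set Adele := {x | (0 ≤ x.1 ∧ x.1 < 1) ∧ ∀ p : Nat.Primes, ‖x.2 p‖ ≤ 1}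

/-- The set `ℝ_{>0} × ∏_p ℤ_pˣ`, a fundamental domain for `T(ℚ)\T(𝔸) = ℚˣ\𝔸ˣ`. -/
def ideleDomain : Set Idele :=
  {a | (0 : ℝ) < a.1 ∧ ∀ p : Nat.Primes, ‖(a.2 p : ℚ_[(p : ℕ)])‖ = 1}

/-- A fundamental domain for the left action of `G(ℚ)` on `G(𝔸)`,
see `existsUnique_mem_domain`. -/
def domain : Set GA := {g | g.x ∈ adeleDomain ∧ g.a ∈ ideleDomain}

theorem existsUnique_mem_adeleDomain (x : Adele) :
    ∃! β : ℚ, ratAdele β + x ∈ adeleDomain := by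
  obtain ⟨s, -, h⟩ := exists_rat_sub_mem x.2
  set r : ℚ := ∑ q ∈ s, fracPart (q : ℕ) (x.2 q) with hr
  refine ⟨-(r + ⌊x.1 - r⌋), ⟨⟨?_, ?_⟩, fun p => ?_⟩, ?_⟩
  · change 0 ≤ ((-(r + ⌊x.1 - r⌋) : ℚ) : ℝ) + x.1
    push_cast
    linarith [Int.floor_le (x.1 - r)]
  · change ((-(r + ⌊x.1 - r⌋) : ℚ) : ℝ) + x.1 < 1
    push_cast
    linarith [Int.lt_floor_add_one (x.1 - r)]
  · change ‖((-(r + ⌊x.1 - r⌋) : ℚ) : ℚ_[(p : ℕ)]) + x.2 p‖ ≤ 1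
    have := norm_sub_le_one (h p) (Padic.norm_int_le_one (p := (p : ℕ)) ⌊x.1 - r⌋)
    convert! this using 2
    push_cast
    ring
  · intro β hβ
    have hint : ∃ j : ℤ, β + (r + ⌊x.1 - r⌋) = j := by
      refine isInt_of_norm_le fun p => ?_
      have h1 : ‖(β : ℚ_[(p : ℕ)]) + x.2 p‖ ≤ 1 := hβ.2 p
      have h2 := norm_add_le_one (norm_sub_le_one h1 (h p))
        (Padic.norm_int_le_one (p := (p : ℕ)) ⌊x.1 - r⌋)
      convert! h2 using 2
      push_cast
      ring
    obtain ⟨j, hj⟩ := hint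
    have h1 : 0 ≤ (β : ℝ) + x.1 := hβ.1.1
    have h2 : (β : ℝ) + x.1 < 1 := hβ.1.2
    have hj' : (β : ℝ) = j - (r + ⌊x.1 - r⌋) := by
      have : β = j - (r + ⌊x.1 - r⌋) := by rw [← hj]; ring
      rw [this]
      push_cast
      ring
    have h3 := Int.floor_le (x.1 - r)
    have h4 := Int.lt_floor_add_one (x.1 - r)
    have a1 : (-1 : ℝ) < j := by linarith
    have a2 : (j : ℝ) < 1 := by linarith
    have a1' : (-1 : ℤ) < j := by exact_mod_cast a1
    have a2' : j < 1 := by exact_mod_cast a2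
    have hj0 : j = 0 := by omega
    rw [hj0] at hj
    push_cast at hj
    linarith

theorem norm_natCast_prime (p q : Nat.Primes) (h : p ≠ q) :
    ‖((q : ℕ) : ℚ_[(p : ℕ)])‖ = 1 := by
  rw [Padic.norm_natCast_eq_one_iff]
  exact (Nat.coprime_primes p.2 q.2).2 fun h' => h (Subtype.ext h')

theorem norm_prod_primes (f : Nat.Primes → ℤ) (s : Finset Nat.Primes) (p : Nat.Primes) :
    ‖((∏ q ∈ s, ((q : ℕ) : ℚ) ^ f q : ℚ) : ℚ_[(p : ℕ)])‖ =
      if p ∈ s then ((p : ℕ) : ℝ) ^ (-f p) else 1 := by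
  classical
  induction s using Finset.induction_on with
  | empty => simp
  | insert q s hq ih =>
    rw [Finset.prod_insert hq, Rat.cast_mul, norm_mul, ih]
    push_cast
    rw [norm_zpow]
    by_cases h : p = q
    · subst h
      simp [hq, Padic.norm_p]
    · simp [norm_natCast_prime p q h, h]

theorem existsUnique_mem_ideleDomain (a : Idele) :
    ∃! α : ℚˣ, ratIdele α * a ∈ ideleDomain := by
  classical
  have hfin : {p : Nat.Primes | ¬ ‖(a.2 p : ℚ_[(p : ℕ)])‖ = 1}.Finite := by
    have h : ∀ᶠ p : Nat.Primes in cofinite,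
        a.2 p ∈ (Submonoid.ofClass (PadicInt.subring (p : ℕ))).units := a.2.2
    refine Set.Finite.subset h fun p hp hq => hp ((mem_units_iff p _).1 hq)
  set s := hfin.toFinset with hs
  set r : ℚ := ∏ q ∈ s, ((q : ℕ) : ℚ) ^ (-(a.2 q : ℚ_[(q : ℕ)]).valuation) with hr
  have hrpos : 0 < r := Finset.prod_pos fun q _ => zpow_pos (by exact_mod_cast q.2.pos) _
  have hrn : ∀ p : Nat.Primes, ‖(r : ℚ_[(p : ℕ)])‖ * ‖(a.2 p : ℚ_[(p : ℕ)])‖ = 1 := by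
    intro p
    rw [hr, norm_prod_primes]
    have hp0 : ((p : ℕ) : ℝ) ≠ 0 := by exact_mod_cast p.2.ne_zero
    split_ifs with h
    · rw [Padic.norm_eq_zpow_neg_valuation (a.2 p).ne_zero, ← zpow_add₀ hp0]
      simp
    · rw [one_mul]
      by_contra h'
      exact h (by rw [hs, Set.Finite.mem_toFinset]; exact h')
  obtain ⟨ε, hε, hεa⟩ : ∃ ε : ℚ, |ε| = 1 ∧ 0 < (ε : ℝ) * (a.1 : ℝ) := by
    rcases lt_or_gt_of_ne a.1.ne_zero with h | h
    · exact ⟨-1, by simp, by push_cast; linarith⟩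
    · exact ⟨1, by simp, by push_cast; linarith⟩
  have hεn : ∀ p : Nat.Primes, ‖(ε : ℚ_[(p : ℕ)])‖ = 1 := by
    intro p
    rcases (abs_eq zero_le_one).1 hε with h | h <;> simp [h]
  have hε0 : ε ≠ 0 := by
    rintro rfl
    simp at hε
  refine ⟨Units.mk0 (ε * r) (mul_ne_zero hε0 hrpos.ne'), ⟨?_, fun p => ?_⟩, ?_⟩
  · change 0 < ((ε * r : ℚ) : ℝ) * (a.1 : ℝ)
    push_cast
    have : (0 : ℝ) < r := by exact_mod_cast hrpos
    nlinarith [mul_pos this hεa]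
  · change ‖((ε * r : ℚ) : ℚ_[(p : ℕ)]) * (a.2 p : ℚ_[(p : ℕ)])‖ = 1
    rw [Rat.cast_mul, norm_mul, norm_mul, hεn, one_mul, hrn]
  · intro α hα
    have h1 : 0 < ((α : ℚ) : ℝ) * (a.1 : ℝ) := hα.1
    have h2 : ∀ p : Nat.Primes, ‖((α : ℚ) : ℚ_[(p : ℕ)])‖ * ‖(a.2 p : ℚ_[(p : ℕ)])‖ = 1 := by
      intro p
      rw [← norm_mul]
      exact hα.2 p
    set u : ℚ := (α : ℚ) / (ε * r) with hu
    have hun : ∀ p : Nat.Primes, ‖(u : ℚ_[(p : ℕ)])‖ = 1 := by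
      intro p
      have ha : ‖(a.2 p : ℚ_[(p : ℕ)])‖ ≠ 0 := norm_ne_zero_iff.2 (a.2 p).ne_zero
      have e1 := h2 p
      have e2 := hrn p
      rw [hu, Rat.cast_div, Rat.cast_mul, norm_div, norm_mul, hεn, one_mul,
        eq_div_of_mul_eq ha e1, eq_div_of_mul_eq ha e2]
      exact div_self (div_ne_zero one_ne_zero ha)
    obtain ⟨j, hj⟩ := isInt_of_norm_le fun p => (hun p).le
    obtain ⟨k, hk⟩ := isInt_of_norm_le (r := u⁻¹) fun p => by
      rw [Rat.cast_inv, norm_inv, hun, inv_one]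
    have hu0 : u ≠ 0 := div_ne_zero α.ne_zero (mul_ne_zero hε0 hrpos.ne')
    have hjk : j * k = 1 := by
      have : u * u⁻¹ = 1 := mul_inv_cancel₀ hu0
      rw [hk, hj] at this
      exact_mod_cast this
    have hαu : (α : ℚ) = u * (ε * r) := by
      rw [hu]
      field_simp
    have hupos : 0 < (u : ℝ) := by
      rw [hαu] at h1
      push_cast at h1
      have hr' : (0 : ℝ) < r := by exact_mod_cast hrpos
      have h3 : 0 < (r : ℝ) * ((ε : ℝ) * (a.1 : ℝ)) := mul_pos hr' hεa
      have h4 : 0 < (u : ℝ) * ((r : ℝ) * ((ε : ℝ) * (a.1 : ℝ))) := by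
        convert! h1 using 1
        ring
      exact pos_of_mul_pos_left h4 h3.le
    have hjpos : 0 < j := by
      have : 0 < u := by exact_mod_cast hupos
      rw [hj] at this
      exact_mod_cast this
    have hj1 : j = 1 := by
      rcases Int.eq_one_or_neg_one_of_mul_eq_one hjk with h | h <;> omega
    refine Units.ext ?_
    rw [hαu, hj, hj1]
    simp

/-- `domain` is a strict fundamental domain for `G(ℚ)` acting on `G(𝔸)` from the left. -/
theorem existsUnique_mem_domain (g : GA) : ∃! γ : rational, γ • g ∈ domain := by
  obtain ⟨α, hα, hα'⟩ := existsUnique_mem_ideleDomain g.a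
  obtain ⟨β, hβ, hβ'⟩ := existsUnique_mem_adeleDomain ((ratIdele α).toAdele * g.x)
  refine ⟨⟨mk (ratAdele β) (ratIdele α), β, α, rfl⟩, ⟨hβ, hα⟩, ?_⟩
  rintro ⟨_, β', α', rfl⟩ ⟨h1, h2⟩
  have e : α' = α := hα' α' h2
  subst e
  have e' : β' = β := hβ' β' h1
  subst e'
  rfl

end GA

/-- The quotient `G(ℚ)\G(𝔸)`. -/
abbrev AutQuot : Type := MulAction.orbitRel.Quotient GA.rational GA

/-- The projection `G(𝔸) → G(ℚ)\G(𝔸)`. -/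
def toQuot (g : GA) : AutQuot := Quotient.mk _ g

theorem measurable_toQuot : Measurable toQuot := fun _ h => h

/-- The measure on `G(ℚ)\G(𝔸)` induced by `dg`. -/
def quotMeasure : Measure AutQuot := (GA.haar.restrict GA.domain).map toQuot

/-! ### The Hilbert space `L²(G(ℚ)\G(𝔸))` and its infinite-dimensional part -/

/-- The Hilbert space `L²(G(ℚ)\G(𝔸), dg)`. -/
abbrev AutL2 : Type := Lp ℂ 2 quotMeasure

/-- The set of `φ ∈ L²(G(ℚ)\G(𝔸))` with `φ((x, 1) g) = φ(g)` for all `x ∈ N(𝔸)`. -/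
def H0 : Set AutL2 :=
  {φ | ∀ x : Adele, ∀ᵐ g ∂GA.haar, φ (toQuot (GA.mk x 1 * g)) = φ (toQuot g)}

/-- The orthogonal complement of `H0`. -/
def H1 : Submodule ℂ AutL2 := (Submodule.span ℂ H0)ᗮ

/-- The compact subgroup `K = ∏_p K_p · K_∞` of `G(𝔸)`, where `K_∞ = {(0, ±1)}` and `K_p` consists
of the `(x, a)` with `x ∈ p^{n_p} ℤ_p` and `a ∈ ℤ_pˣ`, `a ∈ 1 + p^{n_p} ℤ_p`. -/
def compactK (n : Nat.Primes →₀ ℕ) : Set GA :=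
  {k | k.x.1 = 0 ∧ (k.a.1 = 1 ∨ k.a.1 = -1) ∧ ∀ p : Nat.Primes,
    ‖k.x.2 p‖ ≤ ((p : ℕ) : ℝ) ^ (-(n p : ℤ)) ∧ ‖(k.a.2 p : ℚ_[(p : ℕ)])‖ = 1 ∧
    ‖(k.a.2 p : ℚ_[(p : ℕ)]) - 1‖ ≤ ((p : ℕ) : ℝ) ^ (-(n p : ℤ))}

/-- The vectors of `L²(G(ℚ)\G(𝔸))` fixed by right translation by the elements of `K`. -/
def fixedK (n : Nat.Primes →₀ ℕ) : Set AutL2 :=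
  {f | ∀ k ∈ compactK n, ∀ᵐ g ∂GA.haar, f (toQuot (g * k)) = f (toQuot g)}

/-- The operator `I`: the Fourier coefficient `a ↦ ∫_{N(ℚ)\N(𝔸)} f(x, a) conj(ψ(x)) dx`. -/
def opI (f : AutQuot → ℂ) (a : Idele) : ℂ :=
  ∫ x in GA.adeleDomain, f (toQuot (GA.mk x a)) * conj (psi x : ℂ) ∂adeleMeasure

/-- The operator `Θ`: `Θ(h)(x, a) = ∑_{α ∈ ℚˣ} ψ(α x) h(α a)`. -/
def opTheta (h : Idele → ℂ) (g : GA) : ℂ :=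
  ∑' α : ℚˣ, (psi (ratAdele (α : ℚ) * g.x) : ℂ) * h (ratIdele α * g.a)

theorem opTheta_rational_mul (h : Idele → ℂ) (γ : GA.rational) (g : GA) :
    opTheta h (γ • g) = opTheta h g := by
  obtain ⟨_, β, α', rfl⟩ := γ
  unfold opTheta
  rw [← (Equiv.mulRight α').tsum_eq
    (fun α : ℚˣ => (psi (ratAdele (α : ℚ) * g.x) : ℂ) * h (ratIdele α * g.a))]
  refine tsum_congr fun α => ?_
  change (psi (ratAdele (α : ℚ) * (ratAdele β + (ratIdele α').toAdele * g.x)) : ℂ) *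
    h (ratIdele α * (ratIdele α' * g.a)) =
    (psi (ratAdele ((α * α' : ℚˣ) : ℚ) * g.x) : ℂ) * h (ratIdele (α * α') * g.a)
  have h1 : ratAdele (α : ℚ) * (ratAdele β + (ratIdele α').toAdele * g.x) =
      ratAdele ((α : ℚ) * β) + ratAdele ((α * α' : ℚˣ) : ℚ) * g.x := by
    rw [mul_add, map_mul, toAdele_ratIdele, Units.val_mul, map_mul, mul_assoc]
  rw [h1, AddChar.map_add_eq_mul, psi_ratAdele, one_mul, map_mul ratIdele, mul_assoc]

/-- `Θ(h)` as a function on `G(ℚ)\G(𝔸)`. -/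
def opThetaQuot (h : Idele → ℂ) : AutQuot → ℂ :=
  Quotient.lift (opTheta h) (by
    rintro g g' ⟨γ, rfl⟩
    exact opTheta_rational_mul h γ g')

/-! ### The basis vectors `v_{m, χ}` and the functions `θ_{m, χ, t}` -/

/-- The subgroup `1 + p^k ℤ_p` of `ℤ_pˣ` (all of `ℤ_pˣ` if `k = 0`), see `mem_congrUnits`. -/
def congrUnits (p : ℕ) [Fact p.Prime] (k : ℕ) : Subgroup ℤ_[p]ˣ :=
  (Units.map (PadicInt.toZModPow k : ℤ_[p] →+* ZMod (p ^ k)).toMonoidHom).ker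

theorem mem_congrUnits (p : ℕ) [Fact p.Prime] (k : ℕ) (u : ℤ_[p]ˣ) :
    u ∈ congrUnits p k ↔ ‖(u : ℤ_[p]) - 1‖ ≤ (p : ℝ) ^ (-(k : ℤ)) := by
  rw [PadicInt.norm_le_pow_iff_mem_span_pow, ← PadicInt.ker_toZModPow, RingHom.mem_ker, map_sub,
    map_one, sub_eq_zero, congrUnits, MonoidHom.mem_ker, Units.ext_iff]
  rfl

/-- `M = ∏_{p ∈ S} M_p`, where `S = {p | n_p ≠ 0}` and `M_p` is the set of characters of
`ℤ_pˣ/(1 + p^{n_p} ℤ_p)`. -/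
abbrev CharM (n : Nat.Primes →₀ ℕ) : Type :=
  ∀ p : n.support, (ℤ_[((p : Nat.Primes) : ℕ)]ˣ ⧸
    congrUnits ((p : Nat.Primes) : ℕ) (n (p : Nat.Primes))) →* ℂˣ

instance finite_quot (p : ℕ) [Fact p.Prime] (k : ℕ) : Finite (ℤ_[p]ˣ ⧸ congrUnits p k) := by
  have : NeZero (p ^ k) := ⟨pow_ne_zero _ (Fact.out : p.Prime).ne_zero⟩
  exact Finite.of_injective _ (QuotientGroup.kerLift_injective
    (Units.map (PadicInt.toZModPow k : ℤ_[p] →+* ZMod (p ^ k)).toMonoidHom))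

theorem finite_hom (Q : Type) [Group Q] [Finite Q] : Finite (Q →* ℂˣ) := inferInstance

instance finite_chars (p : ℕ) [Fact p.Prime] (k : ℕ) :
    Finite ((ℤ_[p]ˣ ⧸ congrUnits p k) →* ℂˣ) := finite_hom _

instance finite_charM (n : Nat.Primes →₀ ℕ) : Finite (CharM n) := by
  have : ∀ p : n.support, Finite ((ℤ_[((p : Nat.Primes) : ℕ)]ˣ ⧸
      congrUnits ((p : Nat.Primes) : ℕ) (n (p : Nat.Primes))) →* ℂˣ) := fun p => inferInstance
  exact Pi.finite

instance fintype_charM (n : Nat.Primes →₀ ℕ) : Fintype (CharM n) := Fintype.ofFinite _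

/-- `N = ∏_p p^{n_p}`. -/
def levelN (n : Nat.Primes →₀ ℕ) : ℕ := n.prod fun p k => (p : ℕ) ^ k

/-- The unit `a p^{-v_p(a)}` of `ℤ_p`. -/
def unitPart (p : ℕ) [Fact p.Prime] (a : ℚ_[p]ˣ) : ℤ_[p]ˣ :=
  PadicInt.mkUnits (u := (a : ℚ_[p]) * (p : ℚ_[p]) ^ (-(a : ℚ_[p]).valuation)) (by
    have hp : (p : ℝ) ≠ 0 := by exact_mod_cast (Fact.out : p.Prime).ne_zero
    rw [norm_mul, norm_zpow, Padic.norm_p, Padic.norm_eq_zpow_neg_valuation a.ne_zero,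
      inv_zpow, ← zpow_neg, neg_neg, ← zpow_add₀ hp]
    simp)

open Classical in
/-- The function `v_{m, χ}` on the finite ideles: the product of the functions
`χ_p(a_p p^{-v_p(a_p)}) 1_{(m/N) ℤ_pˣ}(a_p)` for `p ∈ S` and `1_{m ℤ_pˣ}(a_p)` for `p ∉ S`. -/
def vec (n : Nat.Primes →₀ ℕ) (m : ℕ+) (χ : CharM n) (a : FinIdele) : ℂ :=
  if (∀ p ∈ n.support, ‖(a p : ℚ_[(p : ℕ)])‖ = ‖((m : ℕ) : ℚ_[(p : ℕ)]) / (levelN n : ℕ)‖) ∧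
      (∀ p ∉ n.support, ‖(a p : ℚ_[(p : ℕ)])‖ = ‖((m : ℕ) : ℚ_[(p : ℕ)])‖) then
    ∏ p : n.support, ((χ p (QuotientGroup.mk (unitPart _ (a p))) : ℂˣ) : ℂ)
  else 0

/-- The function `v_{m, χ} ⊗ |·|_∞^{it}` on the ideles. -/
def vecTensor (n : Nat.Primes →₀ ℕ) (m : ℕ+) (χ : CharM n) (t : ℝ) (a : Idele) : ℂ :=
  vec n m χ a.2 * ((|(a.1 : ℝ)| : ℝ) : ℂ) ^ ((t : ℂ) * Complex.I)

/-- The function `θ_{m, χ, t} = Θ(v_{m, χ} ⊗ |·|_∞^{it})` on `G(ℚ)\G(𝔸)`. -/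
def theta (n : Nat.Primes →₀ ℕ) (m : ℕ+) (χ : CharM n) (t : ℝ) : AutQuot → ℂ :=
  opThetaQuot (vecTensor n m χ t)

/-- The pairing `(f, θ_{m, χ, t})`, the integral of `f(g) conj(θ_{m, χ, t}(g))` over
`G(ℚ)\G(𝔸)`. -/
def pairing (n : Nat.Primes →₀ ℕ) (f : AutQuot → ℂ) (m : ℕ+) (χ : CharM n) (t : ℝ) : ℂ :=
  ∫ g, f g * conj (theta n m χ t g) ∂quotMeasure

end AxPlusB

end

open AxPlusB

noncomputable section

namespace AxPlusB

/-! The expansion combines three Fourier analyses: along `ℚ\𝔸`, on a finite quotient of `∏_p ℤ_pˣ`,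
and on the real line in the coordinate `s = log a_∞`.

For fixed `a`, expand `x ↦ f(x, a)` on `ℚ\𝔸`. Left invariance under `ℚˣ` makes the coefficient of
`ψ(αx)` equal to `I(f)(αa)`. The constant term vanishes because `f` is orthogonal to `H0`. If `a`
lies in the fundamental domain, its finite part is a unit, and invariance under the additive part of
`K` leaves only the frequencies `k/N`. The sets `(k/N)·ideleDomain` are disjoint, so integrability
of `I(f)` bounds the sum over `k` of the integrals of the coefficients (`tsum_lintegral_coeff_le`).
Hence the series converges absolutely for almost every `a`, it represents `f` (`fourier_expansion`),
and `f` is integrable.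

Write `a = (e^s, u)` and let `c_k(s, u)` be the coefficient of index `k`. The element `-1` of `ℚˣ`
together with `K_∞` gives `c_{-m}(s, u) = c_m(s, -u)`. The multiplicative part of `K` makes `c_k`
invariant in `u` under a congruence subgroup, so `c_m` is a finite combination of the characters in
`M`, with coefficients `vecCoeff` depending on `s` alone (`sum_vec_mul_integral`).

On the fundamental domain the sum defining `θ_{m,χ,t}` reduces to `α = ±m/N`, and its dependence on
`t` is the phase `exp(it(s + log(m/N)))` (`theta_proj_logCoord`). So the pairing is, up to a phase,
twice the Fourier transform of `vecCoeff` (`pairing_eq`). By Fourier inversion, `1/4π` times the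
integral over `t` is the part of the terms `±m` belonging to `χ` (`ae_spectral_integral`); here `4π
= 2 · 2π`. Summing over `χ` and then `m` restores the Fourier series of `f(·, a)`. -/

/-! ### Topology and measurability of adeles and ideles. -/

theorem secondCountableTopology_restrictedProduct {ι : Type} [Countable ι] {R : ι → Type}
    [∀ i, TopologicalSpace (R i)] [∀ i, SecondCountableTopology (R i)]
    {A : ∀ i, Set (R i)} (hA : ∀ i, IsOpen (A i)) :
    SecondCountableTopology (Πʳ i, [R i, A i]) := by
  have hT : ∀ T : Finset ι, cofinite ≤ 𝓟 ((T : Set ι)ᶜ) := fun T => by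
    rw [le_principal_iff, mem_cofinite, compl_compl]; exact T.finite_toSet
  -- Elements integral outside the finite set `T`. These open sets are countably many and cover the
  -- restricted product; each carries the topology induced from a countable full product.
  let U : Finset ι → Set (Πʳ i, [R i, A i]) :=
    fun T => Set.range (RestrictedProduct.inclusion R A (hT T))
  have hemb := fun T => RestrictedProduct.isOpenEmbedding_inclusion_principal hA (hT T)
  have : ∀ T, SecondCountableTopology (U T) := fun T => by
    have h1 : SecondCountableTopology (Πʳ i, [R i, A i]_[𝓟 ((T : Set ι)ᶜ)]) :=
      (RestrictedProduct.isEmbedding_coe_of_principal).isInducing.secondCountableTopology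
    exact (hemb T).toIsEmbedding.toHomeomorph.symm.isEmbedding.secondCountableTopology
  refine TopologicalSpace.secondCountableTopology_of_countable_cover
    (fun T => (hemb T).isOpen_range) (Set.eq_univ_of_forall fun x => Set.mem_iUnion.2 ?_)
  have hx : {i | ¬ x i ∈ A i}.Finite := x.2
  refine ⟨hx.toFinset, ⟨x, ?_⟩, ?_⟩
  · intro i hi
    by_contra h
    exact hi (by simpa using h)
  · rfl

instance : SecondCountableTopology FinAdele :=
  secondCountableTopology_restrictedProduct isOpen_subring

instance (p : Nat.Primes) : SecondCountableTopology ℚ_[(p : ℕ)]ˣ :=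
  Units.isEmbedding_val₀.secondCountableTopology

instance : SecondCountableTopology FinIdele :=
  secondCountableTopology_restrictedProduct factOpenUnits.out

instance : LocallyCompactSpace FinAdele :=
  zHat.isCompact.locallyCompactSpace_of_mem_nhds_of_addGroup
    (mem_of_superset (isOpen_interior.mem_nhds zHat.interior_nonempty.some_mem) interior_subset)

instance : BorelSpace ℝˣ := ⟨by
  rw [Units.isEmbedding_val₀.eq_induced, borel_comap, ← BorelSpace.measurable_eq]; rfl⟩

instance : SecondCountableTopology ℝˣ := Units.isEmbedding_val₀.secondCountableTopology

instance : SigmaFinite adeleMeasure := inferInstanceAs (SigmaFinite (Measure.prod _ _))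

instance : adeleMeasure.IsAddHaarMeasure :=
  inferInstanceAs (Measure.IsAddHaarMeasure (Measure.prod _ _))

theorem measurableEmbedding_units_val : MeasurableEmbedding (Units.val : ℝˣ → ℝ) := by
  refine Units.isEmbedding_val₀.measurableEmbedding ?_
  have : Set.range (Units.val : ℝˣ → ℝ) = {0}ᶜ := by
    ext x; simp only [Set.mem_range, Set.mem_compl_iff, Set.mem_singleton_iff]
    exact ⟨by rintro ⟨u, rfl⟩; exact u.ne_zero, fun h => ⟨Units.mk0 x h, rfl⟩⟩
  rw [this]; exact (measurableSet_singleton 0).compl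

instance : SigmaFinite realUnitsMeasure := by
  have : SigmaFinite ((volume : Measure ℝ).withDensity fun r => ENNReal.ofReal |r|⁻¹) :=
    inferInstance
  refine SigmaFinite.of_map _ measurableEmbedding_units_val.measurable.aemeasurable ?_
  rw [realUnitsMeasure, measurableEmbedding_units_val.map_comap]
  infer_instance

instance : SigmaFinite ideleMeasure := inferInstanceAs (SigmaFinite (Measure.prod _ _))
instance : SigmaFinite GA.haar := inferInstanceAs (SigmaFinite (Measure.prod _ _))

theorem continuous_toAdele : Continuous Idele.toAdele := by
  have h : Continuous fun a : FinIdele => (Units.coeHom FinAdele).comp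
      (RestrictedProduct.unitsEquiv (fun p : Nat.Primes => ℚ_[(p : ℕ)])).symm.toMonoidHom a :=
    RestrictedProduct.mapAlong_continuous (fun p : Nat.Primes => ℚ_[(p : ℕ)]ˣ)
      (fun p : Nat.Primes => ℚ_[(p : ℕ)]) id Filter.tendsto_id (fun p => Units.val)
      (Filter.Eventually.of_forall fun p u hu => hu.1) (fun p => Units.continuous_val)
  exact (Units.continuous_val.comp continuous_fst).prodMk (h.comp continuous_snd)

theorem measurable_toAdele : Measurable Idele.toAdele := continuous_toAdele.measurable

/-! ### The lattice `ℚ` in the adeles and its fundamental domains. -/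

/-- The image of `ℚ` in the adeles. -/
def ratSubgroup : AddSubgroup Adele := ratAdele.toAddMonoidHom.range

instance : Countable ratSubgroup :=
  (Set.countable_range ratAdele.toAddMonoidHom).to_subtype

theorem continuous_eval (p : Nat.Primes) : Continuous fun x : FinAdele => x p :=
  RestrictedProduct.continuous_eval p

theorem measurableSet_zHat : MeasurableSet (zHat : Set FinAdele) :=
  zHat.isCompact.isClosed.measurableSet

theorem adeleDomain_eq : GA.adeleDomain = Set.Ico (0 : ℝ) 1 ×ˢ (zHat : Set FinAdele) := rfl

theorem measurableSet_adeleDomain : MeasurableSet GA.adeleDomain :=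
  measurableSet_Ico.prod measurableSet_zHat

theorem adeleMeasure_adeleDomain : adeleMeasure GA.adeleDomain = 1 := by
  rw [adeleDomain_eq, adeleMeasure, Measure.prod_prod, Measure.addHaarMeasure_self]
  simp

theorem isAddFundamentalDomain_of_existsUnique {s : Set Adele} (hs : MeasurableSet s)
    (h : ∀ x : Adele, ∃! β : ℚ, ratAdele β + x ∈ s) :
    IsAddFundamentalDomain ratSubgroup s adeleMeasure := by
  refine IsAddFundamentalDomain.mk' hs.nullMeasurableSet fun x => ?_
  obtain ⟨β, hβ, hu⟩ := h x
  refine ⟨⟨ratAdele β, β, rfl⟩, hβ, ?_⟩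
  rintro ⟨_, β', rfl⟩ h'
  exact Subtype.ext (congrArg ratAdele (hu β' h'))

/-- Multiplication by `α` permutes the cosets of `ℚ`, so the dilate `α⁻¹·adeleDomain` again meets
each coset exactly once. -/
theorem isAddFundamentalDomain_smul (α : ℚˣ) :
    IsAddFundamentalDomain ratSubgroup {x | ratAdele (α : ℚ) * x ∈ GA.adeleDomain}
      adeleMeasure := by
  refine isAddFundamentalDomain_of_existsUnique
    ((measurable_const.mul measurable_id) measurableSet_adeleDomain) fun x => ?_
  obtain ⟨β, hβ, hu⟩ := GA.existsUnique_mem_adeleDomain (ratAdele (α : ℚ) * x)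
  refine ⟨(α⁻¹ : ℚˣ) * β, ?_, fun β' h' => ?_⟩
  · have : ratAdele (α : ℚ) * (ratAdele ((α⁻¹ : ℚˣ) * β) + x) =
        ratAdele β + ratAdele (α : ℚ) * x := by
      rw [mul_add, ← map_mul, ← mul_assoc, Units.mul_inv, one_mul]
    exact (congrArg (· ∈ GA.adeleDomain) this).mpr hβ
  · have h2 : ratAdele (α * β') + ratAdele (α : ℚ) * x ∈ GA.adeleDomain := by
      rw [map_mul, ← mul_add]; exact h'
    rw [← hu _ h2, ← mul_assoc, Units.inv_mul, one_mul]

theorem isAddFundamentalDomain_adeleDomain :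
    IsAddFundamentalDomain ratSubgroup GA.adeleDomain adeleMeasure :=
  isAddFundamentalDomain_of_existsUnique measurableSet_adeleDomain GA.existsUnique_mem_adeleDomain

/-- Multiplication by a nonzero rational number preserves the Haar measure of the adeles. -/
theorem measurePreserving_ratAdele_mul (α : ℚˣ) :
    MeasurePreserving (fun x : Adele => ratAdele (α : ℚ) * x) adeleMeasure adeleMeasure := by
  have hm : Measurable fun x : Adele => ratAdele (α : ℚ) * x := measurable_const.mul measurable_id
  refine ⟨hm, ?_⟩
  let e : Adele ≃+ Adele :=
    { toFun := fun x => ratAdele (α : ℚ) * x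
      invFun := fun x => ratAdele ((α⁻¹ : ℚˣ) : ℚ) * x
      left_inv := fun x => by simp only [← mul_assoc, ← map_mul, Units.inv_mul, map_one, one_mul]
      right_inv := fun x => by simp only [← mul_assoc, ← map_mul, Units.mul_inv, map_one, one_mul]
      map_add' := fun x y => mul_add _ _ _ }
  have : (adeleMeasure.map (fun x : Adele => ratAdele (α : ℚ) * x)).IsAddHaarMeasure :=
    e.isAddHaarMeasure_map adeleMeasure (continuous_const.mul continuous_id)
      (continuous_const.mul continuous_id)
  -- By uniqueness of Haar measure only a scalar is in question. It is read off on `adeleDomain`: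
  -- this set and its preimage are both fundamental domains for `ℚ`, hence both have volume one. No
  -- computation with local absolute values is needed.
  have h1 := Measure.isAddLeftInvariant_eq_smul
    (adeleMeasure.map (fun x : Adele => ratAdele (α : ℚ) * x)) adeleMeasure
  have h2 := congrArg (fun μ => μ GA.adeleDomain) h1
  simp only [Measure.map_apply hm measurableSet_adeleDomain, Measure.smul_apply,
    adeleMeasure_adeleDomain] at h2
  have h3 : adeleMeasure ((fun x : Adele => ratAdele (α : ℚ) * x) ⁻¹' GA.adeleDomain) = 1 := by
    rw [← adeleMeasure_adeleDomain]
    exact (isAddFundamentalDomain_smul α).measure_eq isAddFundamentalDomain_adeleDomain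
  rw [h3] at h2
  rw [h1]
  have h4 : ((adeleMeasure.map (fun x : Adele => ratAdele (α : ℚ) * x)).addHaarScalarFactor
      adeleMeasure) = 1 := by
    have : (1 : ℝ≥0∞) = ((adeleMeasure.map (fun x : Adele => ratAdele (α : ℚ) * x)).addHaarScalarFactor
      adeleMeasure : ℝ≥0∞) := by
      rw [h2, ENNReal.smul_def, smul_eq_mul, mul_one]
    exact_mod_cast this.symm
  rw [h4, one_smul]

/-- The integral of a `ℚ`-periodic function over a fundamental domain is unchanged when its
argument is scaled by a nonzero rational number. -/
theorem setIntegral_adeleDomain_comp_mul (α : ℚˣ) {H : Adele → ℂ}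
    (hH : ∀ (β : ℚ) (x : Adele), H (ratAdele β + x) = H x) :
    ∫ x in GA.adeleDomain, H (ratAdele (α : ℚ) * x) ∂adeleMeasure =
      ∫ x in GA.adeleDomain, H x ∂adeleMeasure := by
  have hme : MeasurableEmbedding fun x : Adele => ratAdele (α : ℚ) * x :=
    (MeasurableEquiv.mk
      { toFun := fun x : Adele => ratAdele (α : ℚ) * x
        invFun := fun x => ratAdele ((α⁻¹ : ℚˣ) : ℚ) * x
        left_inv := fun x => by
          simp only [← mul_assoc, ← map_mul, Units.inv_mul, map_one, one_mul]
        right_inv := fun x => by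
          simp only [← mul_assoc, ← map_mul, Units.mul_inv, map_one, one_mul] }
      (measurable_const.mul measurable_id)
      (measurable_const.mul measurable_id)).measurableEmbedding
  have h1 := (measurePreserving_ratAdele_mul α).setIntegral_preimage_emb hme H
    {x | ratAdele ((α⁻¹ : ℚˣ) : ℚ) * x ∈ GA.adeleDomain}
  have h2 : (fun x : Adele => ratAdele (α : ℚ) * x) ⁻¹'
      {x | ratAdele ((α⁻¹ : ℚˣ) : ℚ) * x ∈ GA.adeleDomain} = GA.adeleDomain := by
    ext x
    simp only [Set.mem_preimage, Set.mem_ofPred_eq, ← mul_assoc, ← map_mul, Units.inv_mul,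
      map_one, one_mul]
  rw [h2] at h1
  rw [h1]
  refine (isAddFundamentalDomain_smul α⁻¹).setIntegral_eq isAddFundamentalDomain_adeleDomain ?_
  rintro ⟨_, β, rfl⟩ x
  exact hH β x

/-! ### The character -/

theorem psi_of_mem_zHat {x : Adele} (hx : ∀ p : Nat.Primes, ‖x.2 p‖ ≤ 1) :
    psi x = Circle.exp (-(2 * Real.pi * x.1)) := by
  change Circle.exp (-(2 * Real.pi * x.1)) * ∏ᶠ p : Nat.Primes, psiLocal (p : ℕ) (x.2 p) = _
  have h : ∀ p : Nat.Primes, psiLocal (p : ℕ) (x.2 p) = 1 := fun p => psiLocal_of_norm_le _ (hx p)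
  rw [finprod_congr h, finprod_one, mul_one]

/-- Near `x0` the difference `x - x0` has integral finite part, so `ψ(x)/ψ(x0)` is given by the
archimedean exponential alone. -/
theorem continuous_psi : Continuous (psi : Adele → Circle) := by
  rw [continuous_iff_continuousAt]
  intro x0
  have h0 : ∀ᶠ x : Adele in 𝓝 x0, ∀ p : Nat.Primes, ‖(x - x0).2 p‖ ≤ 1 := by
    have ho : IsOpen {y : FinAdele | ∀ p : Nat.Primes, y p ∈ PadicInt.subring (p : ℕ)} :=
      RestrictedProduct.isOpen_forall_mem
        (A := fun p : Nat.Primes => (PadicInt.subring (p : ℕ) : Set ℚ_[(p : ℕ)])) isOpen_subring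
    have hc : Continuous fun x : Adele => (x - x0).2 := by fun_prop
    refine (ho.preimage hc).mem_nhds ?_
    intro p
    simp
  have h1 : (fun x : Adele => psi x0 * Circle.exp (-(2 * Real.pi * (x - x0).1))) =ᶠ[𝓝 x0] psi := by
    filter_upwards [h0] with x hx
    rw [← psi_of_mem_zHat hx, ← AddChar.map_add_eq_mul, add_sub_cancel]
  refine ContinuousAt.congr ?_ h1
  fun_prop

theorem measurable_psi : Measurable fun x : Adele => (psi x : ℂ) :=
  (continuous_subtype_val.comp continuous_psi).measurable

/-! ### The measures on `ℝˣ` and on the ideles, and logarithmic coordinates. -/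

theorem lintegral_realUnitsMeasure {g : ℝ → ℝ≥0∞} :
    ∫⁻ r : ℝˣ, g r ∂realUnitsMeasure = ∫⁻ r : ℝ, ENNReal.ofReal |r|⁻¹ * g r := by
  -- The range of `Units.val` misses only the null set `{0}`, so restricting to it loses nothing.
  have h : (volume.withDensity fun r : ℝ => ENNReal.ofReal |r|⁻¹).restrict
      (Set.range (Units.val : ℝˣ → ℝ)) = volume.withDensity fun r : ℝ => ENNReal.ofReal |r|⁻¹ := by
    rw [Measure.restrict_eq_self_of_ae_mem]
    refine (withDensity_absolutelyContinuous _ _).ae_le ?_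
    filter_upwards [Measure.ae_ne volume (0 : ℝ)] with x hx
    exact ⟨Units.mk0 x hx, rfl⟩
  rw [← measurableEmbedding_units_val.lintegral_map, realUnitsMeasure,
    measurableEmbedding_units_val.map_comap, h, lintegral_withDensity_eq_lintegral_mul_non_measurable]
  · rfl
  · fun_prop
  · exact ae_of_all _ fun _ => ENNReal.ofReal_lt_top

theorem measure_realUnitsMeasure_preimage (s : Set ℝ) (hs : MeasurableSet s) :
    realUnitsMeasure (Units.val ⁻¹' s) = ∫⁻ r in s, ENNReal.ofReal |r|⁻¹ := by
  rw [← lintegral_indicator_one (measurableEmbedding_units_val.measurable hs)]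
  have := lintegral_realUnitsMeasure (g := s.indicator 1)
  rw [← lintegral_indicator hs]
  convert! this using 1
  refine lintegral_congr fun r => ?_
  by_cases h : r ∈ s <;> simp [h]

theorem realUnitsMeasure_ext {μ : Measure ℝˣ}
    (h : ∀ s : Set ℝ, MeasurableSet s →
      μ (Units.val ⁻¹' s) = ∫⁻ r in s, ENNReal.ofReal |r|⁻¹) : μ = realUnitsMeasure := by
  ext t ht
  obtain ⟨s, hs, rfl⟩ := ht
  rw [h s hs, measure_realUnitsMeasure_preimage s hs]

theorem measurePreserving_realUnits_mul (c : ℝˣ) :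
    MeasurePreserving (fun r : ℝˣ => c * r) realUnitsMeasure realUnitsMeasure := by
  refine ⟨measurable_const_mul c, realUnitsMeasure_ext fun s hs => ?_⟩
  have h1 : (fun r : ℝˣ => c * r) ⁻¹' (Units.val ⁻¹' s) =
      Units.val ⁻¹' ((fun r : ℝ => c * r) ⁻¹' s) := rfl
  rw [Measure.map_apply (measurable_const_mul c) (measurableEmbedding_units_val.measurable hs), h1,
    measure_realUnitsMeasure_preimage _ (measurable_const_mul _ hs),
    ← lintegral_indicator hs, ← lintegral_indicator (measurable_const_mul (c : ℝ) hs)]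
  have hm : Measurable (s.indicator fun r : ℝ => ENNReal.ofReal |r|⁻¹) :=
    Measurable.indicator (by fun_prop) hs
  have h3 : ∫⁻ r, s.indicator (fun r : ℝ => ENNReal.ofReal |r|⁻¹) r
      ∂(volume.map fun r : ℝ => (c : ℝ) * r) = ENNReal.ofReal |(c : ℝ)⁻¹| *
        ∫⁻ r, s.indicator (fun r : ℝ => ENNReal.ofReal |r|⁻¹) r := by
    rw [Real.map_volume_mul_left c.ne_zero, lintegral_smul_measure, smul_eq_mul]
  rw [lintegral_map hm (measurable_const_mul _)] at h3
  have h4 : ∀ r : ℝ, ((fun r : ℝ => (c : ℝ) * r) ⁻¹' s).indicator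
      (fun r : ℝ => ENNReal.ofReal |r|⁻¹) r = ENNReal.ofReal |(c : ℝ)| *
      s.indicator (fun r : ℝ => ENNReal.ofReal |r|⁻¹) (c * r) := by
    intro r
    by_cases h : (c : ℝ) * r ∈ s
    · rw [Set.indicator_of_mem (by exact h), Set.indicator_of_mem h,
        ← ENNReal.ofReal_mul (abs_nonneg _), abs_mul, mul_inv,
        mul_inv_cancel_left₀ (abs_ne_zero.2 c.ne_zero)]
    · rw [Set.indicator_of_notMem (by exact h), Set.indicator_of_notMem h, mul_zero]
  rw [lintegral_congr h4, lintegral_const_mul' _ _ ENNReal.ofReal_ne_top, h3, ← mul_assoc,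
    ← ENNReal.ofReal_mul (abs_nonneg _), abs_inv, mul_inv_cancel₀ (abs_ne_zero.2 c.ne_zero),
    ENNReal.ofReal_one, one_mul]

/-- The exponential as a map from `ℝ` to `ℝˣ`. -/
def expUnits (s : ℝ) : ℝˣ := Units.mk0 (Real.exp s) (Real.exp_ne_zero s)

theorem measurable_expUnits : Measurable expUnits := by
  rw [← measurableEmbedding_units_val.measurable_comp_iff]
  exact Real.measurable_exp

theorem measurePreserving_expUnits :
    MeasurePreserving expUnits volume (realUnitsMeasure.restrict {r | 0 < (r : ℝ)}) := by
  refine ⟨measurable_expUnits, ?_⟩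
  ext t ht
  obtain ⟨s, hs, rfl⟩ := ht
  rw [Measure.map_apply measurable_expUnits (measurableEmbedding_units_val.measurable hs),
    Measure.restrict_apply (measurableEmbedding_units_val.measurable hs)]
  have h1 : Units.val ⁻¹' s ∩ {r : ℝˣ | 0 < (r : ℝ)} = Units.val ⁻¹' (s ∩ Set.Ioi 0) := rfl
  rw [h1, measure_realUnitsMeasure_preimage _ (hs.inter measurableSet_Ioi),
    ← setLIntegral_indicator hs, ← Real.range_exp, ← Set.image_univ,
    lintegral_image_eq_lintegral_abs_deriv_mul MeasurableSet.univ
      (fun x _ => (Real.hasDerivAt_exp x).hasDerivWithinAt) Real.exp_injective.injOn,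
    setLIntegral_univ, ← lintegral_indicator_one
      (measurable_expUnits (measurableEmbedding_units_val.measurable hs))]
  refine lintegral_congr fun x => ?_
  by_cases h : Real.exp x ∈ s
  · rw [Set.indicator_of_mem (by exact h), Set.indicator_of_mem h,
      ← ENNReal.ofReal_mul (abs_nonneg _), mul_inv_cancel₀ (abs_ne_zero.2 (Real.exp_ne_zero x))]
    simp
  · rw [Set.indicator_of_notMem (by exact h), Set.indicator_of_notMem h, mul_zero]

theorem measurePreserving_idele_mul (α : Idele) :
    MeasurePreserving (fun a : Idele => α * a) ideleMeasure ideleMeasure :=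
  (measurePreserving_realUnits_mul α.1).prod
    (measurePreserving_mul_left (Measure.haarMeasure zHatUnits) α.2)

theorem mem_zHatUnits {a : FinIdele} :
    a ∈ (zHatUnits : Set FinIdele) ↔ ∀ p : Nat.Primes, ‖(a p : ℚ_[(p : ℕ)])‖ = 1 :=
  forall_congr' fun p => mem_units_iff p _

theorem measurableSet_zHatUnits : MeasurableSet (zHatUnits : Set FinIdele) :=
  zHatUnits.isCompact.isClosed.measurableSet

theorem measurableSet_pos : MeasurableSet {r : ℝˣ | 0 < (r : ℝ)} :=
  measurableEmbedding_units_val.measurable measurableSet_Ioi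

theorem ideleDomain_eq :
    GA.ideleDomain = {r : ℝˣ | 0 < (r : ℝ)} ×ˢ (zHatUnits : Set FinIdele) := by
  ext a
  exact and_congr Iff.rfl mem_zHatUnits.symm

theorem measurableSet_ideleDomain : MeasurableSet GA.ideleDomain := by
  rw [ideleDomain_eq]
  exact measurableSet_pos.prod measurableSet_zHatUnits

/-- The Haar probability measure on `∏_p ℤ_pˣ`, as a measure on the finite ideles. -/
def unitMeasure : Measure FinIdele := (Measure.haarMeasure zHatUnits).restrict zHatUnits

instance : IsProbabilityMeasure unitMeasure := ⟨by
  rw [unitMeasure, Measure.restrict_apply_univ, Measure.haarMeasure_self]⟩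

/-- Logarithmic coordinates on `ideleDomain`. -/
def logCoord (s : ℝ × FinIdele) : Idele := (expUnits s.1, s.2)

theorem measurePreserving_logCoord :
    MeasurePreserving logCoord (volume.prod unitMeasure)
      (ideleMeasure.restrict GA.ideleDomain) := by
  rw [ideleDomain_eq, ideleMeasure, ← Measure.prod_restrict]
  exact measurePreserving_expUnits.prod (MeasurePreserving.id _)

theorem measurePreserving_unitMeasure {b : FinIdele} (hb : b ∈ (zHatUnits : Set FinIdele)) :
    MeasurePreserving (fun a => b * a) unitMeasure unitMeasure := by
  have h := (measurePreserving_mul_left (Measure.haarMeasure zHatUnits) b).restrict_preimage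
    measurableSet_zHatUnits
  have h2 : (fun a => b * a) ⁻¹' (zHatUnits : Set FinIdele) = zHatUnits := by
    ext a
    rw [Set.mem_preimage, mem_zHatUnits, mem_zHatUnits]
    refine forall_congr' fun p => ?_
    have := mem_zHatUnits.1 hb p
    change ‖(b p : ℚ_[(p : ℕ)]) * (a p : ℚ_[(p : ℕ)])‖ = 1 ↔ _
    rw [norm_mul, this, one_mul]
  rwa [h2] at h

/-! ### The quotient and its fundamental domain -/

theorem toQuot_smul (γ : GA.rational) (g : GA) : toQuot (γ • g) = toQuot g :=
  Quotient.sound ⟨γ, rfl⟩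

theorem toQuot_eq_iff {g h : GA} : toQuot g = toQuot h ↔ ∃ γ : GA.rational, γ • h = g :=
  Quotient.eq (r := MulAction.orbitRel GA.rational GA)

theorem toQuot_add_rat (β : ℚ) (x : Adele) (a : Idele) :
    toQuot (GA.mk (ratAdele β + x) a) = toQuot (GA.mk x a) := by
  have : GA.mk (ratAdele β + x) a =
      (⟨GA.mk (ratAdele β) (ratIdele 1), β, 1, rfl⟩ : GA.rational) • GA.mk x a := by
    change _ = GA.mk (ratAdele β) (ratIdele 1) * GA.mk x a
    apply GA.ext
    · rw [GA.mul_x, GA.mk_x, GA.mk_x, GA.mk_x, GA.mk_a, map_one, map_one, one_mul]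
    · rw [GA.mul_a, GA.mk_a, GA.mk_a, GA.mk_a, map_one, one_mul]
  rw [this, toQuot_smul]

theorem toQuot_rat_mul (α : ℚˣ) (x : Adele) (a : Idele) :
    toQuot (GA.mk (ratAdele (α : ℚ) * x) (ratIdele α * a)) = toQuot (GA.mk x a) := by
  have : GA.mk (ratAdele (α : ℚ) * x) (ratIdele α * a) =
      (⟨GA.mk (ratAdele 0) (ratIdele α), 0, α, rfl⟩ : GA.rational) • GA.mk x a := by
    change _ = GA.mk (ratAdele 0) (ratIdele α) * GA.mk x a
    apply GA.ext
    · rw [GA.mul_x, GA.mk_x, GA.mk_x, GA.mk_x, GA.mk_a, map_zero, zero_add, toAdele_ratIdele]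
    · rw [GA.mul_a, GA.mk_a, GA.mk_a, GA.mk_a]
  rw [this, toQuot_smul]

theorem measurable_mk : Measurable fun z : Adele × Idele => GA.mk z.1 z.2 := measurable_id
theorem measurable_x : Measurable GA.x := measurable_fst
theorem measurable_a : Measurable GA.a := measurable_snd

theorem measurable_ga_mul : Measurable fun z : GA × GA => z.1 * z.2 := by
  have h1 := measurable_toAdele
  refine Measurable.prodMk (f := fun z : GA × GA => z.1.x + z.1.a.toAdele * z.2.x)
    (g := fun z : GA × GA => z.1.a * z.2.a) ?_ ?_
  · exact (measurable_x.comp measurable_fst).add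
      ((h1.comp (measurable_a.comp measurable_fst)).mul (measurable_x.comp measurable_snd))
  · exact (measurable_a.comp measurable_fst).mul (measurable_a.comp measurable_snd)

theorem measurableSet_domain : MeasurableSet GA.domain :=
  measurableSet_adeleDomain.prod measurableSet_ideleDomain

instance : Countable ℚˣ := Function.Injective.countable (f := (Units.val : ℚˣ → ℚ)) Units.val_injective

instance : Countable GA.rational := by
  have h : Set.Countable (GA.rational : Set GA) := by
    refine (Set.countable_range fun z : ℚ × ℚˣ => GA.mk (ratAdele z.1) (ratIdele z.2)).mono ?_
    rintro g ⟨β, α, rfl⟩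
    exact ⟨(β, α), rfl⟩
  exact h.to_subtype

/-- The representative in `GA.domain` of a class in `G(ℚ)\G(𝔸)`. -/
def rep (q : AutQuot) : GA := (GA.existsUnique_mem_domain q.out).choose • q.out

theorem rep_mem (q : AutQuot) : rep q ∈ GA.domain :=
  (GA.existsUnique_mem_domain q.out).choose_spec.1

theorem toQuot_rep (q : AutQuot) : toQuot (rep q) = q := by
  rw [rep, toQuot_smul]
  exact Quotient.out_eq q

theorem rep_toQuot_eq {g : GA} (γ : GA.rational) (h : γ • g ∈ GA.domain) :
    rep (toQuot g) = γ • g := by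
  obtain ⟨δ, hδ⟩ := toQuot_eq_iff.1 (toQuot_rep (toQuot g))
  rw [← hδ]
  have h2 : δ • g ∈ GA.domain := hδ ▸ rep_mem _
  rw [(GA.existsUnique_mem_domain g).unique h2 h]

theorem rep_toQuot {g : GA} (h : g ∈ GA.domain) : rep (toQuot g) = g := by
  rw [rep_toQuot_eq 1 (by rwa [one_smul]), one_smul]

/-- Although `rep` is built by choice, its value at the class of `g` is `γ • g` for the unique
rational `γ` carrying `g` into the domain. Preimages are therefore countable unions over `γ` of
measurable sets. -/
theorem measurable_rep : Measurable rep := by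
  intro B hB
  change MeasurableSet (toQuot ⁻¹' (rep ⁻¹' B))
  have : toQuot ⁻¹' (rep ⁻¹' B) = ⋃ γ : GA.rational, (fun g : GA => (γ : GA) * g) ⁻¹'
      (GA.domain ∩ B) := by
    ext g
    simp only [Set.mem_preimage, Set.mem_iUnion, Set.mem_inter_iff]
    constructor
    · intro h
      obtain ⟨γ, hγ, -⟩ := GA.existsUnique_mem_domain g
      exact ⟨γ, hγ, by rwa [rep_toQuot_eq γ hγ] at h⟩
    · rintro ⟨γ, h1, h2⟩
      rw [rep_toQuot_eq γ h1]
      exact h2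
  rw [this]
  exact MeasurableSet.iUnion fun γ => (measurable_ga_mul.comp
    (measurable_const.prodMk measurable_id)) (measurableSet_domain.inter hB)

/-- The restriction of the Haar measure to the fundamental domain. -/
def domainMeasure : Measure (Adele × Idele) :=
  (adeleMeasure.restrict GA.adeleDomain).prod (ideleMeasure.restrict GA.ideleDomain)

theorem haar_restrict_domain : GA.haar.restrict GA.domain = domainMeasure :=
  (Measure.prod_restrict _ _).symm

instance : SigmaFinite domainMeasure := inferInstanceAs (SigmaFinite (Measure.prod _ _))

/-- The projection to the quotient, on pairs of coordinates. -/
def proj (z : Adele × Idele) : AutQuot := toQuot (GA.mk z.1 z.2)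

theorem measurePreserving_proj : MeasurePreserving proj domainMeasure quotMeasure :=
  ⟨measurable_toQuot.comp measurable_mk, by rw [quotMeasure, haar_restrict_domain]; rfl⟩

theorem ae_domainMeasure_mem :
    ∀ᵐ z ∂domainMeasure, z.1 ∈ GA.adeleDomain ∧ z.2 ∈ GA.ideleDomain := by
  rw [← haar_restrict_domain]
  exact ae_restrict_mem measurableSet_domain

theorem measurePreserving_rep : MeasurePreserving rep quotMeasure (GA.haar.restrict GA.domain) := by
  refine ⟨measurable_rep, ?_⟩
  rw [quotMeasure, Measure.map_map measurable_rep measurable_toQuot]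
  have : rep ∘ toQuot =ᵐ[GA.haar.restrict GA.domain] id := by
    filter_upwards [ae_restrict_mem measurableSet_domain] with g hg using rep_toQuot hg
  rw [Measure.map_congr this, Measure.map_id]

theorem setIntegral_comp_proj {g : AutQuot → ℂ} (hg : AEStronglyMeasurable g quotMeasure)
    {s : Set AutQuot} (hs : MeasurableSet s) :
    ∫ z in proj ⁻¹' s, g (proj z) ∂domainMeasure = ∫ q in s, g q ∂quotMeasure := by
  rw [← measurePreserving_proj.map_eq] at hg ⊢
  exact (setIntegral_map hs hg measurePreserving_proj.aemeasurable).symm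

theorem integral_comp_proj {g : AutQuot → ℂ} (hg : AEStronglyMeasurable g quotMeasure) :
    ∫ z, g (proj z) ∂domainMeasure = ∫ q, g q ∂quotMeasure := by
  simpa using setIntegral_comp_proj hg MeasurableSet.univ

/-- `P` is not assumed measurable, so the push-forward description of the measure is not enough; the
measure-preserving section `rep` transports the exceptional set instead. -/
theorem quotMeasure_ae_of_domain {P : AutQuot → Prop}
    (h : ∀ᵐ z ∂domainMeasure, P (proj z)) : ∀ᵐ q ∂quotMeasure, P q := by
  have h1 : ∀ᵐ g ∂(GA.haar.restrict GA.domain), P (toQuot g) := by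
    rw [haar_restrict_domain]; exact h
  filter_upwards [measurePreserving_rep.quasiMeasurePreserving.ae h1] with q hq
  rwa [toQuot_rep] at hq

theorem psi_mul_rat_add (α β : ℚ) (x : Adele) :
    psi (ratAdele α * (ratAdele β + x)) = psi (ratAdele α * x) := by
  have h : ratAdele α * (ratAdele β + x) = ratAdele (α * β) + ratAdele α * x := by
    rw [mul_add, map_mul]
  rw [h, AddChar.map_add_eq_mul, psi_ratAdele, one_mul]

/-- The Fourier coefficients along the unipotent radical. -/
theorem opI_ratIdele_mul (f : AutQuot → ℂ) (α : ℚˣ) (a : Idele) :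
    opI f (ratIdele α * a) = ∫ x in GA.adeleDomain,
      f (toQuot (GA.mk x a)) * conj (psi (ratAdele (α : ℚ) * x) : ℂ) ∂adeleMeasure := by
  rw [← setIntegral_adeleDomain_comp_mul α⁻¹
    (H := fun x => f (toQuot (GA.mk x a)) * conj (psi (ratAdele (α : ℚ) * x) : ℂ))]
  · refine integral_congr_ae (ae_of_all _ fun x => ?_)
    have h : ratAdele (α : ℚ) * (ratAdele ((α⁻¹ : ℚˣ) : ℚ) * x) = x := by
      rw [← mul_assoc, ← map_mul, Units.mul_inv, map_one, one_mul]
    have h2 := toQuot_rat_mul α (ratAdele ((α⁻¹ : ℚˣ) : ℚ) * x) a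
    rw [h] at h2
    simp only [h, h2]
  · intro β x
    rw [toQuot_add_rat, psi_mul_rat_add]

/-! ### Vanishing of the constant term -/

theorem measurePreserving_smul_haar (γ : GA.rational) :
    MeasurePreserving (fun g : GA => γ • g) GA.haar GA.haar := by
  obtain ⟨_, β, α, rfl⟩ := γ
  have h1 : MeasurePreserving (fun x : Adele => ratAdele β + ratAdele (α : ℚ) * x)
      adeleMeasure adeleMeasure :=
    (measurePreserving_add_left adeleMeasure (ratAdele β)).comp (measurePreserving_ratAdele_mul α)
  exact h1.prod (measurePreserving_idele_mul (ratIdele α))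

/-- The preimage of a null set is `G(ℚ)`-invariant, hence covered by countably many rational
translates of its null intersection with the domain. -/
theorem quasiMeasurePreserving_toQuot :
    Measure.QuasiMeasurePreserving toQuot GA.haar quotMeasure := by
  refine ⟨measurable_toQuot, Measure.AbsolutelyContinuous.mk fun s hs h0 => ?_⟩
  rw [Measure.map_apply measurable_toQuot hs]
  rw [quotMeasure, Measure.map_apply measurable_toQuot hs,
    Measure.restrict_apply (measurable_toQuot hs)] at h0
  refine measure_mono_null (t := ⋃ γ : GA.rational, (fun g : GA => γ • g) ⁻¹'
    (toQuot ⁻¹' s ∩ GA.domain)) ?_ (measure_iUnion_null fun γ => ?_)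
  · intro g hg
    obtain ⟨γ, hγ, -⟩ := GA.existsUnique_mem_domain g
    refine Set.mem_iUnion.2 ⟨γ, ?_, hγ⟩
    change toQuot (γ • g) ∈ s
    rw [toQuot_smul]
    exact hg
  · exact (measurePreserving_smul_haar γ).quasiMeasurePreserving.preimage_null h0

theorem measurePreserving_translate (x : Adele) :
    MeasurePreserving (fun g : GA => GA.mk x 1 * g) GA.haar GA.haar := by
  have h : (fun g : GA => GA.mk x 1 * g) =
      fun g : GA => (GA.mk (x + g.x) g.a) := by
    funext g
    apply GA.ext
    · rw [GA.mul_x, GA.mk_x, GA.mk_a, map_one, one_mul, GA.mk_x]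
    · rw [GA.mul_a, GA.mk_a, GA.mk_a, one_mul]
  rw [h]
  exact (measurePreserving_add_left adeleMeasure x).prod (MeasurePreserving.id ideleMeasure)

/-- The multiplicative part of the rational element moving `g` into the domain depends on `g.a`
alone. This makes functions of `(rep q).a` invariant under `N(𝔸)`, which supplies test vectors in
`H0`. -/
theorem rep_translate_a (x : Adele) (g : GA) :
    (rep (toQuot (GA.mk x 1 * g))).a = (rep (toQuot g)).a := by
  obtain ⟨γ, hγ⟩ := toQuot_eq_iff.1 (toQuot_rep (toQuot (GA.mk x 1 * g)))
  obtain ⟨δ, hδ⟩ := toQuot_eq_iff.1 (toQuot_rep (toQuot g))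
  have h1 := rep_mem (toQuot (GA.mk x 1 * g))
  have h2 := rep_mem (toQuot g)
  rw [← hγ] at h1 ⊢
  rw [← hδ] at h2 ⊢
  obtain ⟨_, β, α, rfl⟩ := γ
  obtain ⟨_, β', α', rfl⟩ := δ
  have h1' : ratIdele α * (1 * g.a) ∈ GA.ideleDomain := h1.2
  have h2' : ratIdele α' * g.a ∈ GA.ideleDomain := h2.2
  rw [one_mul] at h1'
  have := (GA.existsUnique_mem_ideleDomain g.a).unique h1' h2'
  subst this
  change ratIdele α * (1 * g.a) = ratIdele α * g.a
  rw [one_mul]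

theorem measurable_comp_proj (f : AutL2) : Measurable fun z : Adele × Idele => f (proj z) :=
  (Lp.stronglyMeasurable f).measurable.comp measurePreserving_proj.measurable

theorem memLp_comp_proj (f : AutL2) :
    MemLp (fun z : Adele × Idele => f (proj z)) 2 domainMeasure :=
  (Lp.memLp f).comp_measurePreserving measurePreserving_proj

instance : IsProbabilityMeasure (adeleMeasure.restrict GA.adeleDomain) :=
  ⟨by rw [Measure.restrict_apply_univ, adeleMeasure_adeleDomain]⟩

/-- The indicator of `{q | (rep q).a ∈ E}` lies in `H0`, and orthogonality of `f` to it is the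
claim. No other elements of `H0` are needed to kill the constant term. -/
theorem setIntegral_eq_zero_of_mem_H1 {f : AutL2} (hf : f ∈ H1) {E : Set Idele}
    (hE : MeasurableSet E) (hfin : ideleMeasure.restrict GA.ideleDomain E < ∞) :
    ∫ z in Prod.snd ⁻¹' E, f (proj z) ∂domainMeasure = 0 := by
  set s : Set AutQuot := {q | (rep q).a ∈ E} with hs
  have hsm : MeasurableSet s := (measurable_a.comp measurable_rep) hE
  have hpre : proj ⁻¹' s =ᵐ[domainMeasure] Prod.snd ⁻¹' E := by
    filter_upwards [ae_domainMeasure_mem] with z hz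
    have : rep (proj z) = GA.mk z.1 z.2 := rep_toQuot hz
    change ((rep (proj z)).a ∈ E) = (z.2 ∈ E)
    rw [this, GA.mk_a]
  have hμ : quotMeasure s ≠ ∞ := by
    rw [← measurePreserving_proj.measure_preimage hsm.nullMeasurableSet, measure_congr hpre,
      domainMeasure, ← Set.univ_prod, Measure.prod_prod, measure_univ, one_mul]
    exact hfin.ne
  have hmem : indicatorConstLp 2 hsm hμ (1 : ℂ) ∈ H0 := by
    intro x
    have h0 := quasiMeasurePreserving_toQuot.ae
      (indicatorConstLp_coeFn (p := 2) (hs := hsm) (hμs := hμ) (c := (1 : ℂ)))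
    filter_upwards [h0, (measurePreserving_translate x).quasiMeasurePreserving.ae h0] with g h1 h2
    rw [h1, h2]
    have : toQuot (GA.mk x 1 * g) ∈ s ↔ toQuot g ∈ s := by
      rw [hs, Set.mem_ofPred_eq, Set.mem_ofPred_eq, rep_translate_a]
    by_cases h : toQuot g ∈ s
    · rw [Set.indicator_of_mem h, Set.indicator_of_mem (this.2 h)]
    · rw [Set.indicator_of_notMem h, Set.indicator_of_notMem (fun h' => h (this.1 h'))]
  have h := (Submodule.mem_orthogonal _ _).1 hf _ (Submodule.subset_span hmem)
  rw [L2.inner_indicatorConstLp_one] at h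
  rw [← setIntegral_congr_set hpre, ← h]
  exact setIntegral_comp_proj (Lp.stronglyMeasurable f).aestronglyMeasurable hsm

theorem integral_adeleDomain_eq_zero {f : AutL2} (hf : f ∈ H1) :
    ∀ᵐ a ∂(ideleMeasure.restrict GA.ideleDomain),
      ∫ x in GA.adeleDomain, f (proj (x, a)) ∂adeleMeasure = 0 := by
  -- Over a set `E` of finite measure, `L²` is contained in `L¹`, so Fubini applies there.
  have hint : ∀ E : Set Idele, MeasurableSet E → ideleMeasure.restrict GA.ideleDomain E < ∞ →
      Integrable (fun z => f (proj z)) ((adeleMeasure.restrict GA.adeleDomain).prod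
        ((ideleMeasure.restrict GA.ideleDomain).restrict E)) := by
    intro E hE hfin
    have hfm : IsFiniteMeasure ((ideleMeasure.restrict GA.ideleDomain).restrict E) :=
      ⟨by rwa [Measure.restrict_apply_univ]⟩
    have h := (memLp_comp_proj f).restrict (Prod.snd ⁻¹' E)
    have h2 : domainMeasure.restrict (Prod.snd ⁻¹' E) =
        (adeleMeasure.restrict GA.adeleDomain).prod
          ((ideleMeasure.restrict GA.ideleDomain).restrict E) := by
      rw [domainMeasure, ← Set.univ_prod, ← Measure.prod_restrict, Measure.restrict_univ]
    rw [h2] at h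
    exact h.integrable (by norm_num)
  refine ae_eq_zero_of_forall_setIntegral_eq_of_sigmaFinite (fun E hE hfin => ?_)
    fun E hE hfin => ?_
  · exact (hint E hE hfin).integral_prod_right
  · rw [← setIntegral_eq_zero_of_mem_H1 hf hE hfin, domainMeasure, ← Set.univ_prod,
      ← Measure.prod_restrict, Measure.restrict_univ, integral_prod_symm _ (hint E hE hfin)]

/-! ### Invariance under the unipotent part of `K` -/

/-- The subgroup `∏_p p^{n_p} ℤ_p = N ∏_p ℤ_p` of the finite adeles. -/
def levelSet (n : Nat.Primes →₀ ℕ) : Set FinAdele :=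
  {y | ∀ p : Nat.Primes, ‖y p‖ ≤ ((p : ℕ) : ℝ) ^ (-(n p : ℤ))}

variable {n : Nat.Primes →₀ ℕ}

theorem isClosed_levelSet : IsClosed (levelSet n) := by
  have : levelSet n = ⋂ p : Nat.Primes, {y | ‖y p‖ ≤ ((p : ℕ) : ℝ) ^ (-(n p : ℤ))} := by
    ext y; simp [levelSet]
  rw [this]
  exact isClosed_iInter fun p => isClosed_le (continuous_eval p).norm continuous_const

theorem measurableSet_levelSet : MeasurableSet (levelSet n) := isClosed_levelSet.measurableSet

theorem add_mem_levelSet {y z : FinAdele} (hy : y ∈ levelSet n) (hz : z ∈ levelSet n) :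
    y + z ∈ levelSet n :=
  fun p => (Padic.nonarchimedean (y p) (z p)).trans (max_le (hy p) (hz p))

theorem neg_mem_levelSet {y : FinAdele} (hy : y ∈ levelSet n) : -y ∈ levelSet n := fun p => by
  change ‖-(y p)‖ ≤ _
  rw [norm_neg]; exact hy p

theorem levelN_ne_zero : levelN n ≠ 0 :=
  Finset.prod_ne_zero_iff.2 fun p _ => pow_ne_zero _ p.2.ne_zero

theorem norm_levelN (p : Nat.Primes) :
    ‖((levelN n : ℕ) : ℚ_[(p : ℕ)])‖ = ((p : ℕ) : ℝ) ^ (-(n p : ℤ)) := by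
  have h := GA.norm_prod_primes (fun q => (n q : ℤ)) n.support p
  have h2 : ((∏ q ∈ n.support, ((q : ℕ) : ℚ) ^ (n q : ℤ) : ℚ) : ℚ_[(p : ℕ)]) =
      ((levelN n : ℕ) : ℚ_[(p : ℕ)]) := by
    rw [levelN, Finsupp.prod]
    push_cast
    simp only [zpow_natCast]
  rw [h2] at h
  rw [h]
  split_ifs with hp
  · rfl
  · rw [Finsupp.notMem_support_iff.1 hp]; simp

/-- The level `N` as a nonzero rational number. -/
def levelUnit (n : Nat.Primes →₀ ℕ) : ℚˣ :=
  Units.mk0 (levelN n : ℚ) (by exact_mod_cast levelN_ne_zero)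

theorem levelDomain_eq :
    {x : Adele | ratAdele ((levelUnit n)⁻¹ : ℚˣ) * x ∈ GA.adeleDomain} =
      Set.Ico (0 : ℝ) (levelN n) ×ˢ levelSet n := by
  have hN : (0 : ℝ) < levelN n := by exact_mod_cast Nat.pos_of_ne_zero levelN_ne_zero
  ext x
  refine and_congr ?_ (forall_congr' fun p => ?_)
  · change 0 ≤ (((levelUnit n)⁻¹ : ℚˣ) : ℚ) * x.1 ∧ (((levelUnit n)⁻¹ : ℚˣ) : ℚ) * x.1 < 1 ↔
      0 ≤ x.1 ∧ x.1 < levelN n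
    have : (((((levelUnit n)⁻¹ : ℚˣ) : ℚ)) : ℝ) = (levelN n : ℝ)⁻¹ := by
      rw [levelUnit]; simp
    rw [this, inv_mul_lt_one₀ hN, mul_nonneg_iff_of_pos_left (inv_pos.2 hN)]
  · change ‖((((levelUnit n)⁻¹ : ℚˣ) : ℚ) : ℚ_[(p : ℕ)]) * x.2 p‖ ≤ 1 ↔ _
    have : ((((levelUnit n)⁻¹ : ℚˣ) : ℚ) : ℚ_[(p : ℕ)]) = ((levelN n : ℕ) : ℚ_[(p : ℕ)])⁻¹ := by
      rw [levelUnit]; simp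
    have hp : (0 : ℝ) < ((p : ℕ) : ℝ) ^ (-(n p : ℤ)) := zpow_pos (by exact_mod_cast p.2.pos) _
    rw [this, norm_mul, norm_inv, norm_levelN, inv_mul_le_one₀ hp]

/-- This is `N·adeleDomain`. On it a character of frequency `k/N` depends on the real coordinate
only, which turns adelic Fourier coefficients into classical ones on `[0, N)`. -/
theorem isAddFundamentalDomain_level :
    IsAddFundamentalDomain ratSubgroup (Set.Ico (0 : ℝ) (levelN n) ×ˢ levelSet n)
      adeleMeasure := by
  rw [← levelDomain_eq]
  exact isAddFundamentalDomain_smul _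

/-- The Haar measure on `∏_p p^{n_p} ℤ_p`. -/
def levelMeasure (n : Nat.Primes →₀ ℕ) : Measure FinAdele :=
  (Measure.addHaarMeasure zHat).restrict (levelSet n)

/-- The fundamental domain `[0, N) × levelSet n` has total volume one and its real factor has length
`N`. -/
theorem levelMeasure_univ : levelMeasure n Set.univ = (levelN n : ℝ≥0∞)⁻¹ := by
  have h := (isAddFundamentalDomain_level (n := n)).measure_eq isAddFundamentalDomain_adeleDomain
  rw [adeleMeasure_adeleDomain, adeleMeasure, Measure.prod_prod, Real.volume_Ico, sub_zero,
    ENNReal.ofReal_natCast] at h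
  rw [levelMeasure, Measure.restrict_apply_univ]
  exact ENNReal.eq_inv_of_mul_eq_one_left (by rw [mul_comm]; exact h)

instance : IsFiniteMeasure (levelMeasure n) :=
  ⟨by rw [levelMeasure_univ]; simp [Nat.pos_iff_ne_zero, levelN_ne_zero]⟩

instance : NeZero (levelMeasure n) := ⟨fun h => by
  have := levelMeasure_univ (n := n)
  rw [h] at this
  exact ENNReal.inv_ne_zero.2 (ENNReal.natCast_ne_top _) this.symm⟩

theorem measurePreserving_levelMeasure_add {y : FinAdele} (hy : y ∈ levelSet n) :
    MeasurePreserving (fun z => y + z) (levelMeasure n) (levelMeasure n) := by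
  have h := (measurePreserving_add_left (Measure.addHaarMeasure zHat) y).restrict_preimage
    (measurableSet_levelSet (n := n))
  have h2 : (fun z => y + z) ⁻¹' levelSet n = levelSet n := by
    ext z
    refine ⟨fun h => ?_, fun h => add_mem_levelSet hy h⟩
    have := add_mem_levelSet (neg_mem_levelSet hy) h
    rwa [neg_add_cancel_left] at this
  rwa [h2] at h

/-- A finite adele as an adele with vanishing real component. -/
def finEmb (y : FinAdele) : Adele := (0, y)

theorem measurable_finEmb : Measurable finEmb := measurable_const.prodMk measurable_id

theorem toAdele_mul_finEmb (a : Idele) (y : FinAdele) :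
    a.toAdele * finEmb y = finEmb (a.toAdele.2 * y) :=
  Prod.ext (mul_zero _) rfl

theorem finEmb_mem_compactK {y : FinAdele} (hy : y ∈ levelSet n) :
    GA.mk (finEmb y) 1 ∈ compactK n := by
  refine ⟨rfl, Or.inl rfl, fun p => ⟨hy p, ?_, ?_⟩⟩
  · change ‖(1 : ℚ_[(p : ℕ)])‖ = 1
    exact norm_one
  · change ‖(1 : ℚ_[(p : ℕ)]) - 1‖ ≤ _
    rw [sub_self, norm_zero]; positivity

/-- For almost every `a`, a `K`-fixed function is invariant in `x` under all of
`∏_p p^{n_p} ℤ_p`. -/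
theorem ae_levelSet_invariant {f : AutL2} (hf : f ∈ fixedK n) :
    ∀ᵐ a ∂(ideleMeasure.restrict GA.ideleDomain), ∀ y ∈ levelSet n,
      ∀ᵐ x ∂adeleMeasure, f (proj (x + finEmb y, a)) = f (proj (x, a)) := by
  have hF := measurable_comp_proj f
  have hmeas : MeasurableSet {w : Idele × (FinAdele × Adele) |
      f (proj (w.2.2 + w.1.toAdele * finEmb w.2.1, w.1)) = f (proj (w.2.2, w.1))} := by
    have h1 := measurable_toAdele
    have h2 := measurable_finEmb
    refine measurableSet_eq_fun (hF.comp (Measurable.prodMk ?_ measurable_fst))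
      (hF.comp (measurable_snd.snd.prodMk measurable_fst))
    exact measurable_snd.snd.add ((h1.comp measurable_fst).mul (h2.comp measurable_snd.fst))
  -- Right multiplication by `(y, 1)` moves `x` by `a y`. At this stage the exceptional set still
  -- depends on `y`.
  have h1 : ∀ y ∈ levelSet n, ∀ᵐ z ∂(adeleMeasure.prod ideleMeasure),
      f (proj (z.1 + z.2.toAdele * finEmb y, z.2)) = f (proj z) := by
    intro y hy
    have h := hf _ (finEmb_mem_compactK hy)
    have h' : ∀ᵐ g ∂GA.haar, f (toQuot (GA.mk (g.x + g.a.toAdele * finEmb y) g.a)) =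
        f (toQuot g) := by
      filter_upwards [h] with g hg
      rw [← hg]
      congr 2
      apply GA.ext
      · rfl
      · rw [GA.mul_a, GA.mk_a, GA.mk_a, mul_one]
    exact h'
  -- Fubini exchanges the quantifiers: for almost every `a`, almost every `y` is a period up to the
  -- twist by `a`.
  have h2 : ∀ᵐ w ∂(ideleMeasure.prod ((levelMeasure n).prod adeleMeasure)),
      f (proj (w.2.2 + w.1.toAdele * finEmb w.2.1, w.1)) = f (proj (w.2.2, w.1)) := by
    have hperm : MeasurePreserving (fun w : Idele × (FinAdele × Adele) => (w.2.1, (w.2.2, w.1)))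
        (ideleMeasure.prod ((levelMeasure n).prod adeleMeasure))
        ((levelMeasure n).prod (adeleMeasure.prod ideleMeasure)) :=
      (measurePreserving_prodAssoc _ _ _).comp Measure.measurePreserving_swap
    refine hperm.quasiMeasurePreserving.ae (p := fun w => f (proj (w.2.1 + w.2.2.toAdele *
      finEmb w.1, w.2.2)) = f (proj w.2)) ?_
    rw [Measure.ae_prod_iff_ae_ae]
    · filter_upwards [ae_restrict_mem (measurableSet_levelSet (n := n))] with y hy using h1 y hy
    · exact (measurable_snd.snd.prodMk (measurable_fst.prodMk measurable_snd.fst)) hmeas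
  filter_upwards [ae_restrict_of_ae (Measure.ae_ae_of_ae_prod h2),
    ae_restrict_mem measurableSet_ideleDomain] with a ha haD
  have h3 := Measure.ae_ae_of_ae_prod ha
  set G : Set FinAdele := {y | ∀ᵐ x ∂adeleMeasure, f (proj (x + finEmb y, a)) = f (proj (x, a))}
  have hsub : ∀ y z, y ∈ G → z + y ∈ G → z ∈ G := by
    intro y z hy hzy
    have h4 := (measurePreserving_add_right adeleMeasure (finEmb z)).quasiMeasurePreserving.ae hy
    filter_upwards [hzy, h4] with x h5 h6
    rw [← h6, ← h5]
    congr 3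
    rw [add_assoc]
    exact congrArg (x + ·) (Prod.ext (add_zero (0 : ℝ)) rfl)
  -- Almost every period becomes every period: translation by `y` preserves `levelMeasure n`, so
  -- some `z` has both `a z` and `a (y + z)` in `G`, and `G` contains their difference `a y`.
  have key : ∀ y ∈ levelSet n, a.toAdele.2 * y ∈ G := by
    intro y hy
    have h5 := (measurePreserving_levelMeasure_add hy).quasiMeasurePreserving.ae h3
    obtain ⟨z, hz1, hz2⟩ := (h3.and h5).exists
    refine hsub (a.toAdele.2 * z) _ ?_ ?_
    · filter_upwards [hz1] with x hx
      rwa [toAdele_mul_finEmb] at hx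
    · filter_upwards [hz2] with x hx
      rwa [toAdele_mul_finEmb, mul_add] at hx
  intro y hy
  -- The twist is undone by using `a⁻¹ y` in place of `y`; it stays in the level set because `a` is
  -- a unit at every prime.
  have h6 := key (a⁻¹.toAdele.2 * y) ?_
  · have h7 : a.toAdele.2 * (a⁻¹.toAdele.2 * y) = y := by
      rw [← mul_assoc, ← Prod.snd_mul, ← map_mul, mul_inv_cancel, map_one]
      exact one_mul y
    rwa [h7] at h6
  · intro p
    change ‖(((a.2 p)⁻¹ : ℚ_[(p : ℕ)]ˣ) : ℚ_[(p : ℕ)]) * y p‖ ≤ _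
    rw [norm_mul, Units.val_inv_eq_inv_val, norm_inv, haD.2 p, inv_one, one_mul]
    exact hy p

/-! ### Fourier series -/

/-- A square-integrable function on an interval with absolutely summable Fourier coefficients is
almost everywhere the sum of its Fourier series. -/
theorem ae_eq_tsum_fourierCoeffOn {T : ℝ} (hT : 0 < T) {φ : ℝ → ℂ}
    (hφ : MemLp φ 2 (volume.restrict (Set.Ioc 0 T)))
    (hs : Summable fun k : ℤ => ‖fourierCoeffOn hT φ k‖) :
    ∀ᵐ t ∂(volume.restrict (Set.Ioc 0 T)),
      φ t = ∑' k : ℤ, fourierCoeffOn hT φ k * fourier k (t : AddCircle T) := by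
  have : Fact (0 < T) := ⟨hT⟩
  have hφ' : MemLp φ 2 (volume.restrict (Set.Ioc 0 (0 + T))) := by rwa [zero_add]
  have h := hφ'.memLp_liftIoc.haarAddCircle
  have hc : ∀ k, fourierCoeff h.toLp k = fourierCoeffOn hT φ k := fun k => by
    rw [fourierCoeff_congr_ae h.coeFn_toLp, fourierCoeff_liftIoc_eq,
      fourierCoeffOn_eq_integral, fourierCoeffOn_eq_integral]
    simp only [fourier_coe_apply, zero_add, sub_zero]
  have h1 := hasSum_fourier_series_L2 h.toLp
  have hsum : Summable fun k : ℤ => fourierCoeffOn hT φ k • (fourier k : C(AddCircle T, ℂ)) := by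
    refine Summable.of_norm ?_
    simpa only [norm_smul, fourier_norm, mul_one] using hs
  -- Absolute summability makes the series converge uniformly to the continuous function `G`. Since
  -- it also converges in `L²` to the class of `φ`, uniqueness of the `L²` sum identifies the two
  -- almost everywhere.
  set G : C(AddCircle T, ℂ) := ∑' k : ℤ, fourierCoeffOn hT φ k • (fourier k : C(AddCircle T, ℂ))
  have h2 : HasSum (fun k : ℤ => fourierCoeffOn hT φ k • (fourierLp 2 k))
      (ContinuousMap.toLp (E := ℂ) 2 AddCircle.haarAddCircle ℂ G) := by
    have := (ContinuousMap.toLp (E := ℂ) 2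
      (AddCircle.haarAddCircle (T := T)) ℂ).hasSum hsum.hasSum
    simpa only [map_smul] using this
  simp_rw [hc] at h1
  have h3 := h1.unique h2
  have h4 : AddCircle.liftIoc T 0 φ =ᵐ[AddCircle.haarAddCircle] G := by
    refine h.coeFn_toLp.symm.trans ?_
    rw [h3]
    exact ContinuousMap.coeFn_toLp _ _
  have h5 : AddCircle.liftIoc T 0 φ =ᵐ[volume] G := by
    rw [AddCircle.volume_eq_smul_haarAddCircle]
    exact Measure.ae_smul_measure h4 _
  have h6 := (AddCircle.measurePreserving_mk T 0).quasiMeasurePreserving.ae h5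
  rw [zero_add] at h6
  filter_upwards [h6, ae_restrict_mem measurableSet_Ioc] with t ht htm
  rw [AddCircle.liftIoc_coe_apply (by rwa [zero_add])] at ht
  rw [ht]
  exact (((ContinuousMap.evalCLM ℂ (t : AddCircle T)).hasSum hsum.hasSum).tsum_eq).symm

theorem ae_of_ae_fundamentalDomain {s : Set Adele}
    (hex : ∀ x : Adele, ∃ β : ℚ, ratAdele β + x ∈ s) (hsm : MeasurableSet s) {P : Adele → Prop}
    (hP : ∀ (β : ℚ) (x : Adele), P (ratAdele β + x) → P x)
    (h : ∀ᵐ x ∂(adeleMeasure.restrict s), P x) : ∀ᵐ x ∂adeleMeasure, P x := by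
  rw [ae_restrict_iff' hsm] at h
  have h2 : ∀ᵐ x ∂adeleMeasure, ∀ β : ℚ, ratAdele β + x ∈ s → P (ratAdele β + x) :=
    ae_all_iff.2 fun β =>
      (measurePreserving_add_left adeleMeasure (ratAdele β)).quasiMeasurePreserving.ae h
  filter_upwards [h2] with x hx
  obtain ⟨β, hβ⟩ := hex x
  exact hP β x (hx β hβ)

variable {n : Nat.Primes →₀ ℕ}

/-- The rational number `k / N`. -/
def freq (n : Nat.Primes →₀ ℕ) (k : ℤ) : ℚ := k / levelN n

theorem exists_rat_add_mem_level (x : Adele) :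
    ∃ β : ℚ, ratAdele β + x ∈ Set.Ico (0 : ℝ) (levelN n) ×ˢ levelSet n := by
  rw [← levelDomain_eq]
  obtain ⟨β, hβ, -⟩ := GA.existsUnique_mem_adeleDomain (ratAdele ((levelUnit n)⁻¹ : ℚˣ) * x)
  refine ⟨levelUnit n * β, ?_⟩
  have : ratAdele ((levelUnit n)⁻¹ : ℚˣ) * (ratAdele (levelUnit n * β) + x) =
      ratAdele β + ratAdele ((levelUnit n)⁻¹ : ℚˣ) * x := by
    rw [mul_add, ← map_mul, ← mul_assoc, Units.inv_mul, one_mul]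
  exact (congrArg (· ∈ GA.adeleDomain) this).mpr hβ

/-- For `z` in the level set `kz/N` is integral at every prime, so only `ψ_∞` contributes. The sign
in `ψ_∞(x) = exp(-2πix)` turns index `k` into `-k`. -/
theorem psi_freq_mul {t : ℝ} {z : FinAdele} (hz : z ∈ levelSet n) (k : ℤ) :
    (psi (ratAdele (freq n k) * (t, z)) : ℂ) = fourier (-k) (t : AddCircle (levelN n : ℝ)) := by
  rw [psi_of_mem_zHat]
  · rw [fourier_coe_apply, Circle.coe_exp]
    congr 1
    change ((-(2 * Real.pi * (((freq n k : ℚ) : ℝ) * t)) : ℝ) : ℂ) * Complex.I = _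
    rw [freq]
    push_cast
    ring
  · intro p
    change ‖((freq n k : ℚ) : ℚ_[(p : ℕ)]) * z p‖ ≤ 1
    have hp : (0 : ℝ) < ((p : ℕ) : ℝ) ^ (-(n p : ℤ)) := zpow_pos (by exact_mod_cast p.2.pos) _
    rw [freq, norm_mul]
    push_cast
    rw [norm_div, norm_levelN, div_mul_eq_mul_div, div_le_one hp]
    calc _ ≤ 1 * ‖z p‖ := by gcongr; exact Padic.norm_int_le_one _
      _ ≤ _ := by rw [one_mul]; exact hz p

theorem measurable_psi_mul (q : ℚ) : Measurable fun x : Adele => (psi (ratAdele q * x) : ℂ) :=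
  measurable_psi.comp (measurable_const.mul measurable_id)

theorem adeleMeasure_restrict_level :
    adeleMeasure.restrict (Set.Ico (0 : ℝ) (levelN n) ×ˢ levelSet n) =
      (volume.restrict (Set.Ico (0 : ℝ) (levelN n))).prod (levelMeasure n) :=
  (Measure.prod_restrict _ _).symm

section Expansion

variable {h : Adele → ℂ} (hm : Measurable h)
  (hper : ∀ (β : ℚ) (x : Adele), h (ratAdele β + x) = h x)
  (hinv : ∀ y ∈ levelSet n, ∀ᵐ x ∂adeleMeasure, h (x + finEmb y) = h x)
  (hL2 : MemLp h 2 (adeleMeasure.restrict GA.adeleDomain))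

include hm hper hL2 in
theorem memLp_level :
    MemLp h 2 (adeleMeasure.restrict (Set.Ico (0 : ℝ) (levelN n) ×ˢ levelSet n)) := by
  rw [memLp_two_iff_integrable_sq_norm hm.aestronglyMeasurable] at hL2 ⊢
  refine (isAddFundamentalDomain_level.integrableOn_iff isAddFundamentalDomain_adeleDomain ?_).2 hL2
  rintro ⟨_, β, rfl⟩ x
  change ‖h (ratAdele β + x)‖ ^ 2 = _
  rw [hper]

include hm hper hinv hL2 in
-- Invariance under the level set should make `h` independent of its finite coordinate there, but it
-- holds only almost everywhere for each translation. Fubini selects a base point `z₀` from which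
-- almost every translate agrees, and whose real slice is square-integrable.
theorem exists_slice : ∃ z₀ : FinAdele,
    MemLp (fun t : ℝ => h (t, z₀)) 2 (volume.restrict (Set.Ico (0 : ℝ) (levelN n))) ∧
    ∀ᵐ x ∂((volume.restrict (Set.Ico (0 : ℝ) (levelN n))).prod (levelMeasure n)),
      h x = h (x.1, z₀) := by
  have hmeas : MeasurableSet {w : FinAdele × (ℝ × FinAdele) |
      h (w.2.1, w.1 + w.2.2) = h (w.2.1, w.1)} := by
    refine measurableSet_eq_fun (hm.comp ?_) (hm.comp ?_)
    · exact measurable_snd.fst.prodMk (measurable_fst.add measurable_snd.snd)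
    · exact measurable_snd.fst.prodMk measurable_fst
  set ρ := (volume.restrict (Set.Ico (0 : ℝ) (levelN n))) with hρ
  have h1 : ∀ᵐ z ∂levelMeasure n, ∀ᵐ x ∂(ρ.prod (levelMeasure n)),
      h (x.1, x.2 + z) = h (x.1, x.2) := by
    filter_upwards [ae_restrict_mem (measurableSet_levelSet (n := n))] with z hz
    rw [← adeleMeasure_restrict_level]
    refine ae_restrict_of_ae ?_
    filter_upwards [hinv z hz] with x hx
    rw [← hx]
    exact congrArg h (Prod.ext (add_zero x.1).symm rfl)
  have h2 : ∀ᵐ w ∂((levelMeasure n).prod (ρ.prod (levelMeasure n))),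
      h (w.2.1, w.1 + w.2.2) = h (w.2.1, w.1) := by
    -- Exchanging the two finite variables makes the base point, rather than the translation, the
    -- outer variable.
    have hperm : MeasurePreserving
        (fun w : FinAdele × (ℝ × FinAdele) => (w.2.2, (w.2.1, w.1)))
        ((levelMeasure n).prod (ρ.prod (levelMeasure n)))
        ((levelMeasure n).prod (ρ.prod (levelMeasure n))) := by
      have e1 := measurePreserving_prodAssoc ρ (levelMeasure n) (levelMeasure n)
      have e2 : MeasurePreserving Prod.swap ((levelMeasure n).prod (ρ.prod (levelMeasure n)))
        ((ρ.prod (levelMeasure n)).prod (levelMeasure n)) := Measure.measurePreserving_swap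
      have e3 : MeasurePreserving (Prod.map id Prod.swap)
          (ρ.prod ((levelMeasure n).prod (levelMeasure n)))
          (ρ.prod ((levelMeasure n).prod (levelMeasure n))) :=
        (MeasurePreserving.id _).prod Measure.measurePreserving_swap
      have e4 := measurePreserving_prodAssoc ρ (levelMeasure n) (levelMeasure n)
      have e5 : MeasurePreserving Prod.swap ((ρ.prod (levelMeasure n)).prod (levelMeasure n))
          ((levelMeasure n).prod (ρ.prod (levelMeasure n))) := Measure.measurePreserving_swap
      exact e5.comp ((e4.symm _).comp (e3.comp (e1.comp e2)))
    refine hperm.quasiMeasurePreserving.ae (p := fun w => h (w.2.1, w.2.2 + w.1) =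
      h (w.2.1, w.2.2)) ?_
    rw [Measure.ae_prod_iff_ae_ae]
    · exact h1
    · exact (measurable_snd.snd.prodMk (measurable_snd.fst.prodMk measurable_fst)) hmeas
  have hL := memLp_level (n := n) hm hper hL2
  rw [memLp_two_iff_integrable_sq_norm hm.aestronglyMeasurable, adeleMeasure_restrict_level] at hL
  obtain ⟨z₀, ⟨hz₀, hz₁⟩, hz₂⟩ := ((Measure.ae_ae_of_ae_prod h2).and hL.prod_left_ae |>.and
    (ae_restrict_mem (measurableSet_levelSet (n := n)))).exists
  refine ⟨z₀, ?_, ?_⟩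
  · rw [memLp_two_iff_integrable_sq_norm]
    · exact hz₁
    · exact (hm.comp (measurable_id.prodMk measurable_const)).aestronglyMeasurable
  -- Substituting `-z₀ + y` for the translation turns `z₀ + (translation)` into the arbitrary point
  -- `y`.
  · have h3 := ((MeasurePreserving.id ρ).prod (measurePreserving_levelMeasure_add
      (neg_mem_levelSet hz₂))).quasiMeasurePreserving.ae hz₀
    filter_upwards [h3] with x hx
    simpa using hx

include hm hper hinv hL2 in
/-- A `ℚ`-periodic function on the adeles which is invariant under `N ∏_p ℤ_p` is almost everywhere
the sum of its Fourier series, provided that the latter converges absolutely. -/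
theorem ae_eq_tsum_psi
    (hs : Summable fun k : ℤ => ‖∫ x in GA.adeleDomain,
      h x * conj (psi (ratAdele (freq n k) * x) : ℂ) ∂adeleMeasure‖) :
    ∀ᵐ x ∂adeleMeasure, h x = ∑' k : ℤ, (∫ x in GA.adeleDomain,
      h x * conj (psi (ratAdele (freq n k) * x) : ℂ) ∂adeleMeasure) *
        psi (ratAdele (freq n k) * x) := by
  have hN : (0 : ℝ) < levelN n := by exact_mod_cast Nat.pos_of_ne_zero levelN_ne_zero
  obtain ⟨z₀, hφ, hae⟩ := exists_slice hm hper hinv hL2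
  set φ : ℝ → ℂ := fun t => h (t, z₀) with hφdef
  rw [restrict_Ico_eq_restrict_Ioc] at hφ
  have hlev : ∀ᵐ x ∂((volume.restrict (Set.Ico (0 : ℝ) (levelN n))).prod (levelMeasure n)),
      x.2 ∈ levelSet n :=
    Measure.quasiMeasurePreserving_snd.ae (ae_restrict_mem (measurableSet_levelSet (n := n)))
  have hc : ∀ k : ℤ, ∫ x in GA.adeleDomain,
      h x * conj (psi (ratAdele (freq n k) * x) : ℂ) ∂adeleMeasure =
        fourierCoeffOn hN φ (-k) := by
    intro k
    rw [isAddFundamentalDomain_adeleDomain.setIntegral_eq (isAddFundamentalDomain_level (n := n)),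
      adeleMeasure_restrict_level]
    · have : ∀ᵐ x ∂((volume.restrict (Set.Ico (0 : ℝ) (levelN n))).prod (levelMeasure n)),
          h x * conj (psi (ratAdele (freq n k) * x) : ℂ) =
            (φ x.1 * fourier k (x.1 : AddCircle (levelN n : ℝ))) * 1 := by
        filter_upwards [hae, hlev] with x hx1 hx2
        rw [hx1, show x = (x.1, x.2) from rfl, psi_freq_mul hx2, fourier_neg, Complex.conj_conj,
          mul_one]
      -- The mass `1/N` of the finite factor is exactly the normalisation `1/(b - a)` in the
      -- classical Fourier coefficient on `[0, N]`.
      rw [integral_congr_ae this, integral_prod_mul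
        (fun t : ℝ => φ t * fourier k (t : AddCircle (levelN n : ℝ))) (fun _ : FinAdele => (1 : ℂ)),
        integral_const, Measure.real, levelMeasure_univ, fourierCoeffOn_eq_integral,
        intervalIntegral.integral_of_le hN.le, restrict_Ico_eq_restrict_Ioc, neg_neg, sub_zero]
      simp [mul_comm]
    · rintro ⟨_, β, rfl⟩ x
      change h (ratAdele β + x) * conj (psi (ratAdele (freq n k) * (ratAdele β + x)) : ℂ) = _
      rw [hper, psi_mul_rat_add]
  simp_rw [hc] at hs ⊢
  have hs' : Summable fun k : ℤ => ‖fourierCoeffOn hN φ k‖ := by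
    refine (Equiv.neg ℤ).summable_iff.1 ?_
    exact hs
  have h1 := ae_eq_tsum_fourierCoeffOn hN hφ hs'
  rw [← restrict_Ico_eq_restrict_Ioc] at h1
  refine ae_of_ae_fundamentalDomain (exists_rat_add_mem_level (n := n))
    (measurableSet_Ico.prod measurableSet_levelSet) ?_ ?_
  · intro β x hx
    rw [hper] at hx
    rw [hx]
    refine tsum_congr fun k => ?_
    rw [psi_mul_rat_add]
  · rw [adeleMeasure_restrict_level]
    filter_upwards [hae, hlev, Measure.quasiMeasurePreserving_fst.ae h1] with x hx1 hx2 hx3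
    rw [hx1]
    refine hx3.trans ?_
    rw [← (Equiv.neg ℤ).tsum_eq]
    refine tsum_congr fun k => ?_
    rw [show x = (x.1, x.2) from rfl, psi_freq_mul hx2]
    rfl

end Expansion

/-! ### The Fourier expansion of a `K`-fixed function -/

variable {n : Nat.Primes →₀ ℕ}

/-- The nonzero rational number `k / N`. -/
def freqUnit (n : Nat.Primes →₀ ℕ) (k : {k : ℤ // k ≠ 0}) : ℚˣ :=
  Units.mk0 (freq n k) (div_ne_zero (by exact_mod_cast k.2) (by exact_mod_cast levelN_ne_zero))

theorem freqUnit_injective : Function.Injective (freqUnit n) := by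
  intro k l h
  have h1 : freq n k = freq n l := congrArg Units.val h
  have hN : (levelN n : ℚ) ≠ 0 := by exact_mod_cast levelN_ne_zero
  rw [freq, freq, div_left_inj' hN] at h1
  exact Subtype.ext (by exact_mod_cast h1)

/-- The Fourier coefficient of `f(·, a)` of index `k / N`. -/
def coeff (n : Nat.Primes →₀ ℕ) (f : AutQuot → ℂ) (k : ℤ) (a : Idele) : ℂ :=
  ∫ x in GA.adeleDomain, f (proj (x, a)) * conj (psi (ratAdele (freq n k) * x) : ℂ) ∂adeleMeasure

theorem coeff_eq_opI (f : AutQuot → ℂ) (k : {k : ℤ // k ≠ 0}) (a : Idele) :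
    coeff n f k a = opI f (ratIdele (freqUnit n k) * a) :=
  (opI_ratIdele_mul f (freqUnit n k) a).symm

theorem measurable_coeff_integrand (f : AutL2) (q : ℚ) :
    Measurable fun z : Adele × Idele => f (proj z) * conj (psi (ratAdele q * z.1) : ℂ) :=
  (measurable_comp_proj f).mul
    (Complex.continuous_conj.measurable.comp ((measurable_psi_mul q).comp measurable_fst))

theorem measurable_coeff (f : AutL2) (k : ℤ) : Measurable (coeff n f k) :=
  ((measurable_coeff_integrand f (freq n k)).stronglyMeasurable.integral_prod_left'
    (μ := adeleMeasure.restrict GA.adeleDomain)).measurable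

theorem measurable_opI (f : AutL2) : Measurable (opI f) := by
  have h := ((measurable_coeff_integrand f 1).stronglyMeasurable.integral_prod_left'
    (μ := adeleMeasure.restrict GA.adeleDomain)).measurable
  have h1 : opI f = fun a => ∫ x in GA.adeleDomain,
      f (proj (x, a)) * conj (psi (ratAdele 1 * x) : ℂ) ∂adeleMeasure := funext fun a => by
    have h2 := opI_ratIdele_mul f 1 a
    rw [map_one, one_mul] at h2
    exact h2
  rw [h1]
  exact h

theorem coeff_zero_ae {f : AutL2} (hf : f ∈ H1) :
    ∀ᵐ a ∂(ideleMeasure.restrict GA.ideleDomain), coeff n f 0 a = 0 := by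
  filter_upwards [integral_adeleDomain_eq_zero hf] with a ha
  rw [coeff, ← ha]
  refine integral_congr_ae (ae_of_all _ fun x => ?_)
  have : freq n 0 = 0 := by simp [freq]
  simp only [this, map_zero, zero_mul, AddChar.map_zero_eq_one, Circle.coe_one, map_one, mul_one]

theorem enorm_psi (x : Adele) : ‖(psi x : ℂ)‖ₑ = 1 := by
  rw [← ofReal_norm, Circle.norm_coe, ENNReal.ofReal_one]

/-- Unfolding: the substitution `a ↦ (k/N) a` turns each term into the integral of `|I(f)|` over
`(k/N)·ideleDomain`, and these sets are disjoint for distinct `k`. Not every rational is some `k/N`,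
whence an inequality. -/
theorem tsum_lintegral_coeff_le (f : AutL2) :
    ∑' k : {k : ℤ // k ≠ 0}, ∫⁻ a in GA.ideleDomain, ‖coeff n f k a‖ₑ ∂ideleMeasure ≤
      ∫⁻ a, ‖opI f a‖ₑ ∂ideleMeasure := by
  set T : {k : ℤ // k ≠ 0} → Set Idele := fun k =>
    (fun b => ratIdele (freqUnit n k)⁻¹ * b) ⁻¹' GA.ideleDomain with hT
  have hTm : ∀ k, MeasurableSet (T k) := fun k =>
    (measurable_const_mul (ratIdele (freqUnit n k)⁻¹)) measurableSet_ideleDomain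
  have hTd : Pairwise (Function.onFun Disjoint T) := by
    intro k l hkl
    refine Set.disjoint_left.2 fun b hk hl => hkl (freqUnit_injective (n := n) ?_)
    exact inv_injective ((GA.existsUnique_mem_ideleDomain b).unique hk hl)
  have h1 : ∀ k : {k : ℤ // k ≠ 0}, ∫⁻ a in GA.ideleDomain, ‖coeff n f k a‖ₑ ∂ideleMeasure =
      ∫⁻ a in T k, ‖opI f a‖ₑ ∂ideleMeasure := by
    intro k
    rw [← (measurePreserving_idele_mul (ratIdele (freqUnit n k))).setLIntegral_comp_preimage
      (hTm k) (measurable_opI f).enorm]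
    have h2 : (fun a => ratIdele (freqUnit n k) * a) ⁻¹' T k = GA.ideleDomain := by
      ext a
      simp only [hT, Set.mem_preimage, map_inv, inv_mul_cancel_left]
    rw [h2]
    exact lintegral_congr fun a => by rw [coeff_eq_opI]
  rw [tsum_congr h1, ← lintegral_iUnion hTm hTd]
  exact setLIntegral_le_lintegral _ _

section

variable {f : AutL2} (hf : f ∈ H1) (hfK : f ∈ fixedK n) (hI : Integrable (opI f) ideleMeasure)

include hf hI in
theorem lintegral_tsum_coeff_lt_top :
    ∫⁻ a in GA.ideleDomain, ∑' k : ℤ, ‖coeff n f k a‖ₑ ∂ideleMeasure < ∞ := by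
  have h1 : ∫⁻ a in GA.ideleDomain, ∑' k : ℤ, ‖coeff n f k a‖ₑ ∂ideleMeasure =
      ∫⁻ a in GA.ideleDomain, ∑' k : {k : ℤ // k ≠ 0}, ‖coeff n f k a‖ₑ ∂ideleMeasure := by
    refine lintegral_congr_ae ?_
    filter_upwards [coeff_zero_ae (n := n) hf] with a ha
    refine (tsum_subtype_eq_of_support_subset (s := {k : ℤ | k ≠ 0}) fun k hk => ?_).symm
    rintro rfl
    exact hk (by simp [ha])
  rw [h1, lintegral_tsum (f := fun (k : {k : ℤ // k ≠ 0}) a => ‖coeff n f k a‖ₑ)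
    fun k => (measurable_coeff f k).enorm.aemeasurable]
  exact (tsum_lintegral_coeff_le f).trans_lt hI.2

include hf hI in
theorem summable_coeff_ae :
    ∀ᵐ a ∂(ideleMeasure.restrict GA.ideleDomain), Summable fun k : ℤ => ‖coeff n f k a‖ := by
  filter_upwards [ae_lt_top (Measurable.tsum fun k : ℤ => (measurable_coeff f k).enorm)
    (lintegral_tsum_coeff_lt_top (n := n) hf hI).ne] with a ha
  have := ENNReal.summable_toReal ha.ne
  simpa only [toReal_enorm] using this

include hf hfK hI in
/-- The Fourier expansion of a `K`-fixed function with integrable `I(f)`. -/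
theorem fourier_expansion :
    ∀ᵐ z ∂domainMeasure,
      f (proj z) = ∑' k : ℤ, coeff n f k z.2 * psi (ratAdele (freq n k) * z.1) := by
  have hmeas : MeasurableSet {w : Idele × Adele |
      f (proj w.swap) = ∑' k : ℤ, coeff n f k w.1 * psi (ratAdele (freq n k) * w.2)} := by
    refine measurableSet_eq_fun ((measurable_comp_proj f).comp measurable_swap)
      (Measurable.tsum fun k => ?_)
    exact ((measurable_coeff f k).comp measurable_fst).mul
      ((measurable_psi_mul _).comp measurable_snd)
  have h : ∀ᵐ w ∂((ideleMeasure.restrict GA.ideleDomain).prod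
      (adeleMeasure.restrict GA.adeleDomain)),
      f (proj w.swap) = ∑' k : ℤ, coeff n f k w.1 * psi (ratAdele (freq n k) * w.2) := by
    rw [Measure.ae_prod_iff_ae_ae hmeas]
    have hsq := memLp_comp_proj f
    rw [memLp_two_iff_integrable_sq_norm (measurable_comp_proj f).aestronglyMeasurable,
      domainMeasure] at hsq
    filter_upwards [ae_levelSet_invariant hfK, summable_coeff_ae (n := n) hf hI,
      hsq.prod_left_ae] with a h1 h2 h3
    have hm : Measurable fun x => f (proj (x, a)) :=
      (measurable_comp_proj f).comp (measurable_id.prodMk measurable_const)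
    refine ae_restrict_of_ae (ae_eq_tsum_psi hm (fun β x => ?_) h1 ?_ h2)
    · exact congrArg f (toQuot_add_rat β x a)
    · exact (memLp_two_iff_integrable_sq_norm hm.aestronglyMeasurable).2 h3
  exact Measure.measurePreserving_swap.quasiMeasurePreserving.ae h

include hf hfK hI in
-- The Fourier series dominates `|f|` by the sum of the absolute values of its coefficients, and
-- `adeleDomain` has volume one. Integrability is what makes the pairings converge, since `θ` is
-- merely bounded, with modulus constant along the real coordinate.
theorem integrable_of_integrable_opI : Integrable f quotMeasure := by
  have h : Integrable (fun z => f (proj z)) domainMeasure := by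
    refine ⟨(measurable_comp_proj f).aestronglyMeasurable, ?_⟩
    have h1 : ∫⁻ z, ‖f (proj z)‖ₑ ∂domainMeasure ≤
        ∫⁻ z, ∑' k : ℤ, ‖coeff n f k z.2‖ₑ ∂domainMeasure := by
      refine lintegral_mono_ae ?_
      filter_upwards [fourier_expansion hf hfK hI] with z hz
      rw [hz]
      refine (enorm_tsum_le_tsum_enorm ..).trans (ENNReal.tsum_le_tsum fun k => ?_)
      rw [enorm_mul, enorm_psi, mul_one]
    refine h1.trans_lt ?_
    have h2 := lintegral_tsum_coeff_lt_top (n := n) hf hI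
    rw [domainMeasure, lintegral_prod_symm]
    · simpa using h2
    · exact (Measurable.tsum fun k : ℤ =>
        ((measurable_coeff f k).comp measurable_snd).enorm).aemeasurable
  exact (measurePreserving_proj.integrable_comp
    (Lp.stronglyMeasurable f).aestronglyMeasurable).1 h

end

/-! ### Characters of the unit groups and the vectors `v_{m, χ}` -/

/-- If `g ≠ 1`, some character `φ` has `φ g ≠ 1`; translating the sum by `φ` multiplies it by `φ g`,
so it vanishes. -/
theorem sum_monoidHom_apply {Q : Type} [CommGroup Q] [Finite Q] [Fintype (Q →* ℂˣ)]
    [DecidableEq Q] (g : Q) :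
    ∑ χ : Q →* ℂˣ, ((χ g : ℂˣ) : ℂ) = if g = 1 then (Nat.card Q : ℂ) else 0 := by
  have : NeZero (Monoid.exponent Q) := ⟨Monoid.exponent_ne_zero_of_finite⟩
  split_ifs with h
  · subst h
    simp only [map_one, Units.val_one, Finset.sum_const, Finset.card_univ, nsmul_eq_mul, mul_one]
    rw [← CommGroup.card_monoidHom_of_hasEnoughRootsOfUnity Q ℂ, Nat.card_eq_fintype_card]
  · obtain ⟨φ, hφ⟩ := CommGroup.exists_apply_ne_one_of_hasEnoughRootsOfUnity Q ℂ h
    have h1 : ((φ g : ℂˣ) : ℂ) * ∑ χ : Q →* ℂˣ, ((χ g : ℂˣ) : ℂ) =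
        ∑ χ : Q →* ℂˣ, ((χ g : ℂˣ) : ℂ) := by
      rw [Finset.mul_sum, ← Equiv.sum_comp (Equiv.mulLeft φ) fun χ : Q →* ℂˣ => ((χ g : ℂˣ) : ℂ)]
      rfl
    have h2 : ((φ g : ℂˣ) : ℂ) ≠ 1 := fun h' => hφ (Units.ext h')
    by_contra h3
    exact h2 (mul_right_cancel₀ h3 (h1.trans (one_mul _).symm))

theorem norm_monoidHom_apply {Q : Type} [Group Q] [Finite Q] (χ : Q →* ℂˣ) (g : Q) :
    ‖((χ g : ℂˣ) : ℂ)‖ = 1 := by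
  have : ((χ g : ℂˣ) : ℂ) ^ Nat.card Q = 1 := by
    rw [← Units.val_pow_eq_pow_val, ← map_pow, pow_card_eq_one', map_one, Units.val_one]
  exact Complex.norm_eq_one_of_pow_eq_one this Nat.card_pos.ne'

theorem conj_monoidHom_apply {Q : Type} [Group Q] [Finite Q] (χ : Q →* ℂˣ) (g : Q) :
    conj ((χ g : ℂˣ) : ℂ) = ((χ g⁻¹ : ℂˣ) : ℂ) := by
  rw [map_inv, Units.val_inv_eq_inv_val, Complex.inv_eq_conj (norm_monoidHom_apply χ g)]

section

variable (p : ℕ) [Fact p.Prime]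

theorem coe_unitPart (a : ℚ_[p]ˣ) : ((unitPart p a : ℤ_[p]) : ℚ_[p]) =
    (a : ℚ_[p]) * (p : ℚ_[p]) ^ (-(a : ℚ_[p]).valuation) := rfl

theorem unitPart_mul (a b : ℚ_[p]ˣ) : unitPart p (a * b) = unitPart p a * unitPart p b := by
  have hp : (p : ℚ_[p]) ≠ 0 := by exact_mod_cast (Fact.out : p.Prime).ne_zero
  refine Units.ext (Subtype.ext ?_)
  rw [Units.val_mul, PadicInt.coe_mul, coe_unitPart, coe_unitPart, coe_unitPart, Units.val_mul,
    Padic.valuation_mul a.ne_zero b.ne_zero, neg_add, zpow_add₀ hp]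
  ring

theorem coe_unitPart_of_norm_eq_one {a : ℚ_[p]ˣ} (ha : ‖(a : ℚ_[p])‖ = 1) :
    ((unitPart p a : ℤ_[p]) : ℚ_[p]) = a := by
  have hp : (1 : ℝ) < p := by exact_mod_cast (Fact.out : p.Prime).one_lt
  rw [Padic.norm_eq_zpow_neg_valuation a.ne_zero] at ha
  have : (a : ℚ_[p]).valuation = 0 := by
    have := (zpow_eq_one_iff_right₀ (by linarith) hp.ne').1 ha
    omega
  rw [coe_unitPart, this, neg_zero, zpow_zero, mul_one]

end

variable (n : Nat.Primes →₀ ℕ)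

/-- The group `∏_{p ∈ S} ℤ_pˣ / (1 + p^{n_p} ℤ_p)`. -/
abbrev ClassGp : Type := ∀ p : n.support, (ℤ_[((p : Nat.Primes) : ℕ)]ˣ ⧸
    congrUnits ((p : Nat.Primes) : ℕ) (n (p : Nat.Primes)))

variable {n} in
/-- The class of the unit part of a component of a finite idele. -/
def classMap (p : n.support) : FinIdele →* (ℤ_[((p : Nat.Primes) : ℕ)]ˣ ⧸
    congrUnits ((p : Nat.Primes) : ℕ) (n (p : Nat.Primes))) where
  toFun a := QuotientGroup.mk (unitPart _ (a p))
  map_one' := by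
    have h : unitPart ((p : Nat.Primes) : ℕ) 1 = 1 := by
      have := unitPart_mul ((p : Nat.Primes) : ℕ) 1 1
      rw [one_mul] at this
      exact (mul_eq_left.1 this.symm)
    exact congrArg QuotientGroup.mk h
  map_mul' a b := congrArg QuotientGroup.mk (unitPart_mul ((p : Nat.Primes) : ℕ) (a p) (b p))

/-- The congruence subgroup of `∏_p ℤ_pˣ` of level `N`. -/
def congrSet : Set FinIdele := {b | b ∈ (zHatUnits : Set FinIdele) ∧ ∀ p : n.support, classMap p b = 1}

variable {n}

theorem classMap_apply_eq_one_iff {b : FinIdele} (hb : b ∈ (zHatUnits : Set FinIdele))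
    (p : n.support) : classMap p b = 1 ↔
      ‖(b p : ℚ_[((p : Nat.Primes) : ℕ)]) - 1‖ ≤ (((p : Nat.Primes) : ℕ) : ℝ) ^
        (-(n (p : Nat.Primes) : ℤ)) := by
  change (QuotientGroup.mk (unitPart _ (b p)) : ℤ_[((p : Nat.Primes) : ℕ)]ˣ ⧸ _) = 1 ↔ _
  rw [QuotientGroup.eq_one_iff, mem_congrUnits, PadicInt.norm_def, PadicInt.coe_sub,
    coe_unitPart_of_norm_eq_one _ (mem_zHatUnits.1 hb p), PadicInt.coe_one]

theorem isOpen_zHatUnits : IsOpen (zHatUnits : Set FinIdele) :=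
  RestrictedProduct.isOpen_forall_mem
    (R := fun p : Nat.Primes => ℚ_[(p : ℕ)]ˣ)
    (A := fun p : Nat.Primes =>
      ((Submonoid.ofClass (PadicInt.subring (p : ℕ))).units : Set ℚ_[(p : ℕ)]ˣ))
    (fun p => Submonoid.isOpen_units (isOpen_subring p))

theorem continuous_idele_eval (p : Nat.Primes) :
    Continuous fun a : FinIdele => (a p : ℚ_[(p : ℕ)]) :=
  Units.continuous_val.comp (RestrictedProduct.continuous_eval p)

theorem isOpen_congrSet : IsOpen (congrSet n) := by
  have : congrSet n = (zHatUnits : Set FinIdele) ∩ ⋂ p : n.support,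
      (fun a : FinIdele => (a p : ℚ_[((p : Nat.Primes) : ℕ)])) ⁻¹'
        Metric.closedBall 1 ((((p : Nat.Primes) : ℕ) : ℝ) ^ (-(n (p : Nat.Primes) : ℤ))) := by
    ext b
    simp only [congrSet, Set.mem_inter_iff, Set.mem_iInter, Set.mem_preimage,
      mem_closedBall_iff_norm]
    refine and_congr_right fun hb => ?_
    exact forall_congr' fun p => classMap_apply_eq_one_iff hb p
  rw [this]
  refine isOpen_zHatUnits.inter (isOpen_iInter_of_finite fun p => ?_)
  refine (IsUltrametricDist.isOpen_closedBall _ (zpow_ne_zero _ ?_)).preimage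
    (continuous_idele_eval _)
  exact_mod_cast (p : Nat.Primes).2.ne_zero

theorem one_mem_congrSet : (1 : FinIdele) ∈ congrSet n :=
  ⟨mem_zHatUnits.2 fun _ => norm_one, fun _ => map_one _⟩

theorem classMap_mul_of_mem_congrSet (a : FinIdele) {b : FinIdele} (hb : b ∈ congrSet n)
    (p : n.support) : classMap p (a * b) = classMap p a := by
  have h := map_mul (classMap p) a b
  rw [hb.2 p] at h
  exact h.trans (mul_one (classMap p a))

theorem congrSet_mem_compactK {b : FinIdele} (hb : b ∈ congrSet n) :
    GA.mk 0 ((1, b) : Idele) ∈ compactK n := by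
  refine ⟨rfl, Or.inl rfl, fun p => ⟨?_, mem_zHatUnits.1 hb.1 p, ?_⟩⟩
  · change ‖(0 : ℚ_[(p : ℕ)])‖ ≤ _
    rw [norm_zero]; positivity
  · change ‖(b p : ℚ_[(p : ℕ)]) - 1‖ ≤ _
    by_cases hp : p ∈ n.support
    · exact (classMap_apply_eq_one_iff hb.1 ⟨p, hp⟩).1 (hb.2 ⟨p, hp⟩)
    · rw [Finsupp.notMem_support_iff.1 hp, Nat.cast_zero, neg_zero, zpow_zero]
      exact norm_sub_le_one (mem_zHatUnits.1 hb.1 p).le norm_one.le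

/-- At primes outside the support `N` is a unit, so both clauses prescribe the absolute value of
`m/N`. -/
theorem vec_condition_iff (m : ℕ+) (a : FinIdele) :
    ((∀ p ∈ n.support, ‖(a p : ℚ_[(p : ℕ)])‖ = ‖((m : ℕ) : ℚ_[(p : ℕ)]) / (levelN n : ℕ)‖) ∧
      (∀ p ∉ n.support, ‖(a p : ℚ_[(p : ℕ)])‖ = ‖((m : ℕ) : ℚ_[(p : ℕ)])‖)) ↔
    ∀ p : Nat.Primes, ‖(a p : ℚ_[(p : ℕ)])‖ = ‖(freq n m : ℚ_[(p : ℕ)])‖ := by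
  have h1 : ∀ p : Nat.Primes, (freq n m : ℚ_[(p : ℕ)]) = ((m : ℕ) : ℚ_[(p : ℕ)]) / (levelN n : ℕ) :=
    fun p => by rw [freq]; push_cast; rfl
  have h2 : ∀ p ∉ n.support, ‖((m : ℕ) : ℚ_[(p : ℕ)]) / (levelN n : ℕ)‖ =
      ‖((m : ℕ) : ℚ_[(p : ℕ)])‖ := fun p hp => by
    rw [norm_div, norm_levelN, Finsupp.notMem_support_iff.1 hp]
    simp
  simp only [h1]
  refine ⟨fun h p => ?_, fun h => ⟨fun p _ => h p, fun p hp => by rw [h p, h2 p hp]⟩⟩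
  by_cases hp : p ∈ n.support
  · exact h.1 p hp
  · rw [h.2 p hp, h2 p hp]

theorem vec_of_norm {m : ℕ+} {a : FinIdele}
    (h : ∀ p : Nat.Primes, ‖(a p : ℚ_[(p : ℕ)])‖ = ‖(freq n m : ℚ_[(p : ℕ)])‖) (χ : CharM n) :
    vec n m χ a = ∏ p : n.support, ((χ p (classMap p a) : ℂˣ) : ℂ) :=
  if_pos ((vec_condition_iff m a).2 h)

theorem vec_of_not_norm {m : ℕ+} {a : FinIdele}
    (h : ¬ ∀ p : Nat.Primes, ‖(a p : ℚ_[(p : ℕ)])‖ = ‖(freq n m : ℚ_[(p : ℕ)])‖) (χ : CharM n) :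
    vec n m χ a = 0 :=
  if_neg fun h' => h ((vec_condition_iff m a).1 h')

theorem norm_vec_le (m : ℕ+) (χ : CharM n) (a : FinIdele) : ‖vec n m χ a‖ ≤ 1 := by
  by_cases h : ∀ p : Nat.Primes, ‖(a p : ℚ_[(p : ℕ)])‖ = ‖(freq n m : ℚ_[(p : ℕ)])‖
  · rw [vec_of_norm h, norm_prod, Finset.prod_congr rfl fun p _ => norm_monoidHom_apply _ _,
      Finset.prod_const_one]
  · rw [vec_of_not_norm h, norm_zero]
    exact zero_le_one

theorem norm_mul_of_mem_zHatUnits (a : FinIdele) {b : FinIdele}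
    (hb : b ∈ (zHatUnits : Set FinIdele)) (p : Nat.Primes) :
    ‖((a * b) p : ℚ_[(p : ℕ)])‖ = ‖(a p : ℚ_[(p : ℕ)])‖ := by
  change ‖(a p : ℚ_[(p : ℕ)]) * (b p : ℚ_[(p : ℕ)])‖ = _
  rw [norm_mul, mem_zHatUnits.1 hb p, mul_one]

theorem vec_mul_of_mem_congrSet (m : ℕ+) (χ : CharM n) (a : FinIdele) {b : FinIdele}
    (hb : b ∈ congrSet n) : vec n m χ (a * b) = vec n m χ a := by
  by_cases h : ∀ p : Nat.Primes, ‖(a p : ℚ_[(p : ℕ)])‖ = ‖(freq n m : ℚ_[(p : ℕ)])‖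
  · rw [vec_of_norm h, vec_of_norm fun p => by rw [norm_mul_of_mem_zHatUnits a hb.1, h p]]
    exact Finset.prod_congr rfl fun p _ => by rw [classMap_mul_of_mem_congrSet a hb]
  · rw [vec_of_not_norm h, vec_of_not_norm fun h' => h fun p => by
      rw [← norm_mul_of_mem_zHatUnits a hb.1, h' p]]

theorem continuous_vec (m : ℕ+) (χ : CharM n) : Continuous (vec n m χ) := by
  refine IsLocallyConstant.continuous ((IsLocallyConstant.iff_eventually_eq _).2 fun a => ?_)
  have h : (fun b => a⁻¹ * b) ⁻¹' congrSet n ∈ 𝓝 a :=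
    (isOpen_congrSet.preimage (continuous_const_mul a⁻¹)).mem_nhds (by
      rw [Set.mem_preimage, inv_mul_cancel]; exact one_mem_congrSet)
  filter_upwards [h] with b hb
  rw [← vec_mul_of_mem_congrSet m χ a hb, mul_inv_cancel_left]

/-- A sum over tuples of local characters factors into local sums, and orthogonality at each prime
forces the class of `a⁻¹ b` to be trivial. -/
theorem sum_vec_mul_conj_vec {m : ℕ+} {a b : FinIdele}
    (ha : ∀ p : Nat.Primes, ‖(a p : ℚ_[(p : ℕ)])‖ = ‖(freq n m : ℚ_[(p : ℕ)])‖)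
    (hb : ∀ p : Nat.Primes, ‖(b p : ℚ_[(p : ℕ)])‖ = ‖(freq n m : ℚ_[(p : ℕ)])‖) :
    ∑ χ : CharM n, vec n m χ a * conj (vec n m χ b) =
      (Nat.card (ClassGp n) : ℂ) * (congrSet n).indicator 1 (a⁻¹ * b) := by
  classical
  have hz : a⁻¹ * b ∈ (zHatUnits : Set FinIdele) := mem_zHatUnits.2 fun p => by
    change ‖(((a p)⁻¹ : ℚ_[(p : ℕ)]ˣ) : ℚ_[(p : ℕ)]) * (b p : ℚ_[(p : ℕ)])‖ = 1
    rw [norm_mul, Units.val_inv_eq_inv_val, norm_inv, hb p, ← ha p]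
    exact inv_mul_cancel₀ (norm_ne_zero_iff.2 (a p).ne_zero)
  let inst : ∀ p : n.support, Fintype ((ℤ_[((p : Nat.Primes) : ℕ)]ˣ ⧸
      congrUnits ((p : Nat.Primes) : ℕ) (n (p : Nat.Primes))) →* ℂˣ) := fun p => Fintype.ofFinite _
  have h1 : ∀ χ : CharM n, vec n m χ a * conj (vec n m χ b) =
      ∏ p : n.support, ((χ p ((classMap p (a⁻¹ * b))⁻¹) : ℂˣ) : ℂ) := by
    intro χ
    rw [vec_of_norm ha, vec_of_norm hb, map_prod, ← Finset.prod_mul_distrib]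
    refine Finset.prod_congr rfl fun p _ => ?_
    rw [conj_monoidHom_apply, ← Units.val_mul, ← map_mul, ← map_inv (classMap p),
      ← map_inv (classMap p), ← map_mul (classMap p), mul_inv, inv_inv]
  simp_rw [h1]
  have h2 := Finset.prod_univ_sum (fun p : n.support => (Finset.univ : Finset
    ((ℤ_[((p : Nat.Primes) : ℕ)]ˣ ⧸ congrUnits ((p : Nat.Primes) : ℕ) (n (p : Nat.Primes))) →* ℂˣ)))
    (fun p χ => ((χ ((classMap p (a⁻¹ * b))⁻¹) : ℂˣ) : ℂ))
  rw [Fintype.piFinset_univ] at h2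
  have h3 : ∑ χ : CharM n, ∏ p : n.support, ((χ p ((classMap p (a⁻¹ * b))⁻¹) : ℂˣ) : ℂ) =
      ∏ p : n.support, ∑ χ : (ℤ_[((p : Nat.Primes) : ℕ)]ˣ ⧸
        congrUnits ((p : Nat.Primes) : ℕ) (n (p : Nat.Primes))) →* ℂˣ,
        ((χ ((classMap p (a⁻¹ * b))⁻¹) : ℂˣ) : ℂ) := by
    rw [h2]
    exact Finset.sum_congr (Finset.ext fun χ => iff_of_true
      (@Finset.mem_univ _ (_) _) (@Finset.mem_univ _ (_) _)) fun _ _ => rfl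
  rw [h3, Finset.prod_congr rfl fun p _ => sum_monoidHom_apply (classMap p (a⁻¹ * b))⁻¹]
  simp_rw [inv_eq_one]
  rw [Finset.prod_ite_zero, Nat.card_pi]
  by_cases h : ∀ p : n.support, classMap p (a⁻¹ * b) = 1
  · rw [if_pos fun p _ => h p, Set.indicator_of_mem (show a⁻¹ * b ∈ congrSet n from ⟨hz, h⟩)]
    simp
  · rw [if_neg fun h' => h fun p => h' p (Finset.mem_univ p),
      Set.indicator_of_notMem fun h' => h h'.2, mul_zero]

theorem classMap_surjective_on_units (q : ClassGp n) :
    ∃ u ∈ (zHatUnits : Set FinIdele), ∀ p, classMap p u = q p := by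
  classical
  choose w hw using fun p : n.support => QuotientGroup.mk_surjective (q p)
  let v : ∀ p : Nat.Primes, ℚ_[(p : ℕ)]ˣ := fun p =>
    if h : p ∈ n.support then Units.map (PadicInt.Coe.ringHom (p := (p : ℕ))).toMonoidHom (w ⟨p, h⟩)
    else 1
  have hv : ∀ p : Nat.Primes, ‖(v p : ℚ_[(p : ℕ)])‖ = 1 := by
    intro p
    by_cases h : p ∈ n.support
    · simp only [v, dif_pos h]
      exact PadicInt.norm_units (w ⟨p, h⟩)
    · rw [show v p = 1 from dif_neg h, Units.val_one, norm_one]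
  refine ⟨RestrictedProduct.mk v (Eventually.of_forall fun p => (mem_units_iff p _).2 (hv p)),
    mem_zHatUnits.2 hv, fun p => ?_⟩
  rw [← hw p]
  refine congrArg QuotientGroup.mk (Units.ext (Subtype.ext ?_))
  refine (coe_unitPart_of_norm_eq_one _ (hv p)).trans ?_
  simp only [v, dif_pos p.2]
  rfl

/-! ### Fourier inversion for integrable functions on the real line -/

section Inversion

open scoped FourierTransform ContDiff

theorem continuous_fourier {G : ℝ → ℂ} (hG : Integrable G) : Continuous (𝓕 G) :=
  VectorFourier.fourierIntegral_continuous Real.continuous_fourierChar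
    (L := innerₗ ℝ) continuous_inner hG

theorem integral_fourier_mul_eq {φ G : ℝ → ℂ} (hφ : Integrable φ) (hG : Integrable G) :
    ∫ x, 𝓕 φ x * G x = ∫ x, φ x * 𝓕 G x := by
  have h := VectorFourier.integral_fourierIntegral_smul_eq_flip (L := innerₗ ℝ)
    Real.continuous_fourierChar continuous_inner hφ hG
  rw [flip_innerₗ] at h
  exact h

/-- `G` need not be continuous, so inversion holds only almost everywhere. It is tested against
smooth compactly supported functions: the multiplication formula moves both transforms onto the test
function, where Schwartz inversion applies. -/
theorem ae_fourierInv_fourier_eq {G : ℝ → ℂ} (hG : Integrable G) (hG' : Integrable (𝓕 G)) :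
    ∀ᵐ s, 𝓕⁻ (𝓕 G) s = G s := by
  have hc : Continuous (𝓕⁻ (𝓕 G)) := by
    have h : 𝓕⁻ (𝓕 G) = fun s => 𝓕 (𝓕 G) (-s) := funext fun s => Real.fourierInv_eq_fourier_neg _ _
    rw [h]
    exact (continuous_fourier hG').comp continuous_neg
  refine ae_eq_of_integral_contDiff_smul_eq hc.locallyIntegrable hG.locallyIntegrable
    fun g hg hgc => ?_
  have h1 : HasCompactSupport fun x => (g x : ℂ) := hgc.comp_left (g := ((↑) : ℝ → ℂ)) rfl
  set φ := h1.toSchwartzMap (Complex.ofRealCLM.contDiff.comp hg) with hφ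
  have hφg : ∀ x, φ x = g x := fun x => rfl
  have e1 : ∀ x, 𝓕 (𝓕⁻ (φ : ℝ → ℂ)) x = φ x := fun x => by
    rw [← SchwartzMap.fourierInv_coe, ← SchwartzMap.fourier_coe,
      FourierTransform.fourier_fourierInv_eq]
  have e2 : Integrable (𝓕⁻ (φ : ℝ → ℂ)) := by
    rw [← SchwartzMap.fourierInv_coe]; exact SchwartzMap.integrable _
  have e3 : ∫ x, φ x * 𝓕⁻ (𝓕 G) x = ∫ x, 𝓕⁻ (φ : ℝ → ℂ) x * 𝓕 G x := by
    -- The multiplication formula is used for `x ↦ φ(-x)`, whose transform is `𝓕⁻ φ`.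
    have h2 := integral_fourier_mul_eq (φ.integrable (μ := volume)).comp_neg hG'
    rw [← Real.fourierInv_eq_fourier_comp_neg] at h2
    rw [h2, ← integral_neg_eq_self]
    exact integral_congr_ae (ae_of_all _ fun x => by
      simp only [Real.fourierInv_eq_fourier_neg, neg_neg])
  calc ∫ x, g x • 𝓕⁻ (𝓕 G) x = ∫ x, φ x * 𝓕⁻ (𝓕 G) x := rfl
    _ = ∫ x, 𝓕⁻ (φ : ℝ → ℂ) x * 𝓕 G x := e3
    _ = ∫ x, 𝓕 (𝓕⁻ (φ : ℝ → ℂ)) x * G x := (integral_fourier_mul_eq e2 hG).symm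
    _ = ∫ x, g x • G x := integral_congr_ae (ae_of_all _ fun x => by
        simp only [e1 x]; rfl)

/-- The Fourier transform on the real line, without the factor `2π` in the exponent. -/
def fourierExp (G : ℝ → ℂ) (t : ℝ) : ℂ := ∫ s, G s * Complex.exp (-(t * s * Complex.I))

theorem fourier_eq_fourierExp (G : ℝ → ℂ) (ξ : ℝ) : 𝓕 G ξ = fourierExp G (2 * Real.pi * ξ) := by
  rw [Real.fourier_real_eq_integral_exp_smul, fourierExp]
  refine integral_congr_ae (ae_of_all _ fun s => ?_)
  simp only [smul_eq_mul]
  rw [mul_comm]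
  congr 2
  push_cast
  ring

theorem ae_integral_fourierExp {G : ℝ → ℂ} (hG : Integrable G) (hG' : Integrable (fourierExp G)) :
    ∀ᵐ s : ℝ, ∫ t : ℝ, fourierExp G t * Complex.exp (t * s * Complex.I) = 2 * Real.pi * G s := by
  have hpi : (2 * Real.pi : ℝ) ≠ 0 := by positivity
  have h1 : Integrable (𝓕 G) := by
    have : 𝓕 G = fun ξ => fourierExp G (2 * Real.pi * ξ) := funext fun ξ => fourier_eq_fourierExp G ξ
    rw [this]
    exact hG'.comp_mul_left' hpi
  filter_upwards [ae_fourierInv_fourier_eq hG h1] with s hs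
  rw [← hs, Real.fourierInv_eq']
  have h2 := Measure.integral_comp_mul_left
    (fun t : ℝ => fourierExp G t * Complex.exp (t * s * Complex.I)) (2 * Real.pi)
  have h3 : ∫ ξ : ℝ, Complex.exp (((2 * Real.pi * inner ℝ ξ s : ℝ) : ℂ) * Complex.I) • 𝓕 G ξ =
      ∫ ξ : ℝ, fourierExp G (2 * Real.pi * ξ) *
        Complex.exp (((2 * Real.pi * ξ : ℝ) : ℂ) * s * Complex.I) := by
    refine integral_congr_ae (ae_of_all _ fun ξ => ?_)
    simp only [smul_eq_mul, fourier_eq_fourierExp]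
    rw [mul_comm]
    congr 2
    simp only [RCLike.inner_apply, conj_trivial]
    push_cast
    ring
  rw [h3, h2, abs_of_pos (by positivity), Complex.real_smul, ← mul_assoc]
  push_cast
  rw [mul_inv_cancel₀ (by exact_mod_cast hpi), one_mul]

end Inversion

/-! ### Orthogonality relations on the unit ideles -/

section Orthogonality

variable {n : Nat.Primes →₀ ℕ}

/-- The unit ideles have mass one and are partitioned by the cosets of `congrSet n`, one for each
element of `ClassGp n`, all of equal mass. -/
theorem unitMeasure_congrSet : (Nat.card (ClassGp n) : ℂ) * (unitMeasure.real (congrSet n) : ℂ) = 1 := by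
  classical
  have hfin : Finite (ClassGp n) := Pi.finite
  have : Fintype (ClassGp n) := Fintype.ofFinite _
  have hm : MeasurableSet (congrSet n) := isOpen_congrSet.measurableSet
  choose u hu hu' using classMap_surjective_on_units (n := n)
  set T : ClassGp n → Set FinIdele := fun q => (fun a => (u q)⁻¹ * a) ⁻¹' congrSet n with hT
  have hui : ∀ q, (u q)⁻¹ ∈ (zHatUnits : Set FinIdele) := fun q => mem_zHatUnits.2 fun p => by
    change ‖(((u q p)⁻¹ : ℚ_[(p : ℕ)]ˣ) : ℚ_[(p : ℕ)])‖ = 1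
    rw [Units.val_inv_eq_inv_val, norm_inv, mem_zHatUnits.1 (hu q) p, inv_one]
  have hmT : ∀ q, MeasurableSet (T q) := fun q => (measurable_const_mul _) hm
  have hμT : ∀ q, unitMeasure (T q) = unitMeasure (congrSet n) := fun q =>
    (measurePreserving_unitMeasure (hui q)).measure_preimage hm.nullMeasurableSet
  have hcls : ∀ q a, a ∈ T q → ∀ p, classMap p a = q p := by
    intro q a ha p
    have h := classMap_mul_of_mem_congrSet (u q) ha p
    rw [mul_inv_cancel_left] at h
    exact h.trans (hu' q p)
  have hd : Pairwise (Function.onFun Disjoint T) := fun q r hqr =>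
    Set.disjoint_left.2 fun a hq hr => hqr (funext fun p => (hcls q a hq p).symm.trans (hcls r a hr p))
  have hun : (zHatUnits : Set FinIdele) = ⋃ q, T q := by
    ext a
    rw [Set.mem_iUnion]
    constructor
    · intro ha
      refine ⟨fun p => classMap p a, ?_, fun p => ?_⟩
      · refine mem_zHatUnits.2 fun p => ?_
        exact (norm_mul_of_mem_zHatUnits _ ha p).trans (mem_zHatUnits.1 (hui _) p)
      · have h1 := map_mul (classMap p) (u fun p => classMap p a)⁻¹ a
        have h2 := map_inv (classMap p) (u fun p => classMap p a)
        rw [h2, hu'] at h1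
        exact h1.trans (inv_mul_cancel (classMap p a))
    · rintro ⟨q, hq⟩
      have h := hq.1
      refine mem_zHatUnits.2 fun p => ?_
      have h3 := norm_mul_of_mem_zHatUnits (u q) h p
      rw [mul_inv_cancel_left] at h3
      exact h3.trans (mem_zHatUnits.1 (hu q) p)
  have h1 : unitMeasure (zHatUnits : Set FinIdele) = 1 := by
    have h2 : unitMeasure (zHatUnits : Set FinIdele)ᶜ = 0 := by
      rw [unitMeasure, Measure.restrict_apply measurableSet_zHatUnits.compl, Set.compl_inter_self,
        measure_empty]
    exact (prob_compl_eq_zero_iff measurableSet_zHatUnits).1 h2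
  rw [hun, measure_iUnion hd hmT, tsum_congr hμT, tsum_fintype, Finset.sum_const, Finset.card_univ,
    nsmul_eq_mul, ← Nat.card_eq_fintype_card] at h1
  have h2 := congrArg ENNReal.toReal h1
  rw [ENNReal.toReal_mul, ENNReal.toReal_natCast, ENNReal.toReal_one] at h2
  exact_mod_cast h2

theorem ae_mem_zHatUnits : ∀ᵐ u ∂unitMeasure, u ∈ (zHatUnits : Set FinIdele) :=
  ae_restrict_mem measurableSet_zHatUnits

theorem norm_mul_of_mem_zHatUnits_eq {m : ℕ+} {α u : FinIdele}
    (hα : ∀ p : Nat.Primes, ‖(α p : ℚ_[(p : ℕ)])‖ = ‖(freq n m : ℚ_[(p : ℕ)])‖)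
    (hu : u ∈ (zHatUnits : Set FinIdele)) (p : Nat.Primes) :
    ‖((α * u) p : ℚ_[(p : ℕ)])‖ = ‖(freq n m : ℚ_[(p : ℕ)])‖ :=
  (norm_mul_of_mem_zHatUnits α hu p).trans (hα p)

theorem integrable_mul_conj_vec {F : FinIdele → ℂ} (hF : Integrable F unitMeasure) (m : ℕ+)
    (χ : CharM n) (α : FinIdele) :
    Integrable (fun u => F u * conj (vec n m χ (α * u))) unitMeasure := by
  refine hF.mul_bdd (c := 1) ?_ (ae_of_all _ fun u => ?_)
  · exact (Complex.continuous_conj.comp ((continuous_vec m χ).comp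
      (continuous_const_mul α))).measurable.aestronglyMeasurable
  · rw [RCLike.norm_conj]
    exact norm_vec_le m χ _

/-- By orthogonality the sum averages `F` over the coset `u·congrSet n`, on which `F` is almost
everywhere `F u`. The factor `α` supplies the absolute values of `m/N`, without which `vec`
vanishes. -/
theorem sum_vec_mul_integral {F : FinIdele → ℂ} (hF : Integrable F unitMeasure) {m : ℕ+}
    {α u : FinIdele} (hα : ∀ p : Nat.Primes, ‖(α p : ℚ_[(p : ℕ)])‖ = ‖(freq n m : ℚ_[(p : ℕ)])‖)
    (hu : u ∈ (zHatUnits : Set FinIdele))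
    (hFu : ∀ᵐ b ∂unitMeasure, b ∈ congrSet n → F (u * b) = F u) :
    ∑ χ : CharM n, vec n m χ (α * u) * ∫ w, F w * conj (vec n m χ (α * w)) ∂unitMeasure = F u := by
  have hm : MeasurableSet (congrSet n) := isOpen_congrSet.measurableSet
  have h1 : ∑ χ : CharM n, vec n m χ (α * u) * ∫ w, F w * conj (vec n m χ (α * w)) ∂unitMeasure =
      ∫ w, ∑ χ : CharM n, vec n m χ (α * u) * (F w * conj (vec n m χ (α * w))) ∂unitMeasure := by
    rw [integral_finsetSum _ fun χ _ => (integrable_mul_conj_vec hF m χ α).const_mul _]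
    exact Finset.sum_congr rfl fun χ _ => (integral_const_mul _ _).symm
  have h2 : ∫ w, ∑ χ : CharM n, vec n m χ (α * u) * (F w * conj (vec n m χ (α * w))) ∂unitMeasure =
      ∫ w, F w * ((Nat.card (ClassGp n) : ℂ) * (congrSet n).indicator 1 (u⁻¹ * w)) ∂unitMeasure := by
    refine integral_congr_ae ?_
    filter_upwards [ae_mem_zHatUnits] with w hw
    have h3 := sum_vec_mul_conj_vec (norm_mul_of_mem_zHatUnits_eq hα hu)
      (norm_mul_of_mem_zHatUnits_eq hα hw)
    rw [mul_inv, mul_assoc, mul_left_comm u⁻¹ α, inv_mul_cancel_left] at h3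
    rw [← h3, Finset.mul_sum]
    exact Finset.sum_congr rfl fun χ _ => by ring
  have hme : MeasurableEmbedding fun b : FinIdele => u * b :=
    (MeasurableEquiv.mulLeft u).measurableEmbedding
  rw [h1, h2, ← (measurePreserving_unitMeasure hu).integral_comp hme]
  have h3 : ∀ᵐ b ∂unitMeasure, F (u * b) * ((Nat.card (ClassGp n) : ℂ) *
      (congrSet n).indicator 1 (u⁻¹ * (u * b))) =
      (congrSet n).indicator (fun _ => F u * (Nat.card (ClassGp n) : ℂ)) b := by
    filter_upwards [hFu] with b hb
    rw [inv_mul_cancel_left]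
    by_cases h : b ∈ congrSet n
    · rw [Set.indicator_of_mem h, Set.indicator_of_mem h, hb h, Pi.one_apply, mul_one]
    · rw [Set.indicator_of_notMem h, Set.indicator_of_notMem h, mul_zero, mul_zero]
  rw [integral_congr_ae h3, integral_indicator_const _ hm, Complex.real_smul]
  linear_combination F u * unitMeasure_congrSet (n := n)

end Orthogonality

/-! ### Fourier coefficients in logarithmic coordinates -/

section LogCoordinates

/-- The inverse of `logCoord` on `ℝ_{>0} × ∏_p ℤ_pˣ`. -/
def ideleLog (a : Idele) : ℝ × FinIdele := (Real.log a.1, a.2)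

theorem measurable_ideleLog : Measurable ideleLog :=
  (Real.measurable_log.comp (Units.continuous_val.measurable.comp measurable_fst)).prodMk
    measurable_snd

theorem ideleLog_logCoord (w : ℝ × FinIdele) : ideleLog (logCoord w) = w :=
  Prod.ext (Real.log_exp w.1) rfl

theorem logCoord_ideleLog {a : Idele} (ha : a ∈ GA.ideleDomain) : logCoord (ideleLog a) = a :=
  Prod.ext (Units.ext (Real.exp_log ha.1)) rfl

theorem measurePreserving_ideleLog : MeasurePreserving ideleLog
    (ideleMeasure.restrict GA.ideleDomain) ((volume : Measure ℝ).prod unitMeasure) := by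
  refine ⟨measurable_ideleLog, ?_⟩
  rw [← measurePreserving_logCoord.map_eq,
    Measure.map_map measurable_ideleLog measurePreserving_logCoord.measurable]
  have : ideleLog ∘ logCoord = id := funext ideleLog_logCoord
  rw [this, Measure.map_id]

end LogCoordinates

/-! ### Invariance of the Fourier coefficients under the multiplicative part of `K`. -/

section Invariance

variable {n : Nat.Primes →₀ ℕ} {f : AutL2}

theorem coeff_mul_ae (hf : f ∈ fixedK n) {b : Idele} (hb : GA.mk 0 b ∈ compactK n) (k : ℤ) :
    ∀ᵐ a ∂ideleMeasure, coeff n f k (a * b) = coeff n f k a := by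
  have h : ∀ᵐ z ∂(ideleMeasure.prod adeleMeasure),
      f (proj (z.2, z.1 * b)) = f (proj (z.2, z.1)) := by
    have h0 : ∀ᵐ g ∂GA.haar, f (toQuot (GA.mk g.x (g.a * b))) = f (toQuot g) := by
      filter_upwards [hf _ hb] with g hg
      have h1 : g * GA.mk 0 b = GA.mk g.x (g.a * b) := by
        refine GA.ext ?_ rfl
        rw [GA.mul_x, GA.mk_x, mul_zero, add_zero, GA.mk_x]
      rwa [h1] at hg
    exact Measure.measurePreserving_swap.quasiMeasurePreserving.ae
      (p := fun z : Adele × Idele => f (proj (z.1, z.2 * b)) = f (proj (z.1, z.2))) h0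
  filter_upwards [Measure.ae_ae_of_ae_prod h] with a ha
  refine integral_congr_ae (ae_restrict_of_ae ?_)
  filter_upwards [ha] with x hx
  rw [hx]

/-- The Fourier coefficient in logarithmic coordinates. -/
def logCoeff (n : Nat.Primes →₀ ℕ) (f : AutQuot → ℂ) (k : ℤ) (w : ℝ × FinIdele) : ℂ :=
  coeff n f k (logCoord w)

theorem measurable_logCoeff (f : AutL2) (k : ℤ) : Measurable (logCoeff n f k) :=
  (measurable_coeff f k).comp measurePreserving_logCoord.measurable

theorem ae_logCoord {P : Idele → Prop} (h : ∀ᵐ a ∂ideleMeasure, P a) :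
    ∀ᵐ w ∂((volume : Measure ℝ).prod unitMeasure), P (logCoord w) :=
  measurePreserving_logCoord.quasiMeasurePreserving.ae (ae_restrict_of_ae h)

/-- Invariance under each fixed `b` is known for almost every `w`; the measurable exchange of
quantifiers gives the form needed to average over `b` at a fixed `w`. -/
theorem logCoeff_mul_congrSet_ae (hf : f ∈ fixedK n) (k : ℤ) :
    ∀ᵐ w ∂((volume : Measure ℝ).prod unitMeasure), ∀ᵐ b ∂unitMeasure, b ∈ congrSet n →
      logCoeff n f k (w.1, w.2 * b) = logCoeff n f k w := by
  have hm : MeasurableSet {z : (ℝ × FinIdele) × FinIdele | z.2 ∈ congrSet n →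
      logCoeff n f k (z.1.1, z.1.2 * z.2) = logCoeff n f k z.1} := by
    have h1 : MeasurableSet {z : (ℝ × FinIdele) × FinIdele |
      logCoeff n f k (z.1.1, z.1.2 * z.2) = logCoeff n f k z.1} := by
      refine measurableSet_eq_fun ((measurable_logCoeff f k).comp ?_)
        ((measurable_logCoeff f k).comp measurable_fst)
      exact (measurable_fst.comp measurable_fst).prodMk
        ((measurable_snd.comp measurable_fst).mul measurable_snd)
    exact (measurable_snd isOpen_congrSet.measurableSet).imp h1
  refine (Measure.ae_ae_comm hm).2 (ae_of_all _ fun b => ?_)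
  by_cases hb : b ∈ congrSet n
  · filter_upwards [ae_logCoord (coeff_mul_ae hf (congrSet_mem_compactK hb) k)] with w hw _
    refine Eq.trans (congrArg (coeff n f k) ?_) hw
    exact Prod.ext (mul_one _).symm rfl
  · exact ae_of_all _ fun w h => absurd h hb

/-- The diagonal element `-1` of the finite ideles. -/
def negFin : FinIdele := (ratIdele (-1)).2

theorem negFin_mem : negFin ∈ (zHatUnits : Set FinIdele) := mem_zHatUnits.2 fun p => by
  change ‖((((-1 : ℚˣ) : ℚ)) : ℚ_[(p : ℕ)])‖ = 1
  simp

theorem neg_mem_compactK : GA.mk 0 ((-1, 1) : Idele) ∈ compactK n := by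
  refine ⟨rfl, Or.inr rfl, fun p => ⟨?_, norm_one, ?_⟩⟩
  · change ‖(0 : ℚ_[(p : ℕ)])‖ ≤ _
    rw [norm_zero]; positivity
  · change ‖(1 : ℚ_[(p : ℕ)]) - 1‖ ≤ _
    rw [sub_self, norm_zero]; positivity

theorem coeff_neg (f : AutQuot → ℂ) {k : ℤ} (hk : k ≠ 0) (a : Idele) :
    coeff n f (-k) a = coeff n f k (ratIdele (-1) * a) := by
  rw [coeff_eq_opI f ⟨-k, neg_ne_zero.2 hk⟩, coeff_eq_opI f ⟨k, hk⟩, ← mul_assoc, ← map_mul]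
  congr 3
  refine Units.ext ?_
  change freq n (-k) = freq n k * (-1 : ℚ)
  rw [freq, freq]
  push_cast
  ring

/-- The rational number `-1` reverses the frequency and acts at all places at once. Invariance under
`K_∞` undoes its action on the real component, leaving only the sign on the finite part. -/
theorem logCoeff_neg_ae (hf : f ∈ fixedK n) {k : ℤ} (hk : k ≠ 0) :
    ∀ᵐ s : ℝ, ∀ᵐ u ∂unitMeasure, logCoeff n f (-k) (s, u) = logCoeff n f k (s, negFin * u) := by
  refine Measure.ae_ae_of_ae_prod
    (p := fun w => logCoeff n f (-k) w = logCoeff n f k (w.1, negFin * w.2)) ?_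
  have h := (MeasurePreserving.id (volume : Measure ℝ)).prod
    (measurePreserving_unitMeasure negFin_mem)
  filter_upwards [h.quasiMeasurePreserving.ae
    (ae_logCoord (coeff_mul_ae hf neg_mem_compactK k))] with w hw
  rw [logCoeff, coeff_neg f hk]
  refine Eq.trans (congrArg (coeff n f k) ?_) hw
  refine Prod.ext (Units.ext ?_) (mul_one _).symm
  change (((-1 : ℚˣ) : ℚ) : ℝ) * Real.exp w.1 = Real.exp w.1 * -1
  push_cast
  ring

end Invariance

/-! ### The functions `θ_{m, χ, t}` on the fundamental domain -/

section Theta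

variable (n : Nat.Primes →₀ ℕ)

/-- The rational number `m / N` as a unit. -/
def posFreq (m : ℕ+) : ℚˣ := freqUnit n ⟨(m : ℕ), by exact_mod_cast m.ne_zero⟩

/-- The finite idele `m / N`. -/
def finFreq (m : ℕ+) : FinIdele := (ratIdele (posFreq n m)).2

variable {n}

theorem coe_posFreq (m : ℕ+) : (posFreq n m : ℚ) = freq n (m : ℕ) := rfl

theorem posFreq_pos (m : ℕ+) : (0 : ℚ) < posFreq n m :=
  div_pos (Int.cast_pos.2 (Int.natCast_pos.2 m.pos)) (by exact_mod_cast Nat.pos_of_ne_zero levelN_ne_zero)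

theorem norm_finFreq (m : ℕ+) (p : Nat.Primes) :
    ‖(finFreq n m p : ℚ_[(p : ℕ)])‖ = ‖(freq n m : ℚ_[(p : ℕ)])‖ := rfl

theorem norm_negFin_mul_finFreq (m : ℕ+) (p : Nat.Primes) :
    ‖((finFreq n m * negFin) p : ℚ_[(p : ℕ)])‖ = ‖(freq n m : ℚ_[(p : ℕ)])‖ :=
  norm_mul_of_mem_zHatUnits _ negFin_mem p

/-- The quotient and its inverse are integral at every prime, hence integers with product one. -/
theorem eq_or_eq_neg_of_norm_eq {α β : ℚˣ}
    (h : ∀ p : Nat.Primes, ‖((α : ℚ) : ℚ_[(p : ℕ)])‖ = ‖((β : ℚ) : ℚ_[(p : ℕ)])‖) :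
    α = β ∨ α = -β := by
  have h1 : ∀ (α β : ℚˣ) (p : Nat.Primes), ‖((α : ℚ) : ℚ_[(p : ℕ)])‖ = ‖((β : ℚ) : ℚ_[(p : ℕ)])‖ →
      ‖(((α : ℚ) / β : ℚ) : ℚ_[(p : ℕ)])‖ ≤ 1 := by
    intro α β p h
    rw [Rat.cast_div, norm_div, h]
    exact div_self_le_one _
  obtain ⟨j, hj⟩ := isInt_of_norm_le fun p => h1 α β p (h p)
  obtain ⟨k, hk⟩ := isInt_of_norm_le fun p => h1 β α p (h p).symm
  have hα : (α : ℚ) ≠ 0 := α.ne_zero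
  have hβ : (β : ℚ) ≠ 0 := β.ne_zero
  have hjk : j * k = 1 := by
    have : (α : ℚ) / β * (β / α) = 1 := by field_simp
    rw [hj, hk] at this
    exact_mod_cast this
  rw [div_eq_iff hβ] at hj
  rcases Int.eq_one_or_neg_one_of_mul_eq_one hjk with h | h
  · left; refine Units.ext ?_; rw [hj, h]; simp
  · right; refine Units.ext ?_; rw [hj, h]; simp

/-- The factor of `θ_{m, χ, t}` which does not depend on `t`. -/
def thetaFactor (n : Nat.Primes →₀ ℕ) (m : ℕ+) (χ : CharM n) (x : Adele) (u : FinIdele) : ℂ :=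
  psi (ratAdele (freq n (m : ℕ)) * x) * vec n m χ (finFreq n m * u) +
    psi (ratAdele (freq n (-(m : ℕ))) * x) * vec n m χ (finFreq n m * negFin * u)

theorem norm_thetaFactor_le (m : ℕ+) (χ : CharM n) (x : Adele) (u : FinIdele) :
    ‖thetaFactor n m χ x u‖ ≤ 2 := by
  refine (norm_add_le _ _).trans ?_
  rw [norm_mul, norm_mul, Circle.norm_coe, Circle.norm_coe, one_mul, one_mul]
  linarith [norm_vec_le m χ (finFreq n m * u), norm_vec_le m χ (finFreq n m * negFin * u)]

theorem measurable_thetaFactor (m : ℕ+) (χ : CharM n) :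
    Measurable fun z : Adele × FinIdele => thetaFactor n m χ z.1 z.2 := by
  have h : ∀ α : FinIdele, Measurable fun z : Adele × FinIdele => vec n m χ (α * z.2) := fun α =>
    ((continuous_vec m χ).comp (continuous_const_mul α)).measurable.comp measurable_snd
  exact (((measurable_psi_mul _).comp measurable_fst).mul (h _)).add
    (((measurable_psi_mul _).comp measurable_fst).mul (h _))

theorem vecTensor_logCoord (m : ℕ+) (χ : CharM n) (t : ℝ) (α : Idele) (w : ℝ × FinIdele)
    (hα : |(α.1 : ℝ)| = (posFreq n m : ℚ)) :
    vecTensor n m χ t (α * logCoord w) = vec n m χ (α.2 * w.2) *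
      Complex.exp (t * ((w.1 + Real.log (posFreq n m : ℚ) : ℝ) : ℂ) * Complex.I) := by
  have hpos : (0 : ℝ) < (posFreq n m : ℚ) := by exact_mod_cast posFreq_pos m
  have h1 : |((α * logCoord w).1 : ℝ)| = Real.exp (w.1 + Real.log (posFreq n m : ℚ)) := by
    change |(α.1 : ℝ) * Real.exp w.1| = _
    rw [abs_mul, hα, Real.abs_exp, Real.exp_add, Real.exp_log hpos, mul_comm]
  rw [vecTensor, h1, Complex.cpow_def_of_ne_zero (by exact_mod_cast Real.exp_ne_zero _),
    ← Complex.ofReal_log (Real.exp_pos _).le, Real.log_exp]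
  congr 2
  ring

/-- Since `w.2` is a unit, a nonzero term needs `|α|_p = |m/N|_p` for all `p`, so only `α = ±m/N`
survive. Both have real absolute value `m/N` and hence share the same exponential in `t`. -/
theorem theta_proj_logCoord (m : ℕ+) (χ : CharM n) (t : ℝ) (x : Adele) {w : ℝ × FinIdele}
    (hw : w.2 ∈ (zHatUnits : Set FinIdele)) :
    theta n m χ t (proj (x, logCoord w)) = thetaFactor n m χ x w.2 *
      Complex.exp (t * ((w.1 + Real.log (posFreq n m : ℚ) : ℝ) : ℂ) * Complex.I) := by
  classical
  have hne : posFreq n m ≠ -posFreq n m := fun h => by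
    have h1 := congrArg Units.val h
    rw [Units.val_neg] at h1
    have := posFreq_pos (n := n) m
    linarith
  have hpos : (0 : ℝ) < (posFreq n m : ℚ) := by exact_mod_cast posFreq_pos m
  change ∑' α : ℚˣ, (psi (ratAdele (α : ℚ) * x) : ℂ) *
    vecTensor n m χ t (ratIdele α * logCoord w) = _
  rw [tsum_eq_sum (s := {posFreq n m, -posFreq n m}), Finset.sum_pair hne,
    vecTensor_logCoord m χ t (ratIdele (posFreq n m)) w (abs_of_pos hpos),
    vecTensor_logCoord m χ t (ratIdele (-posFreq n m)) w]
  · have h1 : ((-posFreq n m : ℚˣ) : ℚ) = freq n (-(m : ℕ)) := by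
      rw [Units.val_neg, coe_posFreq, freq, freq]
      push_cast
      ring
    have h2 : (ratIdele (-posFreq n m)).2 = finFreq n m * negFin := by
      rw [finFreq, negFin, ← Prod.snd_mul, ← map_mul, mul_neg, mul_one]
    rw [h1, h2, coe_posFreq, thetaFactor, finFreq]
    ring
  · change |(((-posFreq n m : ℚˣ) : ℚ) : ℝ)| = _
    rw [Units.val_neg, Rat.cast_neg, abs_neg, abs_of_pos hpos]
  · intro α hα
    have h3 : vec n m χ (ratIdele α * logCoord w).2 = 0 := by
      refine vec_of_not_norm (fun h => hα ?_) χ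
      have h4 : ∀ p : Nat.Primes, ‖((α : ℚ) : ℚ_[(p : ℕ)])‖ =
          ‖((posFreq n m : ℚ) : ℚ_[(p : ℕ)])‖ := fun p =>
        (norm_mul_of_mem_zHatUnits (ratIdele α).2 hw p).symm.trans (h p)
      rw [Finset.mem_insert, Finset.mem_singleton]
      exact eq_or_eq_neg_of_norm_eq h4
    rw [vecTensor, h3, zero_mul, mul_zero]

/-- The logarithmic coordinates of the representative of a class. -/
def logRep (q : AutQuot) : ℝ × FinIdele := ideleLog (rep q).a

theorem proj_logRep (q : AutQuot) : proj ((rep q).x, logCoord (logRep q)) = q := by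
  rw [logRep, logCoord_ideleLog (rep_mem q).2]
  exact toQuot_rep q

theorem logRep_mem (q : AutQuot) : (logRep q).2 ∈ (zHatUnits : Set FinIdele) :=
  mem_zHatUnits.2 (rep_mem q).2.2

theorem theta_eq (m : ℕ+) (χ : CharM n) (t : ℝ) (q : AutQuot) :
    theta n m χ t q = thetaFactor n m χ (rep q).x (logRep q).2 *
      Complex.exp (t * (((logRep q).1 + Real.log (posFreq n m : ℚ) : ℝ) : ℂ) * Complex.I) := by
  have h := theta_proj_logCoord m χ t (rep q).x (logRep_mem q)
  rwa [proj_logRep] at h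

theorem norm_exp_mul_I (t s : ℝ) : ‖Complex.exp (t * (s : ℂ) * Complex.I)‖ = 1 := by
  rw [← Complex.ofReal_mul, Complex.norm_exp_ofReal_mul_I]

theorem norm_theta_le (m : ℕ+) (χ : CharM n) (t : ℝ) (q : AutQuot) : ‖theta n m χ t q‖ ≤ 2 := by
  rw [theta_eq, norm_mul, norm_exp_mul_I, mul_one]
  exact norm_thetaFactor_le m χ _ _

theorem continuous_theta (m : ℕ+) (χ : CharM n) (q : AutQuot) :
    Continuous fun t => theta n m χ t q := by
  simp_rw [theta_eq]
  fun_prop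

theorem measurable_theta (m : ℕ+) (χ : CharM n) (t : ℝ) : Measurable (theta n m χ t) := by
  have h : Measurable logRep := measurable_ideleLog.comp (measurable_a.comp measurable_rep)
  have h1 : theta n m χ t = fun q => thetaFactor n m χ (rep q).x (logRep q).2 *
      Complex.exp (t * (((logRep q).1 + Real.log (posFreq n m : ℚ) : ℝ) : ℂ) * Complex.I) :=
    funext fun q => theta_eq m χ t q
  rw [h1]
  refine ((measurable_thetaFactor m χ).comp
    ((measurable_x.comp measurable_rep).prodMk (measurable_snd.comp h))).mul ?_
  have h2 : Continuous fun s : ℝ => Complex.exp (t * ((s + Real.log (posFreq n m : ℚ) : ℝ) : ℂ) *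
    Complex.I) := by fun_prop
  exact h2.measurable.comp (measurable_fst.comp h)

theorem integrable_mul_conj_theta {f : AutQuot → ℂ} (hf : Integrable f quotMeasure) (m : ℕ+)
    (χ : CharM n) (t : ℝ) : Integrable (fun q => f q * conj (theta n m χ t q)) quotMeasure :=
  hf.mul_bdd (c := 2)
    (Complex.continuous_conj.measurable.comp (measurable_theta m χ t)).aestronglyMeasurable
    (ae_of_all _ fun q => by rw [RCLike.norm_conj]; exact norm_theta_le m χ t q)

theorem integrable_mul_theta {h : ℝ → ℂ} (hh : Integrable h) (m : ℕ+) (χ : CharM n)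
    (q : AutQuot) : Integrable fun t => h t * theta n m χ t q :=
  hh.mul_bdd (c := 2) (continuous_theta m χ q).aestronglyMeasurable
    (ae_of_all _ fun t => norm_theta_le m χ t q)

end Theta

/-! ### The spectral coefficients -/

section Spectral

variable {n : Nat.Primes →₀ ℕ}

/-- The coefficient of `v_{m, χ}` in the Fourier coefficient of `f` of index `m / N`, as a
function of the logarithm of the real coordinate. -/
def vecCoeff (n : Nat.Primes →₀ ℕ) (f : AutQuot → ℂ) (m : ℕ+) (χ : CharM n) (s : ℝ) : ℂ :=
  ∫ u, logCoeff n f (m : ℕ) (s, u) * conj (vec n m χ (finFreq n m * u)) ∂unitMeasure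

/-- Substituting `-u` for `u` carries the coefficient of index `-m` to that of index `m`. The equal
contributions of the two frequencies are the source of the factor 2 in the pairing. -/
theorem vecCoeff_eq_integral_neg {f : AutL2} (hfK : f ∈ fixedK n) (m : ℕ+) :
    ∀ᵐ s : ℝ, ∀ χ : CharM n, ∫ u, logCoeff n f (-(m : ℕ)) (s, u) *
      conj (vec n m χ (finFreq n m * negFin * u)) ∂unitMeasure = vecCoeff n f m χ s := by
  have hm : ((m : ℕ) : ℤ) ≠ 0 := by exact_mod_cast m.ne_zero
  filter_upwards [logCoeff_neg_ae (n := n) hfK hm] with s hs χ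
  have hme : MeasurableEmbedding fun u : FinIdele => negFin * u :=
    (MeasurableEquiv.mulLeft negFin).measurableEmbedding
  rw [vecCoeff]
  refine Eq.trans ?_ ((measurePreserving_unitMeasure negFin_mem).integral_comp hme
    fun u => logCoeff n f (m : ℕ) (s, u) * conj (vec n m χ (finFreq n m * u)))
  refine integral_congr_ae ?_
  filter_upwards [hs] with u hu
  rw [hu, mul_assoc]

theorem conj_thetaFactor (m : ℕ+) (χ : CharM n) (x : Adele) (u : FinIdele) :
    conj (thetaFactor n m χ x u) =
      conj (psi (ratAdele (freq n (m : ℕ)) * x) : ℂ) * conj (vec n m χ (finFreq n m * u)) +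
        conj (psi (ratAdele (freq n (-(m : ℕ))) * x) : ℂ) *
          conj (vec n m χ (finFreq n m * negFin * u)) :=
  (map_add conj _ _).trans (congrArg₂ (· + ·) (map_mul conj _ _) (map_mul conj _ _))

theorem conj_exp_mul_I (t s : ℝ) : conj (Complex.exp (t * (s : ℂ) * Complex.I)) =
    Complex.exp (-(t * (s : ℂ) * Complex.I)) := by
  rw [← Complex.exp_conj, map_mul, map_mul, Complex.conj_I, Complex.conj_ofReal,
    Complex.conj_ofReal, mul_neg]

variable {f : AutL2} (hf : f ∈ H1) (hfK : f ∈ fixedK n) (hI : Integrable (opI f) ideleMeasure)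

include hf hI

theorem lintegral_tsum_logCoeff_lt_top :
    ∫⁻ w, ∑' k : ℤ, ‖logCoeff n f k w‖ₑ ∂((volume : Measure ℝ).prod unitMeasure) < ∞ := by
  have hm : Measurable fun a => ∑' k : ℤ, ‖coeff n f k a‖ₑ :=
    Measurable.tsum fun k => (measurable_coeff f k).enorm
  have h := measurePreserving_logCoord.lintegral_comp hm
  exact (h.le).trans_lt (lintegral_tsum_coeff_lt_top (n := n) hf hI)

theorem integrable_logCoeff (k : ℤ) :
    Integrable (logCoeff n f k) ((volume : Measure ℝ).prod unitMeasure) :=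
  ⟨(measurable_logCoeff f k).aestronglyMeasurable,
    (lintegral_mono fun w => ENNReal.le_tsum (f := fun k => ‖logCoeff n f k w‖ₑ) k).trans_lt
      (lintegral_tsum_logCoeff_lt_top hf hI)⟩

theorem ae_tsum_lintegral_logCoeff_lt_top :
    ∀ᵐ s : ℝ, ∑' k : ℤ, ∫⁻ u, ‖logCoeff n f k (s, u)‖ₑ ∂unitMeasure < ∞ := by
  have hm : Measurable fun w => ∑' k : ℤ, ‖logCoeff n f k w‖ₑ :=
    Measurable.tsum fun k => (measurable_logCoeff f k).enorm
  have h := lintegral_tsum_logCoeff_lt_top (n := n) hf hI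
  rw [lintegral_prod _ hm.aemeasurable] at h
  filter_upwards [ae_lt_top hm.lintegral_prod_right' h.ne] with s hs
  rwa [lintegral_tsum (f := fun k u => ‖logCoeff n f k (s, u)‖ₑ) fun k =>
    ((measurable_logCoeff f k).comp measurable_prodMk_left).enorm.aemeasurable] at hs

theorem integrable_logCoeff_mul_vec (k : ℤ) (m : ℕ+) (χ : CharM n) (α : FinIdele) :
    Integrable (fun w : ℝ × FinIdele => logCoeff n f k w * conj (vec n m χ (α * w.2)))
      ((volume : Measure ℝ).prod unitMeasure) := by
  refine (integrable_logCoeff hf hI k).mul_bdd (c := 1) ?_ (ae_of_all _ fun u => ?_)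
  · exact ((Complex.continuous_conj.comp ((continuous_vec m χ).comp
      (continuous_const_mul α))).measurable.comp measurable_snd).aestronglyMeasurable
  · rw [RCLike.norm_conj]
    exact norm_vec_le m χ _

theorem integrable_vecCoeff (m : ℕ+) (χ : CharM n) : Integrable (vecCoeff n f m χ) :=
  (integrable_logCoeff_mul_vec hf hI (m : ℕ) m χ (finFreq n m)).integral_prod_left

include hfK

/-- Integrating in `x` against the two characters in `θ` extracts the coefficients of index `±m`.
Integrability of `f` gives integrability of almost every slice, so the integral may be split. -/
theorem ae_integral_mul_conj_theta (m : ℕ+) (χ : CharM n) (t : ℝ) :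
    ∀ᵐ a ∂(ideleMeasure.restrict GA.ideleDomain),
      ∫ x in GA.adeleDomain, f (proj (x, a)) * conj (theta n m χ t (proj (x, a))) ∂adeleMeasure =
      Complex.exp (-(t * (((ideleLog a).1 + Real.log (posFreq n m : ℚ) : ℝ) : ℂ) * Complex.I)) *
      (logCoeff n f (m : ℕ) (ideleLog a) * conj (vec n m χ (finFreq n m * (ideleLog a).2)) +
        logCoeff n f (-(m : ℕ)) (ideleLog a) *
          conj (vec n m χ (finFreq n m * negFin * (ideleLog a).2))) := by
  have h1 : Integrable (fun z => f (proj z)) domainMeasure :=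
    measurePreserving_proj.integrable_comp_of_integrable (integrable_of_integrable_opI hf hfK hI)
  filter_upwards [h1.prod_left_ae, ae_restrict_mem measurableSet_ideleDomain] with a ha haD
  have hint : ∀ q : ℚ, Integrable (fun x => f (proj (x, a)) * conj (psi (ratAdele q * x) : ℂ))
      (adeleMeasure.restrict GA.adeleDomain) := fun q => by
    refine ha.mul_bdd (c := 1)
      (Complex.continuous_conj.measurable.comp (measurable_psi_mul q)).aestronglyMeasurable
      (ae_of_all _ fun x => ?_)
    rw [RCLike.norm_conj, Circle.norm_coe]
  have hw : (ideleLog a).2 ∈ (zHatUnits : Set FinIdele) := mem_zHatUnits.2 haD.2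
  have h2 : ∀ x, f (proj (x, a)) * conj (theta n m χ t (proj (x, a))) =
      Complex.exp (-(t * (((ideleLog a).1 + Real.log (posFreq n m : ℚ) : ℝ) : ℂ) * Complex.I)) *
      (f (proj (x, a)) * conj (psi (ratAdele (freq n (m : ℕ)) * x) : ℂ) *
          conj (vec n m χ (finFreq n m * (ideleLog a).2)) +
        f (proj (x, a)) * conj (psi (ratAdele (freq n (-(m : ℕ))) * x) : ℂ) *
          conj (vec n m χ (finFreq n m * negFin * (ideleLog a).2))) := fun x => by
    have h3 := theta_proj_logCoord m χ t x hw
    rw [logCoord_ideleLog haD] at h3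
    rw [h3, map_mul, conj_exp_mul_I, conj_thetaFactor]
    ring
  rw [integral_congr_ae (ae_of_all _ h2), integral_const_mul, integral_add
    ((hint _).mul_const _) ((hint _).mul_const _), integral_mul_const, integral_mul_const,
    logCoeff, logCoeff, logCoord_ideleLog haD]
  rfl

/-- After the `x`-integration and the one over units, what remains is an integral over `s = log
a_∞`. The shift by `log(m/N)` in the exponent of `θ` comes out as a phase. -/
theorem pairing_eq (m : ℕ+) (χ : CharM n) (t : ℝ) :
    pairing n f m χ t = 2 * Complex.exp (-(t * (Real.log (posFreq n m : ℚ) : ℂ) * Complex.I)) *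
      fourierExp (vecCoeff n f m χ) t := by
  have hint := integrable_mul_conj_theta (integrable_of_integrable_opI hf hfK hI) m χ t
  have hint' : Integrable (fun z => f (proj z) * conj (theta n m χ t (proj z)))
      ((adeleMeasure.restrict GA.adeleDomain).prod (ideleMeasure.restrict GA.ideleDomain)) :=
    measurePreserving_proj.integrable_comp_of_integrable hint
  set E : ℝ × FinIdele → ℂ := fun w =>
    Complex.exp (-(t * ((w.1 + Real.log (posFreq n m : ℚ) : ℝ) : ℂ) * Complex.I)) with hE
  set Φ : ℝ × FinIdele → ℂ := fun w => E w *
      (logCoeff n f (m : ℕ) w * conj (vec n m χ (finFreq n m * w.2)) +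
        logCoeff n f (-(m : ℕ)) w * conj (vec n m χ (finFreq n m * negFin * w.2))) with hΦ
  have hi1 := integrable_logCoeff_mul_vec hf hI (m : ℕ) m χ (finFreq n m)
  have hi2 := integrable_logCoeff_mul_vec hf hI (-(m : ℕ)) m χ (finFreq n m * negFin)
  have hΦi : Integrable Φ ((volume : Measure ℝ).prod unitMeasure) := by
    refine (hi1.add hi2).bdd_mul (c := 1) ?_ (ae_of_all _ fun w => ?_)
    · exact Continuous.aestronglyMeasurable (by fun_prop)
    · rw [hE]
      simp only [← neg_mul, ← Complex.ofReal_neg]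
      exact (norm_exp_mul_I _ _).le
  have h1 : pairing n f m χ t = ∫ w, Φ w ∂((volume : Measure ℝ).prod unitMeasure) := by
    rw [pairing, ← integral_comp_proj hint.aestronglyMeasurable, domainMeasure,
      integral_prod_symm _ hint',
      integral_congr_ae (ae_integral_mul_conj_theta hf hfK hI m χ t),
      ← measurePreserving_ideleLog.map_eq, integral_map measurable_ideleLog.aemeasurable]
    rw [measurePreserving_ideleLog.map_eq]
    exact hΦi.aestronglyMeasurable
  rw [h1, integral_prod _ hΦi, fourierExp, ← integral_const_mul]
  refine integral_congr_ae ?_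
  filter_upwards [hi1.prod_right_ae, hi2.prod_right_ae, vecCoeff_eq_integral_neg hfK m]
    with s h2 h3 h4
  have h5 : ∫ u, Φ (s, u) ∂unitMeasure = E (s, 1) *
      ∫ u, (logCoeff n f (m : ℕ) (s, u) * conj (vec n m χ (finFreq n m * u)) +
        logCoeff n f (-(m : ℕ)) (s, u) * conj (vec n m χ (finFreq n m * negFin * u)))
          ∂unitMeasure :=
    integral_const_mul (E (s, 1)) fun u =>
      logCoeff n f (m : ℕ) (s, u) * conj (vec n m χ (finFreq n m * u)) +
        logCoeff n f (-(m : ℕ)) (s, u) * conj (vec n m χ (finFreq n m * negFin * u))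
  rw [h5, integral_add h2 h3, h4 χ, ← vecCoeff, hE]
  have h6 : Complex.exp (-(t * ((s + Real.log (posFreq n m : ℚ) : ℝ) : ℂ) * Complex.I)) =
      Complex.exp (-(t * (Real.log (posFreq n m : ℚ) : ℂ) * Complex.I)) *
        Complex.exp (-(t * s * Complex.I)) := by
    rw [← Complex.exp_add]
    congr 1
    push_cast
    ring
  simp only [h6]
  ring

theorem integrable_fourierExp_vecCoeff {m : ℕ+} {χ : CharM n}
    (hF : Integrable fun t : ℝ => pairing n f m χ t) :
    Integrable (fourierExp (vecCoeff n f m χ)) := by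
  have h : fourierExp (vecCoeff n f m χ) = fun t : ℝ =>
      (2⁻¹ * Complex.exp (t * (Real.log (posFreq n m : ℚ) : ℂ) * Complex.I)) *
        pairing n f m χ t := funext fun t => by
    rw [pairing_eq hf hfK hI, Complex.exp_neg]
    field_simp [Complex.exp_ne_zero]
  rw [h]
  refine hF.bdd_mul (c := 1) (Continuous.aestronglyMeasurable (by fun_prop))
    (ae_of_all _ fun t => ?_)
  rw [norm_mul, norm_exp_mul_I, mul_one, norm_inv, Complex.norm_ofNat]
  norm_num

/-- The phase of the pairing cancels the one in `θ`, inversion yields `2π`, and with the factor 2 of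
the pairing this accounts for `4π`. The exceptional set lies in `s` alone, because `x` and `u` enter
only through a factor independent of `t`. -/
theorem ae_spectral_integral {m : ℕ+} {χ : CharM n}
    (hF : Integrable fun t : ℝ => pairing n f m χ t) :
    ∀ᵐ s : ℝ, ∀ x : Adele, ∀ u ∈ (zHatUnits : Set FinIdele),
      (1 / (4 * (Real.pi : ℂ))) *
        ∫ t : ℝ, pairing n f m χ t * theta n m χ t (proj (x, logCoord (s, u))) =
      thetaFactor n m χ x u * vecCoeff n f m χ s := by
  filter_upwards [ae_integral_fourierExp (integrable_vecCoeff hf hI m χ)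
    (integrable_fourierExp_vecCoeff hf hfK hI hF)] with s hs x u hu
  have h1 : ∀ t : ℝ, pairing n f m χ t * theta n m χ t (proj (x, logCoord (s, u))) =
      2 * thetaFactor n m χ x u *
        (fourierExp (vecCoeff n f m χ) t * Complex.exp (t * s * Complex.I)) := fun t => by
    have h2 : Complex.exp (t * ((s + Real.log (posFreq n m : ℚ) : ℝ) : ℂ) * Complex.I) =
        Complex.exp (t * (Real.log (posFreq n m : ℚ) : ℂ) * Complex.I) *
          Complex.exp (t * s * Complex.I) := by
      rw [← Complex.exp_add]
      congr 1
      push_cast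
      ring
    rw [pairing_eq hf hfK hI, theta_proj_logCoord m χ t x (w := (s, u)) hu, h2, Complex.exp_neg]
    field_simp [Complex.exp_ne_zero]
  have hpi : (Real.pi : ℂ) ≠ 0 := by exact_mod_cast Real.pi_ne_zero
  rw [integral_congr_ae (ae_of_all _ h1), integral_const_mul, hs]
  field_simp
  ring

end Spectral

/-! ### The spectral expansion -/

section Expand

variable {n : Nat.Primes →₀ ℕ} {f : AutL2}

theorem norm_vecCoeff_le {s : ℝ} (hs : ∑' k : ℤ, ∫⁻ u, ‖logCoeff n f k (s, u)‖ₑ ∂unitMeasure < ∞)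
    (m : ℕ+) (χ : CharM n) :
    ‖vecCoeff n f m χ s‖ ≤ (∫⁻ u, ‖logCoeff n f (m : ℕ) (s, u)‖ₑ ∂unitMeasure).toReal := by
  rw [← toReal_enorm]
  refine ENNReal.toReal_mono ((ENNReal.le_tsum
    (f := fun k : ℤ => ∫⁻ u, ‖logCoeff n f k (s, u)‖ₑ ∂unitMeasure) (m : ℕ)).trans_lt hs).ne ?_
  refine (enorm_integral_le_lintegral_enorm _).trans (lintegral_mono fun u => ?_)
  rw [enorm_mul]
  refine mul_le_of_le_one_right' ?_
  rw [← ofReal_norm, RCLike.norm_conj]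
  exact ENNReal.ofReal_le_one.2 (norm_vec_le m χ _)

/-- `thetaFactor` is bounded by 2 and `vecCoeff` by the `L¹` norm over the units of the coefficient
of index `m`, and these norms are summable for the given `s`. -/
theorem summable_thetaFactor_mul_vecCoeff {s : ℝ}
    (hs : ∑' k : ℤ, ∫⁻ u, ‖logCoeff n f k (s, u)‖ₑ ∂unitMeasure < ∞) (χ : CharM n) (x : Adele)
    (u : FinIdele) : Summable fun m : ℕ+ => thetaFactor n m χ x u * vecCoeff n f m χ s := by
  have h1 : Summable fun m : ℕ+ =>
      (∫⁻ u, ‖logCoeff n f (m : ℕ) (s, u)‖ₑ ∂unitMeasure).toReal :=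
    (ENNReal.summable_toReal hs.ne).comp_injective (i := fun m : ℕ+ => ((m : ℕ) : ℤ))
      fun a b h => PNat.coe_injective (Int.ofNat_injective h)
  refine Summable.of_norm_bounded (h1.mul_left 2) fun m => ?_
  rw [norm_mul]
  exact mul_le_mul (norm_thetaFactor_le m χ x u) (norm_vecCoeff_le hs m χ) (norm_nonneg _)
    zero_le_two

theorem integrable_logCoeff_slice {s : ℝ}
    (hs : ∑' k : ℤ, ∫⁻ u, ‖logCoeff n f k (s, u)‖ₑ ∂unitMeasure < ∞) (k : ℤ) :
    Integrable (fun u => logCoeff n f k (s, u)) unitMeasure :=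
  ⟨((measurable_logCoeff f k).comp measurable_prodMk_left).aestronglyMeasurable,
    (ENNReal.le_tsum (f := fun k : ℤ => ∫⁻ u, ‖logCoeff n f k (s, u)‖ₑ ∂unitMeasure) k).trans_lt hs⟩

/-- Each summand of `thetaFactor` is matched with the integral at its own frequency, using `hneg`
for `-m`; character orthogonality then recovers both Fourier coefficients at `u`. -/
theorem sum_thetaFactor_mul_vecCoeff {s : ℝ} {u : FinIdele}
    (hs : ∑' k : ℤ, ∫⁻ u, ‖logCoeff n f k (s, u)‖ₑ ∂unitMeasure < ∞)
    (hu : u ∈ (zHatUnits : Set FinIdele))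
    (hinv : ∀ k : ℤ, ∀ᵐ b ∂unitMeasure, b ∈ congrSet n →
      logCoeff n f k (s, u * b) = logCoeff n f k (s, u))
    {m : ℕ+} (hneg : ∀ χ : CharM n, ∫ u, logCoeff n f (-(m : ℕ)) (s, u) *
      conj (vec n m χ (finFreq n m * negFin * u)) ∂unitMeasure = vecCoeff n f m χ s) (x : Adele) :
    ∑ χ : CharM n, thetaFactor n m χ x u * vecCoeff n f m χ s =
      logCoeff n f (m : ℕ) (s, u) * psi (ratAdele (freq n (m : ℕ)) * x) +
        logCoeff n f (-(m : ℕ)) (s, u) * psi (ratAdele (freq n (-(m : ℕ))) * x) := by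
  have h1 := sum_vec_mul_integral (integrable_logCoeff_slice hs (m : ℕ)) (norm_finFreq m) hu
    (hinv _)
  have h2 := sum_vec_mul_integral (integrable_logCoeff_slice hs (-(m : ℕ)))
    (norm_negFin_mul_finFreq m) hu (hinv _)
  have h3 : ∀ χ : CharM n, thetaFactor n m χ x u * vecCoeff n f m χ s =
      psi (ratAdele (freq n (m : ℕ)) * x) * (vec n m χ (finFreq n m * u) * vecCoeff n f m χ s) +
      psi (ratAdele (freq n (-(m : ℕ))) * x) * (vec n m χ (finFreq n m * negFin * u) *
        ∫ u, logCoeff n f (-(m : ℕ)) (s, u) *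
          conj (vec n m χ (finFreq n m * negFin * u)) ∂unitMeasure) := fun χ => by
    rw [hneg χ, thetaFactor]
    ring
  rw [Finset.sum_congr rfl fun χ _ => h3 χ, Finset.sum_add_distrib, ← Finset.mul_sum,
    ← Finset.mul_sum, h2]
  refine (congrArg₂ (· + ·) (congrArg _ h1) rfl).trans ?_
  ring

/-- The finite sum over characters passes inside the absolutely convergent series, and the terms `m`
and `-m` together with the vanishing term 0 exhaust `ℤ`. -/
theorem sum_tsum_thetaFactor_mul_vecCoeff {s : ℝ} {u : FinIdele}
    (hs : ∑' k : ℤ, ∫⁻ u, ‖logCoeff n f k (s, u)‖ₑ ∂unitMeasure < ∞)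
    (hu : u ∈ (zHatUnits : Set FinIdele))
    (hinv : ∀ k : ℤ, ∀ᵐ b ∂unitMeasure, b ∈ congrSet n →
      logCoeff n f k (s, u * b) = logCoeff n f k (s, u))
    (hneg : ∀ (m : ℕ+) (χ : CharM n), ∫ u, logCoeff n f (-(m : ℕ)) (s, u) *
      conj (vec n m χ (finFreq n m * negFin * u)) ∂unitMeasure = vecCoeff n f m χ s)
    (hsum : Summable fun k : ℤ => ‖logCoeff n f k (s, u)‖) (h0 : logCoeff n f 0 (s, u) = 0)
    (x : Adele) :
    ∑ χ : CharM n, ∑' m : ℕ+, thetaFactor n m χ x u * vecCoeff n f m χ s =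
      ∑' k : ℤ, logCoeff n f k (s, u) * psi (ratAdele (freq n k) * x) := by
  have hS : Summable fun k : ℤ => logCoeff n f k (s, u) * psi (ratAdele (freq n k) * x) := by
    refine Summable.of_norm_bounded hsum fun k => ?_
    rw [norm_mul, Circle.norm_coe, mul_one]
  have hp : Summable fun m : ℕ+ =>
      logCoeff n f (m : ℕ) (s, u) * psi (ratAdele (freq n (m : ℕ)) * x) :=
    hS.comp_injective (i := fun m : ℕ+ => ((m : ℕ) : ℤ))
      fun a b h => PNat.coe_injective (Int.ofNat_injective h)
  have hn : Summable fun m : ℕ+ =>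
      logCoeff n f (-(m : ℕ)) (s, u) * psi (ratAdele (freq n (-(m : ℕ))) * x) :=
    hS.comp_injective (i := fun m : ℕ+ => -((m : ℕ) : ℤ))
      fun a b h => PNat.coe_injective (Int.ofNat_injective (neg_injective h))
  rw [← Summable.tsum_finsetSum fun χ _ => summable_thetaFactor_mul_vecCoeff hs χ x u,
    tsum_congr fun m => sum_thetaFactor_mul_vecCoeff hs hu hinv (hneg m) x,
    hp.tsum_add hn, tsum_int_eq_zero_add_tsum_pnat hS, h0, zero_mul, zero_add]

/-- All the almost-everywhere conditions involve only `s`, `u` or `a`, so the exceptional set can be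
chosen independent of `x`. -/
theorem ae_logCoord_conditions (hf : f ∈ H1) (hfK : f ∈ fixedK n)
    (hI : Integrable (opI f) ideleMeasure)
    (hF : ∀ (m : ℕ+) (χ : CharM n), Integrable (fun t : ℝ => pairing n f m χ t)) :
    ∀ᵐ a ∂(ideleMeasure.restrict GA.ideleDomain), ∀ x : Adele,
      (∀ χ : CharM n, Summable fun m : ℕ+ =>
        (1 / (4 * (Real.pi : ℂ))) * ∫ t : ℝ, pairing n f m χ t * theta n m χ t (proj (x, a))) ∧
      ∑ χ : CharM n, ∑' m : ℕ+,
        (1 / (4 * (Real.pi : ℂ))) * ∫ t : ℝ, pairing n f m χ t * theta n m χ t (proj (x, a)) =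
      ∑' k : ℤ, coeff n f k a * psi (ratAdele (freq n k) * x) := by
  have hA := Measure.quasiMeasurePreserving_fst (μ := (volume : Measure ℝ)) (ν := unitMeasure)
  have h1 := hA.ae (ae_tsum_lintegral_logCoeff_lt_top (n := n) hf hI)
  have h2 := hA.ae (ae_all_iff.2 fun m : ℕ+ => vecCoeff_eq_integral_neg (n := n) hfK m)
  have h3 := hA.ae (ae_all_iff.2 fun m : ℕ+ => ae_all_iff.2 fun χ : CharM n =>
    ae_spectral_integral hf hfK hI (hF m χ))
  have h4 := ae_all_iff.2 fun k : ℤ => logCoeff_mul_congrSet_ae (n := n) hfK k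
  have hL := measurePreserving_ideleLog.quasiMeasurePreserving
  filter_upwards [hL.ae h1, hL.ae h2, hL.ae h3, hL.ae h4, summable_coeff_ae (n := n) hf hI,
    coeff_zero_ae (n := n) hf, ae_restrict_mem measurableSet_ideleDomain]
    with a h1 h2 h3 h4 h5 h6 haD x
  have hu : (ideleLog a).2 ∈ (zHatUnits : Set FinIdele) := mem_zHatUnits.2 haD.2
  have ha : ∀ k, logCoeff n f k ((ideleLog a).1, (ideleLog a).2) = coeff n f k a := fun k =>
    congrArg (coeff n f k) (logCoord_ideleLog haD)
  have h7 : ∀ (m : ℕ+) (χ : CharM n), (1 / (4 * (Real.pi : ℂ))) *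
      ∫ t : ℝ, pairing n f m χ t * theta n m χ t (proj (x, a)) =
      thetaFactor n m χ x (ideleLog a).2 * vecCoeff n f m χ (ideleLog a).1 := fun m χ => by
    have h8 := h3 m χ x _ hu
    have h9 : logCoord ((ideleLog a).1, (ideleLog a).2) = a := logCoord_ideleLog haD
    rwa [h9] at h8
  simp only [h7]
  refine ⟨fun χ => summable_thetaFactor_mul_vecCoeff h1 χ x _, ?_⟩
  have h8 := sum_tsum_thetaFactor_mul_vecCoeff h1 hu h4 h2 (by simpa only [ha] using h5)
    ((ha 0).trans h6) x
  rw [h8]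
  exact tsum_congr fun k => by rw [ha]

end Expand

end AxPlusB

end

theorem mainTheorem6 (n : Nat.Primes →₀ ℕ) (f : AutL2) (hf : f ∈ H1) (hfK : f ∈ fixedK n)
    (hI : Integrable (opI f) ideleMeasure)
    (hF : ∀ (m : ℕ+) (χ : CharM n), Integrable (fun t : ℝ => pairing n f m χ t)) :
    (∀ (m : ℕ+) (χ : CharM n) (t : ℝ),
      Integrable (fun g => f g * conj (theta n m χ t g)) quotMeasure) ∧
    (∀ (m : ℕ+) (χ : CharM n) (g : AutQuot),
      Integrable (fun t : ℝ => pairing n f m χ t * theta n m χ t g)) ∧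
    ∀ᵐ g ∂quotMeasure,
      (∀ χ : CharM n, Summable fun m : ℕ+ =>
        (1 / (4 * (Real.pi : ℂ))) * ∫ t : ℝ, pairing n f m χ t * theta n m χ t g) ∧
      f g = ∑ χ : CharM n, ∑' m : ℕ+,
        (1 / (4 * (Real.pi : ℂ))) * ∫ t : ℝ, pairing n f m χ t * theta n m χ t g := by
  refine ⟨integrable_mul_conj_theta (integrable_of_integrable_opI hf hfK hI),
    fun m χ g => integrable_mul_theta (hF m χ) m χ g, quotMeasure_ae_of_domain ?_⟩
  have h := Measure.quasiMeasurePreserving_snd (μ := adeleMeasure.restrict GA.adeleDomain)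
    (ν := ideleMeasure.restrict GA.ideleDomain) |>.ae (ae_logCoord_conditions hf hfK hI hF)
  -- Both sides equal the Fourier series of `f(·, a)` at `x`.
  filter_upwards [h, fourier_expansion hf hfK hI] with z hz hz'
  exact ⟨(hz z.1).1, hz'.trans (hz z.1).2.symm⟩
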